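/- For $A\in\mathbb{C}$ let $\zeta_1,\zeta_3,\zeta_5$ be the roots, with multiplicity, of $\zeta^3+4\zeta^2+4\zeta+4A$, numbered so that $\operatorname{Re}\zeta_5\le\operatorname{Re}\zeta_3\le\operatorname{Re}\zeta_1$ (for $A$ outside the rays $A\le 0$ and $A\ge\frac{8}{27}$ the inequalities are strict and the numbering is unique). On the two-sheeted (possibly degenerate) curve $$v^2=v(A,\zeta)^2=\zeta^4+4\zeta^3+4\zeta^2+4A\zeta=\zeta(\zeta-\zeta_1)(\zeta-\zeta_3)(\zeta-\zeta_5)$$ let $\mathbf{a}_*$ be the cycle that encircles the cut $[\zeta_5,\zeta_3]$, i.e. that runs over the segment from $\zeta_5$ to $\zeta_3$ on one sheet and back on the other sheet, and let $\mathbf{b}_*$ be the cycle that runs over the segment from $\zeta_3$ to $\zeta_1$ on one sheet and back on the other sheet. For $\phi\in\mathbb{R}$ we say that $A$ solves the Boutroux equations $(\mathrm{BE})_\phi$ if, for some such numbering and some such cycles (the orientation of the cycles is irrelevant), $$\operatorname{Re}\, e^{2i\phi}\int_{\mathbf{a}_*}\frac{v(A,\zeta)}{\zeta}\,d\zeta=\operatorname{Re}\,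 e^{2i\phi}\int_{\mathbf{b}_*}\frac{v(A,\zeta)}{\zeta}\,d\zeta=0 .$$ Proposition 8.15. There exists a function $\phi\mapsto A_\phi$ from $\mathbb{R}$ to $\mathbb{C}$ such that: (1) for each $\phi\in\mathbb{R}$, $A_\phi$ is the unique solution $A\in\mathbb{C}$ of $(\mathrm{BE})_\phi$; (2) $A_{\phi+\pi/2}=A_\phi$ and $A_{-\phi}=\overline{A_\phi}$ for all $\phi\in\mathbb{R}$; (3) $A_0=\frac{8}{27}$, $A_{\pm\pi/4}=0$, and $0\le\operatorname{Re}A_\phi\le\frac{8}{27}$ for all $\phi\in\mathbb{R}$; (4) $A_\phi$ is continuous in $\phi\in\mathbb{R}$ and smooth ($C^\infty$) in $\phi\in\mathbb{R}\setminus\{m\pi/4 : m\in\mathbb{Z}\}$. -/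

import Mathlib

open Complex

/-- The quartic `v(A, ζ)² = ζ⁴ + 4ζ³ + 4ζ² + 4Aζ`. -/
def quartic (A ζ : ℂ) : ℂ := ζ ^ 4 + 4 * ζ ^ 3 + 4 * ζ ^ 2 + 4 * A * ζ

/-- `ζ₁, ζ₃, ζ₅` are the roots of `ζ³ + 4ζ² + 4ζ + 4A`, with multiplicity, numbered by their real
parts: `Re ζ₅ ≤ Re ζ₃ ≤ Re ζ₁`. (For `A` off the two real rays `A ≤ 0` and `A ≥ 8/27` the
inequalities are automatically strict, so the numbering is unique.) -/
structure IsRootNumbering (A ζ₁ ζ₃ ζ₅ : ℂ) : Prop where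
  factor : ∀ ζ : ℂ, ζ ^ 3 + 4 * ζ ^ 2 + 4 * ζ + 4 * A = (ζ - ζ₁) * (ζ - ζ₃) * (ζ - ζ₅)
  re_five_le_three : ζ₅.re ≤ ζ₃.re
  re_three_le_one : ζ₃.re ≤ ζ₁.re

/-- The closed path in the `ζ`-plane, for `t ∈ [0, 2]`, which runs along the straight segment from
`p` to `q` (for `t ∈ [0, 1]`) and then back along it from `q` to `p` (for `t ∈ [1, 2]`). -/
noncomputable def thereAndBack (p q : ℂ) (t : ℝ) : ℂ := p + ((1 - |1 - t| : ℝ) : ℂ) * (q - p)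

/-- The closed path `t ↦ (thereAndBack p q t, v t)`, `t ∈ [0, 2]`, is the cycle over the segment
`[p, q]` on the two-sheeted curve `v² = quartic A ζ`: `v` is continuous, the path lies on the curve,
and it returns from `q` to `p` on the sheet opposite to the one on which it went from `p` to `q`.
Here `p` and `q` are to be branch points (or nodes, if the curve is degenerate). -/
structure IsCycleOver (A p q : ℂ) (v : ℝ → ℂ) : Prop where
  continuousOn : ContinuousOn v (Set.Icc 0 2)
  on_curve : ∀ t ∈ Set.Icc (0 : ℝ) 2, v t ^ 2 = quartic A (thereAndBack p q t)
  opposite_sheet : ∀ t ∈ Set.Icc (0 : ℝ) 2, v (2 - t) = -v t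

/-- The integral `∫ v(ζ)/ζ dζ` along the closed path `t ↦ (thereAndBack p q t, v t)`. -/
noncomputable def cycleIntegral (p q : ℂ) (v : ℝ → ℂ) : ℂ :=
  ∫ t in (0 : ℝ)..2, v t / thereAndBack p q t * deriv (thereAndBack p q) t

/-- `A` solves the Boutroux equations with parameter `φ`:
`Re e^{2iφ} ∫_{a} v/ζ dζ = Re e^{2iφ} ∫_{b} v/ζ dζ = 0`, where the cycle `a` encircles the cut
`[ζ₅, ζ₃]` (and is contracted onto it) and the cycle `b` goes from `ζ₃` to `ζ₁` on one sheet and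
back from `ζ₁` to `ζ₃` on the other. The orientation of a cycle (equivalently, the choice of the
sheet on which it starts) only affects the sign of its integral, hence not the equations. -/
def SolvesBoutroux (φ : ℝ) (A : ℂ) : Prop :=
  ∃ (ζ₁ ζ₃ ζ₅ : ℂ) (va vb : ℝ → ℂ),
    IsRootNumbering A ζ₁ ζ₃ ζ₅ ∧ IsCycleOver A ζ₅ ζ₃ va ∧ IsCycleOver A ζ₃ ζ₁ vb ∧
    (exp (2 * I * φ) * cycleIntegral ζ₅ ζ₃ va).re = 0 ∧
    (exp (2 * I * φ) * cycleIntegral ζ₃ ζ₁ vb).re = 0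

open Set Filter Topology MeasureTheory

/-! Everything is transported from elliptic periods to one hypergeometric function. Put x = 27A/8
and c = e^{2iφ}. The half-period of v/ζ dζ from 0 to a root u of the cubic is, up to a factor ±i,
J(u) = `periodJ u`. Since A is a function of u, differentiating under the integral and discarding
exact forms yields a Picard–Fuchs equation (`hasDerivAt_periodJ`, `hasDerivAt_periodK'`), which in
the variable x reads x(1-x)y'' = (2/9)y. It is invariant under x ↦ 1-x and is solved by Y(x) and
Y(1-x), where Y = `hyperY` is a multiple of z·₂F₁(1/3,2/3;2;z).

Root triples ordered by real part are parametrized rationally by m in the half-disc Re m ≥ 0, |m+1|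
≤ 2. Its open part with Im m < 0 is convex and is mapped into Im x > 0, so there is no monodromy.
The half-periods J₁, J₃, J₅ are therefore fixed combinations of Y(x) and Y(1-x), and the values at m
= 0 and m = 1 determine the coefficients (`exists_period_relations`): J₁ = αY(x), J₃ = αY(x) +
iβY(1-x), J₃ + J₅ = μJ₁, with α, β, μ real and nonzero. Up to sign the a-period is 2i(J₃ + J₅) and
the b-period is 2i(±J₁ ± J₃). The undetermined signs are harmless, and the Boutroux equations become
Im cY(x) = 0, Re cY(1-x) = 0 (`HyperBoutroux`, `solvesBoutroux_iff`). The half Im m > 0 follows by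
conjugation, and real m is treated directly.

The reduced equations are controlled by arguments in Euler's integral: the kernel (1-zt)^{-1/3} has
only a third of the argument of 1-zt, and sectors are preserved by positive averages. Outside the
disc |x - 1/2| ≤ 1/2 this makes Re(Y(1-x)·conj Y(x)) negative (`re_hyperY_mul_conj_neg`), whereas a
solution makes it zero. To the left of Re z = 1 the derivative F = Y' satisfies |arg F| < π/6, hence
so do difference quotients of Y. Two distinct solutions in the disc would give quotients P, Q and w
≠ 0 with wP real and wQ imaginary, which is impossible (`eq_zero_of_sector`,
`HyperBoutroux.unique`). The boundary of the half-disc of parameters is excluded by a limiting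
argument (`boundary_false`).

Existence is a continuity argument. A solution with φ = -π/8 lies on the line Re x = 1/2 by the
intermediate value theorem. The same sector estimate makes the Jacobian invertible, so the set of
solvable φ is a neighbourhood of each of its points that is not a multiple of π/4, and by
compactness of the disc it is closed. Uniqueness and compactness give continuity; the implicit
function theorem gives smoothness off the multiples of π/4. -/

/-! ### The principal square root -/

theorem sq_csqrt (z : ℂ) : Complex.sqrt z ^ 2 = z := by
  rw [Complex.sqrt]
  exact_mod_cast Complex.cpow_nat_inv_pow z (n := 2) (by norm_num)

theorem csqrt_ne_zero {z : ℂ} (hz : z ≠ 0) : Complex.sqrt z ≠ 0 := by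
  intro h
  apply hz
  rw [← sq_csqrt z, h]
  simp

theorem hasDerivAt_csqrt {z : ℂ} (hz : z ∈ slitPlane) :
    HasDerivAt Complex.sqrt (1 / (2 * Complex.sqrt z)) z := by
  have h := hasDerivAt_sqrt hz
  have h0 := csqrt_ne_zero (slitPlane_ne_zero hz)
  have h2 : HasDerivAt (fun w => Complex.sqrt w ^ 2) 1 z := by
    simpa [sq_csqrt] using hasDerivAt_id' z
  have h3 := (h.pow 2).unique h2
  convert h using 1
  rw [div_eq_iff (mul_ne_zero two_ne_zero h0)]
  generalize z ^ (-1 / 2 : ℂ) = y at *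
  norm_num at h3
  linear_combination -h3

/-- The convention arg = π on the negative axis makes the principal root continuous there from
above. This is what gives the half-periods boundary values at real roots. -/
theorem continuousOn_csqrt_im_nonneg : ContinuousOn Complex.sqrt {z : ℂ | 0 ≤ z.im} := by
  intro z hz
  by_cases h : 0 ≤ z.re ∨ z.im ≠ 0
  · exact (continuousAt_sqrt h).continuousWithinAt
  push Not at h
  have hz0 : z ≠ 0 := by rintro rfl; simp at h
  have h1 := continuousWithinAt_log_of_re_neg_of_im_zero h.1 h.2
  have h2 : ContinuousWithinAt (fun w => exp (log w / 2)) {z : ℂ | 0 ≤ z.im} z :=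
    (h1.div_const 2).cexp
  refine h2.congr_of_eventuallyEq ?_ (sqrt_eq_exp hz0)
  filter_upwards [mem_nhdsWithin_of_mem_nhds (isOpen_ne.mem_nhds hz0)] with w hw
  exact sqrt_eq_exp hw

theorem csqrt_ofReal_of_nonneg {x : ℝ} (hx : 0 ≤ x) : Complex.sqrt x = (√x : ℝ) := by
  rw [Complex.sqrt_of_nonneg (by exact_mod_cast hx)]
  simp

theorem csqrt_ofReal_of_nonpos {x : ℝ} (hx : x ≤ 0) : Complex.sqrt x = I * (√(-x) : ℝ) := by
  have := Complex.sqrt_neg_of_nonneg (a := ((-x : ℝ) : ℂ)) (by exact_mod_cast neg_nonneg.2 hx)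
  rw [csqrt_ofReal_of_nonneg (neg_nonneg.2 hx)] at this
  simpa using this

/-! ### Integrals depending on a parameter -/

/-- Differentiation under the integral sign for a jointly continuous derivative. -/
theorem hasDerivAt_integral_of_continuousOn_deriv {U : Set ℂ} (hU : IsOpen U) {f f' : ℂ → ℝ → ℂ}
    {a b : ℝ} (hf : ∀ z ∈ U, ContinuousOn (f z) (uIcc a b))
    (hf' : ContinuousOn (Function.uncurry f') (U ×ˢ uIcc a b))
    (hd : ∀ z ∈ U, ∀ t ∈ uIcc a b, HasDerivAt (fun z => f z t) (f' z t) z) {z : ℂ} (hz : z ∈ U) :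
    HasDerivAt (fun z => ∫ t in a..b, f z t) (∫ t in a..b, f' z t) z := by
  obtain ⟨r, hr, hrU⟩ := Metric.nhds_basis_closedBall.mem_iff.1 (hU.mem_nhds hz)
  have hK : IsCompact (Metric.closedBall z r ×ˢ uIcc a b) :=
    (isCompact_closedBall z r).prod isCompact_uIcc
  obtain ⟨C, hC⟩ := hK.exists_bound_of_continuousOn
    (hf'.mono (prod_mono hrU subset_rfl))
  have hsub : uIoc a b ⊆ uIcc a b := uIoc_subset_uIcc
  refine (intervalIntegral.hasDerivAt_integral_of_dominated_loc_of_deriv_le (μ := volume)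
    (F := f) (F' := f') (s := Metric.ball z r) (bound := fun _ => C)
    (Metric.ball_mem_nhds z hr) ?_ ?_ ?_ ?_ ?_ ?_).2
  · filter_upwards [hU.mem_nhds hz] with w hw
    exact ((hf w hw).mono hsub).aestronglyMeasurable measurableSet_uIoc
  · exact (hf z hz).intervalIntegrable
  · have : ContinuousOn (f' z) (uIcc a b) :=
      hf'.comp (f := fun t => (z, t)) (by fun_prop) (fun t ht => ⟨hz, ht⟩)
    exact (this.mono hsub).aestronglyMeasurable measurableSet_uIoc
  · exact Eventually.of_forall fun t ht w hw =>
      hC (w, t) ⟨Metric.ball_subset_closedBall hw, hsub ht⟩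
  · simp
  · exact Eventually.of_forall fun t ht w hw =>
      hd w (hrU (Metric.ball_subset_closedBall hw)) t (hsub ht)

/-- Continuity of an integral depending on a parameter, for a jointly continuous integrand. -/
theorem continuousOn_integral_of_continuousOn {s : Set ℂ} {f : ℂ → ℝ → ℂ} {a b : ℝ} (hab : a ≤ b)
    (hf : ContinuousOn (Function.uncurry f) (s ×ˢ Icc a b)) :
    ContinuousOn (fun z => ∫ t in a..b, f z t) s := by
  rw [continuousOn_iff_continuous_domRestrict]
  have h1 : Continuous (Function.uncurry fun (z : s) (t : ℝ) => f z (projIcc a b hab t)) := by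
    have : Continuous (fun p : s × ℝ => ((p.1 : ℂ), ((projIcc a b hab p.2 : Icc a b) : ℝ))) := by
      fun_prop
    exact hf.comp_continuous this fun p => ⟨p.1.2, (projIcc a b hab p.2).2⟩
  have h2 := intervalIntegral.continuous_parametric_intervalIntegral_of_continuous' (μ := volume)
    h1 a b
  refine h2.congr fun z => ?_
  refine intervalIntegral.integral_congr fun t ht => ?_
  rw [uIcc_of_le hab] at ht
  simp [projIcc_of_mem hab ht]

/-! ### Half-periods as functions of a root, and their Picard–Fuchs equation -/

/-- The square root of `rootQuad u (w ^ 2)` which is holomorphic in the upper half-plane. -/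
noncomputable def rootSqrt (u : ℂ) (w : ℝ) : ℂ :=
  Complex.sqrt ((1 + w + w ^ 2) * u + 2) * Complex.sqrt ((1 - w + w ^ 2) * u + 2)

/-- With `t = w ^ 2` this is the cofactor in
`P (u w²) = -u (1 - w²) rootQuad u (w²)`, where `u` is a root of the cubic `P`. -/
noncomputable def rootQuad (u t : ℂ) : ℂ := (t ^ 2 + t + 1) * u ^ 2 + 4 * (t + 1) * u + 4

theorem rootSqrt_sq (u : ℂ) (w : ℝ) : rootSqrt u w ^ 2 = rootQuad u (w ^ 2) := by
  rw [rootSqrt, mul_pow, sq_csqrt, sq_csqrt, rootQuad]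
  ring

/-- The coefficients 1 ± w + w² are positive, so both linear factors of `rootQuad u (w ^ 2)` stay in
the upper half-plane together with u. Hence the product of their principal roots is a holomorphic
branch. -/
theorem im_factor_pos {u : ℂ} (hu : 0 < u.im) (w : ℝ) :
    0 < ((1 + w + w ^ 2 : ℂ) * u + 2).im := by
  have : ((1 + w + w ^ 2 : ℂ) * u + 2).im = (1 + w + w ^ 2) * u.im := by
    have : (1 + w + w ^ 2 : ℂ) = ((1 + w + w ^ 2 : ℝ) : ℂ) := by push_cast; ring
    rw [this, add_im, im_ofReal_mul]; simp
  rw [this]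
  have : 0 < 1 + w + w ^ 2 := by nlinarith [sq_nonneg (w + 1)]
  positivity

theorem im_factor_pos' {u : ℂ} (hu : 0 < u.im) (w : ℝ) :
    0 < ((1 - w + w ^ 2 : ℂ) * u + 2).im := by
  have := im_factor_pos hu (-w)
  simpa [← sub_eq_add_neg] using this

theorem im_factor_nonneg {u : ℂ} (hu : 0 ≤ u.im) (w : ℝ) :
    0 ≤ ((1 + w + w ^ 2 : ℂ) * u + 2).im := by
  have : ((1 + w + w ^ 2 : ℂ) * u + 2).im = (1 + w + w ^ 2) * u.im := by
    have : (1 + w + w ^ 2 : ℂ) = ((1 + w + w ^ 2 : ℝ) : ℂ) := by push_cast; ring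
    rw [this, add_im, im_ofReal_mul]; simp
  rw [this]
  have : 0 < 1 + w + w ^ 2 := by nlinarith [sq_nonneg (w + 1)]
  positivity

theorem im_factor_nonneg' {u : ℂ} (hu : 0 ≤ u.im) (w : ℝ) :
    0 ≤ ((1 - w + w ^ 2 : ℂ) * u + 2).im := by
  have := im_factor_nonneg hu (-w)
  simpa [← sub_eq_add_neg] using this

theorem continuousOn_rootSqrt :
    ContinuousOn (Function.uncurry rootSqrt) ({u : ℂ | 0 ≤ u.im} ×ˢ univ) := by
  have h1 : ContinuousOn (fun p : ℂ × ℝ => Complex.sqrt ((1 + p.2 + p.2 ^ 2) * p.1 + 2))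
      ({u : ℂ | 0 ≤ u.im} ×ˢ univ) :=
    continuousOn_csqrt_im_nonneg.comp (by fun_prop) fun p hp => im_factor_nonneg hp.1 p.2
  have h2 : ContinuousOn (fun p : ℂ × ℝ => Complex.sqrt ((1 - p.2 + p.2 ^ 2) * p.1 + 2))
      ({u : ℂ | 0 ≤ u.im} ×ˢ univ) :=
    continuousOn_csqrt_im_nonneg.comp (by fun_prop) fun p hp => im_factor_nonneg' hp.1 p.2
  exact h1.mul h2

theorem rootSqrt_ne_zero {u : ℂ} (hu : 0 < u.im) (w : ℝ) : rootSqrt u w ≠ 0 := by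
  refine mul_ne_zero (csqrt_ne_zero fun h => ?_) (csqrt_ne_zero fun h => ?_)
  · exact (im_factor_pos hu w).ne' (by rw [h]; simp)
  · exact (im_factor_pos' hu w).ne' (by rw [h]; simp)

theorem hasDerivAt_rootSqrt {u : ℂ} (hu : 0 < u.im) (w : ℝ) :
    HasDerivAt (fun u => rootSqrt u w)
      ((2 * ((w : ℂ) ^ 4 + w ^ 2 + 1) * u + 4 * (w ^ 2 + 1)) / (2 * rootSqrt u w)) u := by
  have e1 : HasDerivAt (fun u : ℂ => (1 + w + w ^ 2 : ℂ) * u + 2) (1 + w + w ^ 2) u := by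
    simpa using ((hasDerivAt_id' u).const_mul (1 + w + w ^ 2 : ℂ)).add_const (2 : ℂ)
  have e2 : HasDerivAt (fun u : ℂ => (1 - w + w ^ 2 : ℂ) * u + 2) (1 - w + w ^ 2) u := by
    simpa using ((hasDerivAt_id' u).const_mul (1 - w + w ^ 2 : ℂ)).add_const (2 : ℂ)
  have m1 : (1 + w + w ^ 2 : ℂ) * u + 2 ∈ slitPlane := Or.inr (im_factor_pos hu w).ne'
  have m2 : (1 - w + w ^ 2 : ℂ) * u + 2 ∈ slitPlane := Or.inr (im_factor_pos' hu w).ne'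
  have h1 := (hasDerivAt_csqrt m1).comp u e1
  have h2 := (hasDerivAt_csqrt m2).comp u e2
  have n1 := csqrt_ne_zero (slitPlane_ne_zero m1)
  have n2 := csqrt_ne_zero (slitPlane_ne_zero m2)
  have s1 := sq_csqrt ((1 + w + w ^ 2 : ℂ) * u + 2)
  have s2 := sq_csqrt ((1 - w + w ^ 2 : ℂ) * u + 2)
  refine (h1.mul h2).congr_deriv ?_
  simp only [rootSqrt, Function.comp_apply]
  generalize Complex.sqrt ((1 + w + w ^ 2 : ℂ) * u + 2) = p at *
  generalize Complex.sqrt ((1 - w + w ^ 2 : ℂ) * u + 2) = q at *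
  field_simp
  rw [s1, s2]
  ring

/-- The substitution ζ = u sin²η turns ∫ v/ζ dζ from 0 to u into ±2iu times this integral and
removes the square-root singularities at both ends. -/
noncomputable def periodL (u : ℂ) : ℂ :=
  ∫ η in (0 : ℝ)..Real.pi / 2, (Real.cos η : ℂ) ^ 2 * rootSqrt u (Real.sin η)

/-- The same substitution applied to the holomorphic differential dζ/v, up to a constant factor. -/
noncomputable def periodK (u : ℂ) : ℂ :=
  ∫ η in (0 : ℝ)..Real.pi / 2, 1 / rootSqrt u (Real.sin η)

/-- The half-period of `v / ζ dζ` between `0` and a root `u` of the cubic in the upper half-plane,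
up to a factor `± I`. -/
noncomputable def periodJ (u : ℂ) : ℂ := 2 * u * periodL u

theorem continuousOn_periodJ : ContinuousOn periodJ {u : ℂ | 0 ≤ u.im} := by
  have : ContinuousOn periodL {u : ℂ | 0 ≤ u.im} := by
    refine continuousOn_integral_of_continuousOn (by positivity) ?_
    have h : ContinuousOn (fun p : ℂ × ℝ => rootSqrt p.1 (Real.sin p.2))
        ({u : ℂ | 0 ≤ u.im} ×ˢ Icc 0 (Real.pi / 2)) :=
      continuousOn_rootSqrt.comp (f := fun p : ℂ × ℝ => (p.1, Real.sin p.2)) (by fun_prop)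
        fun p hp => ⟨hp.1, mem_univ _⟩
    have h' : ContinuousOn (fun p : ℂ × ℝ => (Real.cos p.2 : ℂ) ^ 2)
        ({u : ℂ | 0 ≤ u.im} ×ˢ Icc 0 (Real.pi / 2)) := by fun_prop
    exact h'.mul h
  exact (continuousOn_const.mul continuousOn_id).mul this

theorem continuousOn_rootSqrt_sin :
    ContinuousOn (fun p : ℂ × ℝ => rootSqrt p.1 (Real.sin p.2)) ({u : ℂ | 0 < u.im} ×ˢ univ) :=
  continuousOn_rootSqrt.comp (f := fun p : ℂ × ℝ => (p.1, Real.sin p.2)) (by fun_prop)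
    fun p hp => ⟨(le_of_lt hp.1 : (0 : ℝ) ≤ p.1.im), mem_univ _⟩

theorem isOpen_upper : IsOpen {u : ℂ | 0 < u.im} := isOpen_lt continuous_const continuous_im

theorem continuous_rootSqrt_sin {u : ℂ} (hu : 0 < u.im) :
    Continuous fun η : ℝ => rootSqrt u (Real.sin η) :=
  continuousOn_rootSqrt_sin.comp_continuous (f := fun η : ℝ => (u, η)) (by fun_prop)
    fun η => ⟨hu, mem_univ _⟩

theorem hasDerivAt_periodL {u : ℂ} (hu : 0 < u.im) :
    HasDerivAt periodL (∫ η in (0 : ℝ)..Real.pi / 2, (Real.cos η : ℂ) ^ 2 *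
      ((2 * ((Real.sin η : ℂ) ^ 4 + (Real.sin η : ℂ) ^ 2 + 1) * u + 4 * ((Real.sin η : ℂ) ^ 2 + 1)) /
        (2 * rootSqrt u (Real.sin η)))) u := by
  change HasDerivAt (fun u => ∫ η in (0 : ℝ)..Real.pi / 2,
    (Real.cos η : ℂ) ^ 2 * rootSqrt u (Real.sin η)) _ u
  refine hasDerivAt_integral_of_continuousOn_deriv (f := fun u η => (Real.cos η : ℂ) ^ 2 * rootSqrt u (Real.sin η))
    (f' := fun u η => (Real.cos η : ℂ) ^ 2 *
      ((2 * ((Real.sin η : ℂ) ^ 4 + (Real.sin η : ℂ) ^ 2 + 1) * u + 4 * ((Real.sin η : ℂ) ^ 2 + 1)) /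
        (2 * rootSqrt u (Real.sin η))))
    isOpen_upper (fun z hz => ?_) ?_ ?_ hu
  · exact (Continuous.mul (by fun_prop) (continuous_rootSqrt_sin hz)).continuousOn
  · refine ContinuousOn.mul (by fun_prop) (ContinuousOn.div (by fun_prop) ?_ ?_)
    · exact continuousOn_const.mul (continuousOn_rootSqrt_sin.mono
        (prod_mono subset_rfl (subset_univ _)))
    · exact fun p hp => mul_ne_zero two_ne_zero (rootSqrt_ne_zero hp.1 _)
  · exact fun z hz t _ => (hasDerivAt_rootSqrt hz _).const_mul _

theorem hasDerivAt_periodK {u : ℂ} (hu : 0 < u.im) :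
    HasDerivAt periodK (∫ η in (0 : ℝ)..Real.pi / 2,
      -((2 * ((Real.sin η : ℂ) ^ 4 + (Real.sin η : ℂ) ^ 2 + 1) * u + 4 * ((Real.sin η : ℂ) ^ 2 + 1)) /
        (2 * rootSqrt u (Real.sin η))) / rootSqrt u (Real.sin η) ^ 2) u := by
  change HasDerivAt (fun u => ∫ η in (0 : ℝ)..Real.pi / 2, 1 / rootSqrt u (Real.sin η)) _ u
  have hc : ContinuousOn (fun p : ℂ × ℝ => rootSqrt p.1 (Real.sin p.2))
      ({u : ℂ | 0 < u.im} ×ˢ uIcc 0 (Real.pi / 2)) :=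
    continuousOn_rootSqrt_sin.mono (prod_mono subset_rfl (subset_univ _))
  refine hasDerivAt_integral_of_continuousOn_deriv (f := fun u η => 1 / rootSqrt u (Real.sin η))
    (f' := fun u η => -((2 * ((Real.sin η : ℂ) ^ 4 + (Real.sin η : ℂ) ^ 2 + 1) * u +
      4 * ((Real.sin η : ℂ) ^ 2 + 1)) /
        (2 * rootSqrt u (Real.sin η))) / rootSqrt u (Real.sin η) ^ 2)
    isOpen_upper (fun z hz => ?_) ?_ ?_ hu
  · exact (continuous_const.div (continuous_rootSqrt_sin hz)
      fun η => rootSqrt_ne_zero hz _).continuousOn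
  · refine ContinuousOn.div (ContinuousOn.neg (ContinuousOn.div (by fun_prop)
      (continuousOn_const.mul hc) ?_)) (hc.pow 2) ?_
    · exact fun p hp => mul_ne_zero two_ne_zero (rootSqrt_ne_zero hp.1 _)
    · exact fun p hp => pow_ne_zero _ (rootSqrt_ne_zero hp.1 _)
  · intro z hz t _
    simp only [one_div]
    exact (hasDerivAt_rootSqrt hz (Real.sin t)).inv (rootSqrt_ne_zero hz _)

/-- The derivative of `η ↦ rootSqrt u (sin η)`. -/
theorem hasDerivAt_rootSqrt_sin {u : ℂ} (hu : 0 < u.im) (η : ℝ) :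
    HasDerivAt (fun η : ℝ => rootSqrt u (Real.sin η))
      (((u ^ 2 * (2 * (Real.sin η : ℂ) ^ 2 + 1) + 4 * u) * (Real.sin η * Real.cos η)) /
        rootSqrt u (Real.sin η)) η := by
  have hs : HasDerivAt (fun η : ℝ => (Real.sin η : ℂ)) (Real.cos η : ℂ) η :=
    (Real.hasDerivAt_sin η).ofReal_comp
  set s : ℂ := (Real.sin η : ℂ) with hsdef
  have e1 : HasDerivAt (fun η : ℝ => (1 + (Real.sin η : ℂ) + (Real.sin η : ℂ) ^ 2) * u + 2)
      ((1 + 2 * s) * Real.cos η * u) η := by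
    refine ((((hs.const_add 1).add (hs.pow 2)).mul_const u).add_const (2 : ℂ)).congr_deriv ?_
    rw [hsdef]; push_cast; ring
  have e2 : HasDerivAt (fun η : ℝ => (1 - (Real.sin η : ℂ) + (Real.sin η : ℂ) ^ 2) * u + 2)
      ((-1 + 2 * s) * Real.cos η * u) η := by
    refine ((((hs.const_sub 1).add (hs.pow 2)).mul_const u).add_const (2 : ℂ)).congr_deriv ?_
    rw [hsdef]; push_cast; ring
  have m1 : (1 + s + s ^ 2 : ℂ) * u + 2 ∈ slitPlane := Or.inr (im_factor_pos hu _).ne'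
  have m2 : (1 - s + s ^ 2 : ℂ) * u + 2 ∈ slitPlane := Or.inr (im_factor_pos' hu _).ne'
  have h1 := (hasDerivAt_csqrt m1).comp_of_eq η e1 rfl
  have h2 := (hasDerivAt_csqrt m2).comp_of_eq η e2 rfl
  have n1 := csqrt_ne_zero (slitPlane_ne_zero m1)
  have n2 := csqrt_ne_zero (slitPlane_ne_zero m2)
  have s1 := sq_csqrt ((1 + s + s ^ 2 : ℂ) * u + 2)
  have s2 := sq_csqrt ((1 - s + s ^ 2 : ℂ) * u + 2)
  refine (h1.mul h2).congr_deriv ?_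
  simp only [rootSqrt, Function.comp_apply, ← hsdef]
  generalize Complex.sqrt ((1 + s + s ^ 2 : ℂ) * u + 2) = p at *
  generalize Complex.sqrt ((1 - s + s ^ 2 : ℂ) * u + 2) = q at *
  field_simp
  rw [s1, s2]
  ring

/-- The factor sin η cos η vanishes at both ends. The two Picard–Fuchs relations are reductions
modulo exact forms of this shape. -/
theorem integral_eq_zero_of_sin_mul_cos {G G' : ℝ → ℂ}
    (hG : ∀ η, HasDerivAt (fun η : ℝ => (Real.sin η * Real.cos η : ℂ) * G η) (G' η) η)
    (hc : Continuous G') : ∫ η in (0 : ℝ)..Real.pi / 2, G' η = 0 := by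
  rw [intervalIntegral.integral_eq_sub_of_hasDerivAt (fun η _ => hG η) (hc.intervalIntegrable _ _)]
  simp

theorem cos_sq_eq_one_sub (η : ℝ) : (Real.cos η : ℂ) ^ 2 = 1 - (Real.sin η : ℂ) ^ 2 := by
  have := Real.cos_sq' η
  exact_mod_cast this

theorem hasDerivAt_sin_mul_cos (η : ℝ) :
    HasDerivAt (fun η : ℝ => (Real.sin η * Real.cos η : ℂ)) (1 - 2 * (Real.sin η : ℂ) ^ 2) η := by
  have hs : HasDerivAt (fun η : ℝ => (Real.sin η : ℂ)) (Real.cos η : ℂ) η :=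
    (Real.hasDerivAt_sin η).ofReal_comp
  have hc : HasDerivAt (fun η : ℝ => (Real.cos η : ℂ)) ((-Real.sin η : ℝ) : ℂ) η :=
    (Real.hasDerivAt_cos η).ofReal_comp
  refine (hs.mul hc).congr_deriv ?_
  push_cast
  have := cos_sq_eq_one_sub η
  push_cast at this
  linear_combination this

/-- Since ∂(v²)/∂A = 4ζ, the A-derivative of v/ζ dζ is a multiple of dζ/v. The prefactor is -4 dA/du
with A = -u(u+2)²/4. In the variable η the two sides differ by the exact form d(sin η cos η ·
`rootSqrt`). -/
theorem hasDerivAt_periodJ {u : ℂ} (hu : 0 < u.im) :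
    HasDerivAt periodJ ((u + 2) * (3 * u + 2) * periodK u) u := by
  have h := ((hasDerivAt_id' u).const_mul 2).mul (hasDerivAt_periodL hu)
  refine h.congr_deriv ?_
  have hN := continuous_rootSqrt_sin hu
  have hne := fun η : ℝ => rootSqrt_ne_zero hu (Real.sin η)
  have hcont : Continuous fun η : ℝ => ((1 - 2 * (Real.sin η : ℂ) ^ 2) * rootSqrt u (Real.sin η) +
      (Real.sin η * Real.cos η : ℂ) *
      (((u ^ 2 * (2 * (Real.sin η : ℂ) ^ 2 + 1) + 4 * u) * (Real.sin η * Real.cos η)) /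
        rootSqrt u (Real.sin η))) :=
    Continuous.add (Continuous.mul (by fun_prop) hN) (Continuous.mul (by fun_prop)
      (Continuous.div (by fun_prop) hN hne))
  have key := integral_eq_zero_of_sin_mul_cos
    (fun η => (hasDerivAt_sin_mul_cos η).mul (hasDerivAt_rootSqrt_sin hu η)) hcont
  have i1 : IntervalIntegrable (fun η : ℝ => 2 * 1 * ((Real.cos η : ℂ) ^ 2 *
      rootSqrt u (Real.sin η))) volume 0 (Real.pi / 2) :=
    Continuous.intervalIntegrable (by fun_prop) _ _
  have i2 : IntervalIntegrable (fun η : ℝ => 2 * u * ((Real.cos η : ℂ) ^ 2 *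
      ((2 * ((Real.sin η : ℂ) ^ 4 + (Real.sin η : ℂ) ^ 2 + 1) * u + 4 * ((Real.sin η : ℂ) ^ 2 + 1)) /
        (2 * rootSqrt u (Real.sin η))))) volume 0 (Real.pi / 2) :=
    (continuous_const.mul (Continuous.mul (by fun_prop)
      (Continuous.div (by fun_prop) (by fun_prop)
        fun η => mul_ne_zero two_ne_zero (hne η)))).intervalIntegrable _ _
  have i3 : IntervalIntegrable (fun η : ℝ => (u + 2) * (3 * u + 2) *
      (1 / rootSqrt u (Real.sin η))) volume 0 (Real.pi / 2) :=
    (continuous_const.mul (continuous_const.div hN hne)).intervalIntegrable _ _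
  rw [periodL, periodK, ← sub_eq_zero, ← intervalIntegral.integral_const_mul,
    ← intervalIntegral.integral_const_mul, ← intervalIntegral.integral_const_mul,
    ← intervalIntegral.integral_add, ← intervalIntegral.integral_sub]
  · rw [← key]
    refine intervalIntegral.integral_congr fun η _ => ?_
    have hsq := rootSqrt_sq u (Real.sin η)
    have hne := hne η
    have hcs := cos_sq_eq_one_sub η
    simp only [rootQuad] at hsq
    generalize rootSqrt u (Real.sin η) = N at *
    generalize (Real.sin η : ℂ) = s at *
    generalize (Real.cos η : ℂ) = c at *
    field_simp
    rw [hcs, hsq]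
    ring
  · exact i1.add i2
  · exact i3
  · exact i1
  · exact i2

/-- The second half of the Picard–Fuchs system. It is singular where two roots of the cubic
coincide: u = -2 (A = 0), and u = -2/3 or u = -8/3 (A = 8/27). -/
theorem hasDerivAt_periodK' {u : ℂ} (hu : 0 < u.im) :
    HasDerivAt periodK (-12 * periodL u / ((u + 2) * (3 * u + 2) * (3 * u + 8))) u := by
  have h := hasDerivAt_periodK hu
  have hu' : ∀ x y : ℝ, y ≠ 0 → (y : ℂ) * u + x ≠ 0 := by
    intro x y hy h
    have := congrArg Complex.im h
    simp at this
    rcases this with h | h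
    · exact hy h
    · exact hu.ne' h
  have n1 : u + 2 ≠ 0 := by simpa using hu' 2 1 one_ne_zero
  have n2 : 3 * u + 2 ≠ 0 := by simpa using hu' 2 3 three_ne_zero
  have n3 : 3 * u + 8 ≠ 0 := by simpa using hu' 8 3 three_ne_zero
  refine h.congr_deriv ?_
  rw [eq_div_iff (mul_ne_zero (mul_ne_zero n1 n2) n3)]
  have hN := continuous_rootSqrt_sin hu
  have hne := fun η : ℝ => rootSqrt_ne_zero hu (Real.sin η)
  have hs : ∀ η : ℝ, HasDerivAt (fun η : ℝ => (Real.sin η : ℂ)) (Real.cos η : ℂ) η :=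
    fun η => (Real.hasDerivAt_sin η).ofReal_comp
  -- The coefficients of this polynomial p in sin²η are those for which d(sin η cos η · p /
  -- `rootSqrt`) is exactly the difference of the two integrands.
  have hp : ∀ η : ℝ, HasDerivAt (fun η : ℝ => 3 * u ^ 2 * (Real.sin η : ℂ) ^ 4 +
      (3 * u ^ 2 + 18 * u) * (Real.sin η : ℂ) ^ 2 + (3 * u ^ 2 + 18 * u + 32))
      (3 * u ^ 2 * (4 * (Real.sin η : ℂ) ^ 3 * Real.cos η) +
        (3 * u ^ 2 + 18 * u) * (2 * (Real.sin η : ℂ) * Real.cos η)) η := by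
    intro η
    refine ((((hs η).pow 4).const_mul (3 * u ^ 2)).add
      (((hs η).pow 2).const_mul (3 * u ^ 2 + 18 * u)) |>.add_const _).congr_deriv ?_
    simp
  have key := integral_eq_zero_of_sin_mul_cos (G := fun η => (3 * u ^ 2 * (Real.sin η : ℂ) ^ 4 +
      (3 * u ^ 2 + 18 * u) * (Real.sin η : ℂ) ^ 2 + (3 * u ^ 2 + 18 * u + 32)) /
        rootSqrt u (Real.sin η))
    (fun η => (hasDerivAt_sin_mul_cos η).mul ((hp η).div (hasDerivAt_rootSqrt_sin hu η) (hne η)))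
    (Continuous.add (Continuous.mul (by fun_prop) (Continuous.div (by fun_prop) hN hne))
      (Continuous.mul (by fun_prop) (Continuous.div (Continuous.sub (Continuous.mul (by fun_prop) hN)
        (Continuous.mul (by fun_prop) (Continuous.div (by fun_prop) hN hne))) (hN.pow 2)
        fun η => pow_ne_zero _ (hne η))))
  rw [periodL, ← sub_eq_zero, ← intervalIntegral.integral_const_mul,
    ← intervalIntegral.integral_mul_const, ← intervalIntegral.integral_sub]
  · rw [← key]
    refine intervalIntegral.integral_congr fun η _ => ?_
    have hsq := rootSqrt_sq u (Real.sin η)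
    have hne := hne η
    have hcs := cos_sq_eq_one_sub η
    simp only [rootQuad] at hsq
    simp only [Pi.mul_apply, Pi.div_apply, Pi.sub_apply, Pi.pow_apply]
    generalize rootSqrt u (Real.sin η) = N at *
    generalize (Real.sin η : ℂ) = s at *
    generalize (Real.cos η : ℂ) = c at *
    have h4 : N ^ 4 = (((s ^ 2) ^ 2 + s ^ 2 + 1) * u ^ 2 + 4 * (s ^ 2 + 1) * u + 4) ^ 2 := by
      rw [← hsq]; ring
    field_simp
    rw [hcs, h4, hsq]
    ring
  · refine Continuous.intervalIntegrable (Continuous.mul (Continuous.div (Continuous.neg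
      (Continuous.div (by fun_prop) (by fun_prop) fun η => mul_ne_zero two_ne_zero (hne η)))
      (hN.pow 2) fun η => pow_ne_zero _ (hne η)) continuous_const) _ _
  · exact Continuous.intervalIntegrable (by fun_prop) _ _

/-! ### Values of the half-period at the real roots for A = 0 and A = 8/27 -/

theorem periodJ_zero : periodJ 0 = 0 := by simp [periodJ]

theorem sin_cos_mem_of_mem_Icc {η : ℝ} (h : η ∈ Icc 0 (Real.pi / 2)) :
    0 ≤ Real.sin η ∧ Real.sin η ≤ 1 ∧ 0 ≤ Real.cos η :=
  ⟨Real.sin_nonneg_of_nonneg_of_le_pi h.1 (by linarith [h.2, Real.pi_pos]), Real.sin_le_one η,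
    Real.cos_nonneg_of_neg_pi_div_two_le_of_le (by linarith [h.1, Real.pi_pos]) h.2⟩

theorem sin_cos_mem_of_mem_Ioo {η : ℝ} (h : η ∈ Ioo 0 (Real.pi / 2)) :
    0 < Real.sin η ∧ Real.sin η < 1 ∧ 0 < Real.cos η := by
  have hc : 0 < Real.cos η :=
    Real.cos_pos_of_mem_Ioo ⟨by linarith [h.1, Real.pi_pos], h.2⟩
  refine ⟨Real.sin_pos_of_pos_of_lt_pi h.1 (by linarith [h.2, Real.pi_pos]), ?_, hc⟩
  nlinarith [Real.sin_sq_add_cos_sq η, Real.sin_le_one η, Real.neg_one_le_sin η, sq_nonneg (1 - Real.sin η)]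

/-- `periodJ` on the real axis, from a real formula for the integrand. -/
theorem periodJ_ofReal (c : ℂ) (u : ℝ) (g : ℝ → ℝ)
    (h : ∀ η ∈ Icc 0 (Real.pi / 2), rootSqrt u (Real.sin η) = c * g η) :
    periodJ u = ((2 * u * ∫ η in (0 : ℝ)..Real.pi / 2, Real.cos η ^ 2 * g η : ℝ) : ℂ) * c := by
  have h1 : periodL u = c * ((∫ η in (0 : ℝ)..Real.pi / 2, Real.cos η ^ 2 * g η : ℝ) : ℂ) := by
    rw [periodL, ← intervalIntegral.integral_ofReal, ← intervalIntegral.integral_const_mul]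
    refine intervalIntegral.integral_congr fun η hη => ?_
    rw [uIcc_of_le (by positivity)] at hη
    simp only [h η hη]
    push_cast
    ring
  rw [periodJ, h1]
  push_cast
  ring

theorem integral_cos_sq_mul_pos {g : ℝ → ℝ} (hg : Continuous g)
    (h : ∀ η ∈ Ioo 0 (Real.pi / 2), 0 < g η) :
    0 < ∫ η in (0 : ℝ)..Real.pi / 2, Real.cos η ^ 2 * g η := by
  refine intervalIntegral.intervalIntegral_pos_of_pos_on
    (Continuous.intervalIntegrable (by fun_prop) _ _) (fun η hη => ?_) (by positivity)
  have := (sin_cos_mem_of_mem_Ioo hη).2.2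
  have := h η hη
  positivity

/-- -2/3 is the double root for A = 8/27. The integrand is bounded through (4/9)(1-s²)(4-s²) ≤
(16/9)cos²η with s = sin η, and ∫cos³ = 2/3 gives the constant 32/27, needed only for comparison
with the value at -8/3. -/
theorem periodJ_neg_two_thirds :
    ∃ r : ℝ, periodJ (-2 / 3) = r ∧ r < 0 ∧ -(32 / 27) ≤ r := by
  set g : ℝ → ℝ := fun η => √(2 / 3 * (1 - Real.sin η) * (2 + Real.sin η)) *
    √(2 / 3 * (1 + Real.sin η) * (2 - Real.sin η)) with hg
  have h : ∀ η ∈ Icc 0 (Real.pi / 2), rootSqrt ((-2 / 3 : ℝ) : ℂ) (Real.sin η) = 1 * g η := by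
    intro η hη
    obtain ⟨h1, h2, h3⟩ := sin_cos_mem_of_mem_Icc hη
    have e1 : ((1 + Real.sin η + Real.sin η ^ 2 : ℂ) * ((-2 / 3 : ℝ) : ℂ) + 2) =
        ((2 / 3 * (1 - Real.sin η) * (2 + Real.sin η) : ℝ) : ℂ) := by push_cast; ring
    have e2 : ((1 - Real.sin η + Real.sin η ^ 2 : ℂ) * ((-2 / 3 : ℝ) : ℂ) + 2) =
        ((2 / 3 * (1 + Real.sin η) * (2 - Real.sin η) : ℝ) : ℂ) := by push_cast; ring
    rw [rootSqrt, e1, e2, csqrt_ofReal_of_nonneg, csqrt_ofReal_of_nonneg, hg]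
    · push_cast; ring
    · exact mul_nonneg (by linarith) (by linarith)
    · exact mul_nonneg (by linarith) (by linarith)
  have hgc : Continuous g := by fun_prop
  have hpos := integral_cos_sq_mul_pos hgc (fun η hη => by
    obtain ⟨h1, h2, h3⟩ := sin_cos_mem_of_mem_Ioo hη
    exact mul_pos (Real.sqrt_pos.2 (mul_pos (by linarith) (by linarith)))
      (Real.sqrt_pos.2 (mul_pos (by linarith) (by linarith))))
  have hle : ∫ η in (0 : ℝ)..Real.pi / 2, Real.cos η ^ 2 * g η ≤
      ∫ η in (0 : ℝ)..Real.pi / 2, 4 / 3 * Real.cos η ^ 3 := by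
    refine intervalIntegral.integral_mono_on (by positivity)
      (Continuous.intervalIntegrable (by fun_prop) _ _)
      (Continuous.intervalIntegrable (by fun_prop) _ _) fun η hη => ?_
    obtain ⟨h1, h2, h3⟩ := sin_cos_mem_of_mem_Icc hη
    have : g η ≤ 4 / 3 * Real.cos η := by
      simp only [hg]
      rw [← Real.sqrt_mul (mul_nonneg (by linarith) (by linarith))]
      refine Real.sqrt_le_iff.2 ⟨by positivity, ?_⟩
      have := Real.sin_sq_add_cos_sq η
      have h4 : Real.cos η ^ 2 = 1 - Real.sin η ^ 2 := by linarith
      rw [mul_pow, h4]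
      nlinarith [mul_nonneg (sq_nonneg (Real.sin η)) (by nlinarith : 0 ≤ 1 - Real.sin η ^ 2)]
    calc _ ≤ Real.cos η ^ 2 * (4 / 3 * Real.cos η) := by gcongr
      _ = _ := by ring
  rw [intervalIntegral.integral_const_mul, integral_cos_pow_three] at hle
  simp at hle
  have hJ := periodJ_ofReal 1 (-2 / 3) g h
  refine ⟨2 * (-2 / 3) * ∫ η in (0 : ℝ)..Real.pi / 2, Real.cos η ^ 2 * g η, ?_, by nlinarith,
    by nlinarith⟩
  rw [mul_one] at hJ
  rw [← hJ]
  norm_num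

/-- -2 is the double root for A = 0. One linear factor is nonpositive and the other nonnegative, so
exactly one factor I appears. -/
theorem periodJ_neg_two : ∃ r : ℝ, periodJ (-2) = r * I ∧ r < 0 := by
  set g : ℝ → ℝ := fun η => √(2 * (Real.sin η + Real.sin η ^ 2)) *
    √(2 * (Real.sin η - Real.sin η ^ 2)) with hg
  have h : ∀ η ∈ Icc 0 (Real.pi / 2), rootSqrt ((-2 : ℝ) : ℂ) (Real.sin η) = I * g η := by
    intro η hη
    obtain ⟨h1, h2, h3⟩ := sin_cos_mem_of_mem_Icc hη
    have e1 : ((1 + Real.sin η + Real.sin η ^ 2 : ℂ) * ((-2 : ℝ) : ℂ) + 2) =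
        ((-(2 * (Real.sin η + Real.sin η ^ 2)) : ℝ) : ℂ) := by push_cast; ring
    have e2 : ((1 - Real.sin η + Real.sin η ^ 2 : ℂ) * ((-2 : ℝ) : ℂ) + 2) =
        ((2 * (Real.sin η - Real.sin η ^ 2) : ℝ) : ℂ) := by push_cast; ring
    rw [rootSqrt, e1, e2, csqrt_ofReal_of_nonpos, csqrt_ofReal_of_nonneg, hg]
    · push_cast; simp; ring
    · nlinarith
    · nlinarith
  have hpos := integral_cos_sq_mul_pos (by fun_prop : Continuous g) (fun η hη => by
    obtain ⟨h1, h2, h3⟩ := sin_cos_mem_of_mem_Ioo hη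
    exact mul_pos (Real.sqrt_pos.2 (by positivity)) (Real.sqrt_pos.2 (by nlinarith)))
  have hJ := periodJ_ofReal I (-2) g h
  refine ⟨2 * (-2) * ∫ η in (0 : ℝ)..Real.pi / 2, Real.cos η ^ 2 * g η, ?_, by nlinarith⟩
  rw [← hJ]
  norm_num

/-- -8/3 is the simple root for A = 8/27. Both factors are minus a square, so `rootSqrt` takes the
sign I² = -1. The lower bound ensures that the sum with the value at -2/3 does not vanish. -/
theorem periodJ_neg_eight_thirds : ∃ r : ℝ, periodJ (-8 / 3) = r ∧ 32 / 27 < r := by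
  set g : ℝ → ℝ := fun η => 8 / 3 * |Real.sin η ^ 2 - 1 / 4| with hg
  have h : ∀ η ∈ Icc 0 (Real.pi / 2), rootSqrt ((-8 / 3 : ℝ) : ℂ) (Real.sin η) = (-1) * g η := by
    intro η hη
    have e1 : ((1 + Real.sin η + Real.sin η ^ 2 : ℂ) * ((-8 / 3 : ℝ) : ℂ) + 2) =
        ((-(8 / 3 * (Real.sin η + 1 / 2) ^ 2) : ℝ) : ℂ) := by push_cast; ring
    have e2 : ((1 - Real.sin η + Real.sin η ^ 2 : ℂ) * ((-8 / 3 : ℝ) : ℂ) + 2) =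
        ((-(8 / 3 * (Real.sin η - 1 / 2) ^ 2) : ℝ) : ℂ) := by push_cast; ring
    have e3 : √(8 / 3 * (Real.sin η + 1 / 2) ^ 2) * √(8 / 3 * (Real.sin η - 1 / 2) ^ 2) = g η := by
      rw [← Real.sqrt_mul (by positivity), hg, show 8 / 3 * (Real.sin η + 1 / 2) ^ 2 *
        (8 / 3 * (Real.sin η - 1 / 2) ^ 2) = (8 / 3 * (Real.sin η ^ 2 - 1 / 4)) ^ 2 by ring,
        Real.sqrt_sq_eq_abs, abs_mul, abs_of_pos (by norm_num : (0 : ℝ) < 8 / 3)]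
    rw [rootSqrt, e1, e2, csqrt_ofReal_of_nonpos (by nlinarith [sq_nonneg (Real.sin η + 1 / 2)]),
      csqrt_ofReal_of_nonpos (by nlinarith [sq_nonneg (Real.sin η - 1 / 2)]), ← e3]
    push_cast
    simp only [neg_neg]
    linear_combination ((√(8 / 3 * (Real.sin η + 1 / 2) ^ 2) : ℝ) : ℂ) *
      ((√(8 / 3 * (Real.sin η - 1 / 2) ^ 2) : ℝ) : ℂ) * I_sq
  have hle : ∫ η in (0 : ℝ)..Real.pi / 2,
      8 / 3 * (Real.cos η ^ 2 * (2 * Real.sin η ^ 4 - 3 / 2 * Real.sin η ^ 2 + 1 / 4)) ≤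
      ∫ η in (0 : ℝ)..Real.pi / 2, Real.cos η ^ 2 * g η := by
    refine intervalIntegral.integral_mono_on (by positivity)
      (Continuous.intervalIntegrable (by fun_prop) _ _)
      (Continuous.intervalIntegrable (by fun_prop) _ _) fun η hη => ?_
    have h1 : Real.sin η ^ 2 ≤ 1 := Real.sin_sq_le_one η
    -- With y = sin²η the left side is (2y-1)(y-1/4), and |2y-1| ≤ 1. A polynomial minorant avoids
    -- splitting the integral at sin η = 1/2.
    have h2 : 2 * Real.sin η ^ 4 - 3 / 2 * Real.sin η ^ 2 + 1 / 4 ≤ |Real.sin η ^ 2 - 1 / 4| := by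
      have h0 := sq_nonneg (Real.sin η)
      rcases le_total (1 / 4) (Real.sin η ^ 2) with h3 | h3
      · rw [abs_of_nonneg (by linarith)]
        nlinarith
      · rw [abs_of_nonpos (by linarith)]
        nlinarith
    have h3 := mul_le_mul_of_nonneg_left h2 (sq_nonneg (Real.cos η))
    simp only [hg]
    linarith
  -- Only η/16 survives at the endpoints, so the minorant integrates to π/32; then π > 3 suffices.
  have hF : ∀ η : ℝ, HasDerivAt (fun η => η / 16 + Real.sin η * Real.cos η *
      (3 / 16 - 11 / 24 * Real.sin η ^ 2 + 1 / 3 * Real.sin η ^ 4))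
      (Real.cos η ^ 2 * (2 * Real.sin η ^ 4 - 3 / 2 * Real.sin η ^ 2 + 1 / 4)) η := by
    intro η
    have hs := Real.hasDerivAt_sin η
    have hc := Real.hasDerivAt_cos η
    refine (((hasDerivAt_id' η).div_const 16).add ((hs.mul hc).mul
      ((((hs.pow 2).const_mul (11 / 24)).const_sub (3 / 16)).add
        ((hs.pow 4).const_mul (1 / 3))))).congr_deriv ?_
    simp only [Pi.mul_apply, Pi.add_apply, Pi.pow_apply]
    have h4 : Real.cos η ^ 2 = 1 - Real.sin η ^ 2 := by linarith [Real.sin_sq_add_cos_sq η]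
    push_cast
    generalize Real.sin η = s at *
    generalize Real.cos η = c at *
    linear_combination (3 / 16 - 11 / 24 * s ^ 2 + 1 / 3 * s ^ 4 -
      2 * s * s * (11 / 24) + 4 * (1 / 3) * s ^ 3 * s -
      (2 * s ^ 4 - 3 / 2 * s ^ 2 + 1 / 4)) * h4
  rw [intervalIntegral.integral_const_mul,
    intervalIntegral.integral_eq_sub_of_hasDerivAt (fun η _ => hF η)
      (Continuous.intervalIntegrable (by fun_prop) _ _)] at hle
  simp at hle
  have hJ := periodJ_ofReal (-1) (-8 / 3) g h
  refine ⟨2 * (8 / 3) * ∫ η in (0 : ℝ)..Real.pi / 2, Real.cos η ^ 2 * g η, ?_,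
    by nlinarith [Real.pi_gt_three]⟩
  have e : ((-8 / 3 : ℝ) : ℂ) = -8 / 3 := by push_cast; ring
  rw [← e, hJ]
  push_cast
  ring

/-! ### Euler integrals and the hypergeometric equation -/

/-- Differentiation under the integral sign, with an integrable weight. -/
theorem hasDerivAt_integral_weight {U : Set ℂ} (hU : IsOpen U) {w : ℝ → ℝ} {k k' : ℂ → ℝ → ℂ}
    {a b : ℝ} (hw : IntervalIntegrable w volume a b) (hk : ∀ z ∈ U, ContinuousOn (k z) (uIcc a b))
    (hk' : ContinuousOn (Function.uncurry k') (U ×ˢ uIcc a b))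
    (hd : ∀ z ∈ U, ∀ t ∈ uIcc a b, HasDerivAt (fun z => k z t) (k' z t) z) {z : ℂ} (hz : z ∈ U) :
    HasDerivAt (fun z => ∫ t in a..b, (w t : ℂ) * k z t) (∫ t in a..b, (w t : ℂ) * k' z t) z := by
  obtain ⟨r, hr, hrU⟩ := Metric.nhds_basis_closedBall.mem_iff.1 (hU.mem_nhds hz)
  have hK : IsCompact (Metric.closedBall z r ×ˢ uIcc a b) :=
    (isCompact_closedBall z r).prod isCompact_uIcc
  obtain ⟨C, hC⟩ := hK.exists_bound_of_continuousOn
    (hk'.mono (prod_mono hrU subset_rfl))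
  have hsub : uIoc a b ⊆ uIcc a b := uIoc_subset_uIcc
  have hwc : IntervalIntegrable (fun t => (w t : ℂ)) volume a b := ⟨hw.1.ofReal, hw.2.ofReal⟩
  refine (intervalIntegral.hasDerivAt_integral_of_dominated_loc_of_deriv_le (μ := volume)
    (F := fun z t => (w t : ℂ) * k z t) (F' := fun z t => (w t : ℂ) * k' z t)
    (s := Metric.ball z r) (bound := fun t => |w t| * C)
    (Metric.ball_mem_nhds z hr) ?_ ?_ ?_ ?_ ?_ ?_).2
  · filter_upwards [hU.mem_nhds hz] with w hw
    exact (hwc.mul_continuousOn (hk w hw)).aestronglyMeasurable_restrict_uIoc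
  · exact hwc.mul_continuousOn (hk z hz)
  · have : ContinuousOn (k' z) (uIcc a b) :=
      hk'.comp (f := fun t => (z, t)) (by fun_prop) (fun t ht => ⟨hz, ht⟩)
    exact (hwc.mul_continuousOn this).aestronglyMeasurable_restrict_uIoc
  · refine Eventually.of_forall fun t ht x hx => ?_
    rw [norm_mul, Complex.norm_real, Real.norm_eq_abs]
    exact mul_le_mul_of_nonneg_left
      (hC (x, t) ⟨Metric.ball_subset_closedBall hx, hsub ht⟩) (abs_nonneg _)
  · exact hw.abs.mul_const C
  · exact Eventually.of_forall fun t ht x hx =>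
      (hd x (hrU (Metric.ball_subset_closedBall hx)) t (hsub ht)).const_mul _

theorem intervalIntegrable_beta {p q : ℝ} (hp : -1 < p) (hq : -1 < q) :
    IntervalIntegrable (fun t : ℝ => t ^ p * (1 - t) ^ q) volume 0 1 := by
  have h := (betaIntegral_convergent (u := ((p + 1 : ℝ) : ℂ)) (v := ((q + 1 : ℝ) : ℂ))
    (by simpa using by linarith) (by simpa using by linarith)).norm
  refine h.congr_ae ?_
  rw [uIoc_of_le zero_le_one, EventuallyEq, ae_restrict_iff' measurableSet_Ioc]
  have : ∀ᵐ t : ℝ, t ≠ 1 := by simp [ae_iff]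
  filter_upwards [this] with t ht1 ht
  have h0 : 0 < t := ht.1
  have h1 : 0 < 1 - t := sub_pos.2 (lt_of_le_of_ne ht.2 ht1)
  rw [norm_mul, norm_cpow_eq_rpow_re_of_pos h0]
  have : (1 - (t : ℂ)) = ((1 - t : ℝ) : ℂ) := by push_cast; ring
  rw [this, norm_cpow_eq_rpow_re_of_pos h1]
  simp

/-- The weight of Euler's integral for `₂F₁(1/3, 2/3; 2; ·)`. -/
noncomputable def weightPhi (t : ℝ) : ℝ := t ^ (-1 / 3 : ℝ) * (1 - t) ^ (1 / 3 : ℝ)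

/-- The weight of Euler's integral for `₂F₁(1/3, 2/3; 1; ·)`. -/
noncomputable def weightF (t : ℝ) : ℝ := t ^ (-1 / 3 : ℝ) * (1 - t) ^ (-2 / 3 : ℝ)

noncomputable def eulerKernel (z : ℂ) (t : ℝ) : ℂ := (1 - z * t) ^ ((-1 / 3 : ℝ) : ℂ)

/-- A multiple of `₂F₁(1/3, 2/3; 2; z)`. -/
noncomputable def hyperPhi (z : ℂ) : ℂ := ∫ t in (0 : ℝ)..1, (weightPhi t : ℂ) * eulerKernel z t

/-- A multiple of `₂F₁(1/3, 2/3; 1; z)`. -/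
noncomputable def hyperF (z : ℂ) : ℂ :=
  1 / 3 * ∫ t in (0 : ℝ)..1, (weightF t : ℂ) * eulerKernel z t

/-- The solution of `z (1 - z) y'' = (2 / 9) y` vanishing at `0`. -/
noncomputable def hyperY (z : ℂ) : ℂ := z * hyperPhi z

theorem intervalIntegrable_weightPhi : IntervalIntegrable weightPhi volume 0 1 :=
  intervalIntegrable_beta (by norm_num) (by norm_num)

theorem intervalIntegrable_weightF : IntervalIntegrable weightF volume 0 1 :=
  intervalIntegrable_beta (by norm_num) (by norm_num)

theorem intervalIntegrable_weightF_ofReal :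
    IntervalIntegrable (fun t => (weightF t : ℂ)) volume 0 1 :=
  ⟨intervalIntegrable_weightF.1.ofReal, intervalIntegrable_weightF.2.ofReal⟩

theorem intervalIntegrable_weightPhi_ofReal :
    IntervalIntegrable (fun t => (weightPhi t : ℂ)) volume 0 1 :=
  ⟨intervalIntegrable_weightPhi.1.ofReal, intervalIntegrable_weightPhi.2.ofReal⟩

theorem weightPhi_pos {t : ℝ} (ht : t ∈ Ioo (0 : ℝ) 1) : 0 < weightPhi t :=
  mul_pos (Real.rpow_pos_of_pos ht.1 _) (Real.rpow_pos_of_pos (sub_pos.2 ht.2) _)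

theorem weightF_pos {t : ℝ} (ht : t ∈ Ioo (0 : ℝ) 1) : 0 < weightF t :=
  mul_pos (Real.rpow_pos_of_pos ht.1 _) (Real.rpow_pos_of_pos (sub_pos.2 ht.2) _)

def slitDomain : Set ℂ := {z | 1 - z ∈ slitPlane}

theorem isOpen_slitDomain : IsOpen slitDomain := isOpen_slitPlane.preimage (by fun_prop)

theorem one_sub_mul_mem_slitPlane {z : ℂ} (hz : z ∈ slitDomain) {t : ℝ} (ht : t ∈ Icc (0 : ℝ) 1) :
    1 - z * t ∈ slitPlane := by
  have := starConvex_one_slitPlane hz (sub_nonneg.2 ht.2) ht.1 (by ring)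
  convert this using 1
  simp
  ring

theorem mem_slitDomain_of_re_lt {z : ℂ} (hz : z.re < 1) : z ∈ slitDomain :=
  Or.inl (by simpa using hz)

theorem mem_slitDomain_of_im_ne {z : ℂ} (hz : z.im ≠ 0) : z ∈ slitDomain :=
  Or.inr (by simpa using hz)

theorem continuousOn_cpow_kernel (c : ℂ) :
    ContinuousOn (fun p : ℂ × ℝ => (1 - p.1 * p.2) ^ c) (slitDomain ×ˢ uIcc 0 1) := by
  rw [uIcc_of_le zero_le_one]
  exact ContinuousOn.cpow_const (by fun_prop) fun p hp => one_sub_mul_mem_slitPlane hp.1 hp.2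

theorem continuousOn_cpow_kernel_right (c : ℂ) {z : ℂ} (hz : z ∈ slitDomain) :
    ContinuousOn (fun t : ℝ => (1 - z * t) ^ c) (uIcc 0 1) :=
  (continuousOn_cpow_kernel c).comp (f := fun t : ℝ => (z, t)) (by fun_prop)
    fun _ ht => ⟨hz, ht⟩

theorem hasDerivAt_integral_eulerKernel {w : ℝ → ℝ} (hw : IntervalIntegrable w volume 0 1) {z : ℂ}
    (hz : z ∈ slitDomain) :
    HasDerivAt (fun z => ∫ t in (0 : ℝ)..1, (w t : ℂ) * eulerKernel z t)
      (∫ t in (0 : ℝ)..1, (w t : ℂ) * (t / 3 * (1 - z * t) ^ ((-4 / 3 : ℝ) : ℂ))) z := by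
  refine hasDerivAt_integral_weight
    (k' := fun z t => t / 3 * (1 - z * t) ^ ((-4 / 3 : ℝ) : ℂ)) isOpen_slitDomain hw
    (fun z hz => continuousOn_cpow_kernel_right _ hz)
    (ContinuousOn.mul (by fun_prop) (continuousOn_cpow_kernel _)) (fun z hz t ht => ?_) hz
  rw [uIcc_of_le zero_le_one] at ht
  have h1 : HasDerivAt (fun z : ℂ => 1 - z * t) (-(t : ℂ)) z := by
    simpa using ((hasDerivAt_id' z).mul_const (t : ℂ)).const_sub 1
  refine (h1.cpow_const (c := ((-1 / 3 : ℝ) : ℂ)) (one_sub_mul_mem_slitPlane hz ht)).congr_deriv ?_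
  have : ((-1 / 3 : ℝ) : ℂ) - 1 = ((-4 / 3 : ℝ) : ℂ) := by push_cast; ring
  rw [this]
  push_cast
  ring

theorem weightPhi_eq {t : ℝ} (ht : t < 1) : weightPhi t = weightF t * (1 - t) := by
  rw [weightPhi, weightF, mul_assoc]
  congr 1
  conv_rhs => rw [← Real.rpow_one (1 - t), ← Real.rpow_mul (sub_pos.2 ht).le, one_mul]
  rw [← Real.rpow_add (sub_pos.2 ht)]
  norm_num

theorem eulerKernel_eq {z : ℂ} {t : ℝ} (h : 1 - z * t ≠ 0) :
    eulerKernel z t = (1 - z * t) * (1 - z * t) ^ ((-4 / 3 : ℝ) : ℂ) := by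
  have e : ((-1 / 3 : ℝ) : ℂ) = 1 + ((-4 / 3 : ℝ) : ℂ) := by push_cast; ring
  rw [eulerKernel, e, cpow_add _ _ h, cpow_one]

/-- The exact form behind the hypergeometric differential equation. -/
theorem integral_exact_form {z : ℂ} (hz : z ∈ slitDomain) :
    IntervalIntegrable (fun t : ℝ => (weightF t : ℂ) * ((1 - z * t) ^ ((-4 / 3 : ℝ) : ℂ) *
      ((1 - z * t) * (2 / 3 - t) + z * t * (1 - t) / 3))) volume 0 1 ∧
    ∫ t in (0 : ℝ)..1, (weightF t : ℂ) * ((1 - z * t) ^ ((-4 / 3 : ℝ) : ℂ) *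
      ((1 - z * t) * (2 / 3 - t) + z * t * (1 - t) / 3)) = 0 := by
  have hint : IntervalIntegrable (fun t : ℝ => (weightF t : ℂ) *
      ((1 - z * t) ^ ((-4 / 3 : ℝ) : ℂ) *
      ((1 - z * t) * (2 / 3 - t) + z * t * (1 - t) / 3))) volume 0 1 :=
    intervalIntegrable_weightF_ofReal.mul_continuousOn
      ((continuousOn_cpow_kernel_right _ hz).mul (by fun_prop))
  refine ⟨hint, ?_⟩
  have hcont : ContinuousOn (fun t : ℝ => ((t ^ (2 / 3 : ℝ) * (1 - t) ^ (1 / 3 : ℝ) : ℝ) : ℂ) *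
      (1 - z * t) ^ ((-1 / 3 : ℝ) : ℂ)) (Icc 0 1) := by
    have h1 : Continuous fun t : ℝ => t ^ (2 / 3 : ℝ) * (1 - t) ^ (1 / 3 : ℝ) :=
      (Real.continuous_rpow_const (by norm_num)).mul
        ((Real.continuous_rpow_const (by norm_num)).comp (by fun_prop))
    have h2 := continuousOn_cpow_kernel_right ((-1 / 3 : ℝ) : ℂ) hz
    rw [uIcc_of_le zero_le_one] at h2
    exact (continuous_ofReal.comp h1).continuousOn.mul h2
  rw [intervalIntegral.integral_eq_sub_of_hasDerivAt_of_le zero_le_one hcont (fun t ht => ?_) hint]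
  · simp
  have m := one_sub_mul_mem_slitPlane hz (Ioo_subset_Icc_self ht)
  have h1 : HasDerivAt (fun t : ℝ => 1 - z * t) (-z) t := by
    simpa using ((hasDerivAt_id' t).ofReal_comp.const_mul z).const_sub 1
  have h2 := (Complex.hasStrictDerivAt_cpow_const (c := ((-1 / 3 : ℝ) : ℂ)) m).hasDerivAt.comp t h1
  have h3 : HasDerivAt (fun t : ℝ => t ^ (2 / 3 : ℝ) * (1 - t) ^ (1 / 3 : ℝ)) _ t :=
    ((hasDerivAt_id' t).rpow_const (p := 2 / 3) (Or.inl ht.1.ne')).mul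
      (((hasDerivAt_id' t).const_sub 1).rpow_const (p := 1 / 3) (Or.inl (sub_pos.2 ht.2).ne'))
  refine (h3.ofReal_comp.mul h2).congr_deriv ?_
  have e1 : ((-1 / 3 : ℝ) : ℂ) - 1 = ((-4 / 3 : ℝ) : ℂ) := by push_cast; ring
  have e2 := eulerKernel_eq (slitPlane_ne_zero m)
  have t1 : t ^ (2 / 3 : ℝ) = t ^ (-1 / 3 : ℝ) * t := by
    conv_rhs => rw [← Real.rpow_one t, ← Real.rpow_mul ht.1.le, one_mul]
    rw [← Real.rpow_add ht.1]; norm_num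
  have t2 : t ^ (2 / 3 - 1 : ℝ) = t ^ (-1 / 3 : ℝ) := by norm_num
  have t3 : (1 - t) ^ (1 / 3 - 1 : ℝ) = (1 - t) ^ (-2 / 3 : ℝ) := by norm_num
  have t4 : (1 - t) ^ (1 / 3 : ℝ) = (1 - t) ^ (-2 / 3 : ℝ) * (1 - t) := by
    conv_rhs => rw [← Real.rpow_one (1 - t), ← Real.rpow_mul (sub_pos.2 ht.2).le, one_mul]
    rw [← Real.rpow_add (sub_pos.2 ht.2)]; norm_num
  rw [eulerKernel] at e2
  rw [Function.comp_apply, e1, e2, t2, t3, t1, t4, weightF]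
  push_cast
  ring

theorem integral_weightPhi_eulerKernel {z : ℂ} (hz : z ∈ slitDomain) :
    hyperPhi z = ∫ t in (0 : ℝ)..1, (weightF t : ℂ) * ((1 - z * t) ^ ((-4 / 3 : ℝ) : ℂ) *
      ((1 - t) * (1 - z * t))) := by
  refine intervalIntegral.integral_congr_ae ?_
  have : ∀ᵐ t : ℝ, t ≠ 1 := by simp [ae_iff]
  filter_upwards [this] with t ht1 ht
  rw [uIoc_of_le zero_le_one] at ht
  rw [weightPhi_eq (lt_of_le_of_ne ht.2 ht1),
    eulerKernel_eq (slitPlane_ne_zero (one_sub_mul_mem_slitPlane hz ⟨ht.1.le, ht.2⟩))]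
  push_cast
  ring

theorem integral_weightF_eulerKernel {z : ℂ} (hz : z ∈ slitDomain) :
    hyperF z = ∫ t in (0 : ℝ)..1, (weightF t : ℂ) * ((1 - z * t) ^ ((-4 / 3 : ℝ) : ℂ) *
      ((1 - z * t) / 3)) := by
  rw [hyperF, ← intervalIntegral.integral_const_mul]
  refine intervalIntegral.integral_congr fun t ht => ?_
  rw [uIcc_of_le zero_le_one] at ht
  simp only [eulerKernel_eq (slitPlane_ne_zero (one_sub_mul_mem_slitPlane hz ht))]
  ring

theorem intervalIntegrable_weightF_mul {z : ℂ} (hz : z ∈ slitDomain) {g : ℝ → ℂ}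
    (hg : Continuous g) :
    IntervalIntegrable (fun t : ℝ => (weightF t : ℂ) * ((1 - z * t) ^ ((-4 / 3 : ℝ) : ℂ) * g t))
      volume 0 1 :=
  intervalIntegrable_weightF_ofReal.mul_continuousOn
    ((continuousOn_cpow_kernel_right _ hz).mul hg.continuousOn)

theorem hasDerivAt_hyperPhi {z : ℂ} (hz : z ∈ slitDomain) :
    HasDerivAt hyperPhi (∫ t in (0 : ℝ)..1, (weightF t : ℂ) * ((1 - z * t) ^ ((-4 / 3 : ℝ) : ℂ) *
      ((1 - t) * (t / 3)))) z := by
  refine (hasDerivAt_integral_eulerKernel intervalIntegrable_weightPhi hz).congr_deriv ?_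
  refine intervalIntegral.integral_congr_ae ?_
  have : ∀ᵐ t : ℝ, t ≠ 1 := by simp [ae_iff]
  filter_upwards [this] with t ht1 ht
  rw [uIoc_of_le zero_le_one] at ht
  rw [weightPhi_eq (lt_of_le_of_ne ht.2 ht1)]
  push_cast
  ring

/-- The product rule gives Φ + zΦ', and after clearing to the common power (1-zt)^{-4/3} the
integrand of Φ + zΦ' - F is precisely the exact form. -/
theorem hasDerivAt_hyperY {z : ℂ} (hz : z ∈ slitDomain) : HasDerivAt hyperY (hyperF z) z := by
  refine ((hasDerivAt_id' z).mul (hasDerivAt_hyperPhi hz)).congr_deriv ?_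
  rw [integral_weightPhi_eulerKernel hz, integral_weightF_eulerKernel hz, ← sub_eq_zero,
    ← intervalIntegral.integral_const_mul, ← intervalIntegral.integral_const_mul,
    ← intervalIntegral.integral_add, ← intervalIntegral.integral_sub,
    ← (integral_exact_form hz).2]
  · refine intervalIntegral.integral_congr fun t ht => ?_
    ring
  · exact ((intervalIntegrable_weightF_mul hz (by fun_prop)).const_mul _).add
      ((intervalIntegrable_weightF_mul hz (by fun_prop)).const_mul _)
  · exact intervalIntegrable_weightF_mul hz (by fun_prop)
  · exact ((intervalIntegrable_weightF_mul hz (by fun_prop)).const_mul _)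
  · exact ((intervalIntegrable_weightF_mul hz (by fun_prop)).const_mul _)

/-- Together with Y' = F this is z(1-z)Y'' = (2/9)Y. The two sides differ by -1/3 times the same
exact form. -/
theorem hasDerivAt_hyperF {z : ℂ} (hz : z ∈ slitDomain) :
    HasDerivAt hyperF (2 / 9 * hyperPhi z / (1 - z)) z := by
  have h := (hasDerivAt_integral_eulerKernel intervalIntegrable_weightF hz).const_mul (1 / 3 : ℂ)
  refine HasDerivAt.congr_deriv (f := hyperF) h ?_
  have hz1 : 1 - z ≠ 0 := slitPlane_ne_zero hz
  rw [eq_div_iff hz1, integral_weightPhi_eulerKernel hz, ← sub_eq_zero,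
    ← intervalIntegral.integral_const_mul, ← intervalIntegral.integral_mul_const,
    ← intervalIntegral.integral_const_mul, ← intervalIntegral.integral_sub,
    ← mul_zero (-1 / 3 : ℂ), ← (integral_exact_form hz).2, ← intervalIntegral.integral_const_mul]
  · refine intervalIntegral.integral_congr fun t ht => ?_
    ring
  · have := ((intervalIntegrable_weightF_mul hz (g := fun t : ℝ => (t : ℂ) / 3)
      (by fun_prop)).const_mul (1 / 3 : ℂ)).mul_const (1 - z)
    refine this.congr fun t _ => ?_
    ring
  · exact (intervalIntegrable_weightF_mul hz (by fun_prop)).const_mul _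

/-! ### Sectors containing the Euler kernel -/

section Kernel

variable {y : ℂ}

theorem abs_arg_lt_pi (hy : y ∈ slitPlane) : |arg y| < Real.pi := by
  refine lt_of_le_of_ne (abs_arg_le_pi y) fun h => ?_
  rcases abs_eq Real.pi_pos.le |>.1 h with h | h
  · exact (mem_slitPlane_iff_arg.1 hy).1 h
  · exact (neg_pi_lt_arg y).ne' h

/-- The argument of the power is -arg(y)/3, of modulus below π/3, so its cosine is at least 1/2. -/
theorem half_norm_rpow_le_re_cpow (hy : y ∈ slitPlane) :
    ‖y‖ ^ (-1 / 3 : ℝ) / 2 ≤ (y ^ ((-1 / 3 : ℝ) : ℂ)).re := by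
  rw [cpow_ofReal_re, div_eq_mul_inv]
  refine mul_le_mul_of_nonneg_left ?_ (by positivity)
  have h := abs_arg_lt_pi hy
  rw [← one_div, ← Real.cos_pi_div_three, ← Real.cos_abs (arg y * (-1 / 3))]
  refine Real.cos_le_cos_of_nonneg_of_le_pi (abs_nonneg _) (by linarith [Real.pi_pos]) ?_
  rw [abs_mul]
  norm_num
  linarith

theorem im_cpow_pos (hy : y.im < 0) : 0 < (y ^ ((-1 / 3 : ℝ) : ℂ)).im := by
  have h0 : y ≠ 0 := by rintro rfl; simp at hy
  rw [cpow_ofReal_im]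
  refine mul_pos (Real.rpow_pos_of_pos (norm_pos_iff.2 h0) _) ?_
  have h1 := arg_neg_iff.2 hy
  have h2 := neg_pi_lt_arg y
  exact Real.sin_pos_of_pos_of_lt_pi (by linarith) (by linarith [Real.pi_pos])

theorem sqrt_three_mul_cos_sub_sin (α : ℝ) :
    √3 * Real.cos α - Real.sin α = 2 * Real.sin (Real.pi / 3 - α) := by
  rw [Real.sin_sub, Real.sin_pi_div_three, Real.cos_pi_div_three]
  ring

theorem cos_sub_sqrt_three_mul_sin (α : ℝ) :
    Real.cos α - √3 * Real.sin α = 2 * Real.sin (Real.pi / 6 - α) := by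
  rw [Real.sin_sub, Real.sin_pi_div_six, Real.cos_pi_div_six]
  ring

theorem im_cpow_lt (hy : y ∈ slitPlane) :
    (y ^ ((-1 / 3 : ℝ) : ℂ)).im < √3 * (y ^ ((-1 / 3 : ℝ) : ℂ)).re := by
  have h0 := slitPlane_ne_zero hy
  rw [cpow_ofReal_im, cpow_ofReal_re, ← sub_pos]
  have h1 := abs_lt.1 (abs_arg_lt_pi hy)
  have h2 : 0 < Real.sin (Real.pi / 3 - arg y * (-1 / 3)) :=
    Real.sin_pos_of_pos_of_lt_pi (by linarith) (by linarith [Real.pi_pos])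
  have h3 := sqrt_three_mul_cos_sub_sin (arg y * (-1 / 3))
  have h4 : 0 < ‖y‖ ^ (-1 / 3 : ℝ) := Real.rpow_pos_of_pos (norm_pos_iff.2 h0) _
  have : √3 * (‖y‖ ^ (-1 / 3 : ℝ) * Real.cos (arg y * (-1 / 3))) -
      ‖y‖ ^ (-1 / 3 : ℝ) * Real.sin (arg y * (-1 / 3)) =
      ‖y‖ ^ (-1 / 3 : ℝ) * (2 * Real.sin (Real.pi / 3 - arg y * (-1 / 3))) := by
    rw [← h3]; ring
  rw [this]
  positivity

/-- Here |arg y| < π/2, so the power lies in the sector |arg| < π/6, written as two linear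
inequalities so that it can be integrated. -/
theorem sqrt_three_mul_im_cpow_lt (hy : 0 < y.re) :
    √3 * (y ^ ((-1 / 3 : ℝ) : ℂ)).im < (y ^ ((-1 / 3 : ℝ) : ℂ)).re ∧
    -(√3 * (y ^ ((-1 / 3 : ℝ) : ℂ)).im) < (y ^ ((-1 / 3 : ℝ) : ℂ)).re := by
  have h0 : y ≠ 0 := by rintro rfl; simp at hy
  rw [cpow_ofReal_im, cpow_ofReal_re]
  have h1 := abs_lt.1 (abs_arg_lt_pi_div_two_iff.2 (Or.inl hy))
  set α := arg y * (-1 / 3) with hα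
  have h2 : 0 < Real.sin (Real.pi / 6 - α) :=
    Real.sin_pos_of_pos_of_lt_pi (by linarith) (by linarith [Real.pi_pos])
  have h2' : 0 < Real.sin (Real.pi / 6 - -α) :=
    Real.sin_pos_of_pos_of_lt_pi (by linarith) (by linarith [Real.pi_pos])
  have h3 := cos_sub_sqrt_three_mul_sin α
  have h3' := cos_sub_sqrt_three_mul_sin (-α)
  rw [Real.cos_neg, Real.sin_neg] at h3'
  have h4 : 0 < ‖y‖ ^ (-1 / 3 : ℝ) := Real.rpow_pos_of_pos (norm_pos_iff.2 h0) _
  constructor <;> nlinarith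

end Kernel

/-! ### Sector bounds for the hypergeometric functions -/

/-- Positivity of a real-linear functional passes to weighted integrals. -/
theorem integral_weight_functional_pos {w : ℝ → ℝ} {k : ℝ → ℂ} {α β : ℝ}
    (hint : IntervalIntegrable (fun t => (w t : ℂ) * k t) volume 0 1)
    (hw : ∀ t ∈ Ioo (0 : ℝ) 1, 0 < w t)
    (h : ∀ t ∈ Ioo (0 : ℝ) 1, 0 < α * (k t).re + β * (k t).im) :
    0 < α * (∫ t in (0 : ℝ)..1, (w t : ℂ) * k t).re + β * (∫ t in (0 : ℝ)..1, (w t : ℂ) * k t).im := by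
  set L : ℂ →L[ℝ] ℝ := α • reCLM + β • imCLM with hL
  have e : ∀ z : ℂ, L z = α * z.re + β * z.im := fun z => by simp [hL]
  rw [← e, ← L.intervalIntegral_comp_comm hint]
  refine intervalIntegral.intervalIntegral_pos_of_pos_on ?_ (fun t ht => ?_) zero_lt_one
  · exact ⟨L.integrable_comp hint.1, L.integrable_comp hint.2⟩
  · rw [e]
    have := mul_pos (hw t ht) (h t ht)
    simp
    linarith

theorem re_one_sub_mul_le {z : ℂ} (hz : z.re ≤ 1) {t : ℝ} (ht : 0 ≤ t) :
    1 - t ≤ (1 - z * t).re := by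
  have := mul_le_mul_of_nonneg_right hz ht
  simp
  linarith

/-- For Re z ≤ 1 one has |1-zt| ≥ 1-t, so the factor (1-t)^{1/3} of the weight absorbs the
singularity of the kernel. The bound is uniform in z and includes z = 1, which yields continuity of
Φ up to that point. -/
theorem norm_weightPhi_mul_kernel_le {z : ℂ} (hz : z.re ≤ 1) {t : ℝ} (ht : t ∈ Ioo (0 : ℝ) 1) :
    ‖(weightPhi t : ℂ) * eulerKernel z t‖ ≤ t ^ (-1 / 3 : ℝ) := by
  have h1 : 0 < 1 - t := sub_pos.2 ht.2
  have h2 : 1 - t ≤ ‖1 - z * t‖ := (re_one_sub_mul_le hz ht.1.le).trans (re_le_norm _)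
  rw [norm_mul, eulerKernel, norm_cpow_real, Complex.norm_real, Real.norm_eq_abs,
    abs_of_pos (weightPhi_pos ht), weightPhi, mul_assoc]
  have h3 : ‖1 - z * t‖ ^ (-1 / 3 : ℝ) ≤ (1 - t) ^ (-1 / 3 : ℝ) :=
    Real.rpow_le_rpow_of_nonpos h1 h2 (by norm_num)
  have h4 : (1 - t) ^ (1 / 3 : ℝ) * (1 - t) ^ (-1 / 3 : ℝ) = 1 := by
    rw [← Real.rpow_add h1]; norm_num
  have h5 : 0 < t ^ (-1 / 3 : ℝ) := Real.rpow_pos_of_pos ht.1 _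
  have h6 : 0 < (1 - t) ^ (1 / 3 : ℝ) := Real.rpow_pos_of_pos h1 _
  calc _ ≤ t ^ (-1 / 3 : ℝ) * ((1 - t) ^ (1 / 3 : ℝ) * (1 - t) ^ (-1 / 3 : ℝ)) := by gcongr
    _ = _ := by rw [h4, mul_one]

theorem aestronglyMeasurable_weightPhi_mul (z : ℂ) :
    AEStronglyMeasurable (fun t : ℝ => (weightPhi t : ℂ) * eulerKernel z t)
      (volume.restrict (uIoc 0 1)) := by
  refine Measurable.aestronglyMeasurable (Measurable.mul ?_ ?_)
  · unfold weightPhi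
    fun_prop
  · unfold eulerKernel
    exact Measurable.pow_const (by fun_prop) _

theorem intervalIntegrable_rpow_neg_third :
    IntervalIntegrable (fun t : ℝ => t ^ (-1 / 3 : ℝ)) volume 0 1 :=
  intervalIntegral.intervalIntegrable_rpow' (by norm_num)

theorem ae_ne_one : ∀ᵐ t : ℝ, t ≠ 1 := by simp [ae_iff]

theorem intervalIntegrable_weightPhi_mul_of_re_le {z : ℂ} (hz : z.re ≤ 1) :
    IntervalIntegrable (fun t : ℝ => (weightPhi t : ℂ) * eulerKernel z t) volume 0 1 := by
  refine intervalIntegrable_rpow_neg_third.mono_fun (aestronglyMeasurable_weightPhi_mul z) ?_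
  rw [EventuallyLE, ae_restrict_iff' measurableSet_uIoc]
  filter_upwards [ae_ne_one] with t ht1 ht
  rw [uIoc_of_le zero_le_one] at ht
  exact (norm_weightPhi_mul_kernel_le hz ⟨ht.1, lt_of_le_of_ne ht.2 ht1⟩).trans (le_abs_self _)

theorem intervalIntegrable_weightPhi_mul {z : ℂ} (hz : z ∈ slitDomain) :
    IntervalIntegrable (fun t : ℝ => (weightPhi t : ℂ) * eulerKernel z t) volume 0 1 :=
  intervalIntegrable_weightPhi_ofReal.mul_continuousOn (continuousOn_cpow_kernel_right _ hz)

theorem intervalIntegrable_weightF_mul' {z : ℂ} (hz : z ∈ slitDomain) :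
    IntervalIntegrable (fun t : ℝ => (weightF t : ℂ) * eulerKernel z t) volume 0 1 :=
  intervalIntegrable_weightF_ofReal.mul_continuousOn (continuousOn_cpow_kernel_right _ hz)

theorem continuousOn_hyperPhi : ContinuousOn hyperPhi {z | z.re ≤ 1} := by
  intro z hz
  refine intervalIntegral.continuousWithinAt_of_dominated_interval
    (bound := fun t => t ^ (-1 / 3 : ℝ)) ?_ ?_ intervalIntegrable_rpow_neg_third ?_
  · exact Eventually.of_forall fun z => aestronglyMeasurable_weightPhi_mul z
  · filter_upwards [self_mem_nhdsWithin] with x hx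
    filter_upwards [ae_ne_one] with t ht1 ht
    rw [uIoc_of_le zero_le_one] at ht
    exact norm_weightPhi_mul_kernel_le hx ⟨ht.1, lt_of_le_of_ne ht.2 ht1⟩
  · filter_upwards [ae_ne_one] with t ht1 ht
    rw [uIoc_of_le zero_le_one] at ht
    have h1 : 0 < 1 - t := sub_pos.2 (lt_of_le_of_ne ht.2 ht1)
    have : 1 - z * t ∈ slitPlane := Or.inl (h1.trans_le (re_one_sub_mul_le hz ht.1.le))
    refine ContinuousAt.continuousWithinAt (continuousAt_const.mul ?_)
    exact ContinuousAt.cpow (f := fun x : ℂ => 1 - x * t) (by fun_prop) continuousAt_const this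

theorem continuousOn_hyperY : ContinuousOn hyperY {z | z.re ≤ 1} :=
  continuousOn_id.mul continuousOn_hyperPhi

theorem hyperPhi_conj {z : ℂ} (hz : z ∈ slitDomain ∨ z.re ≤ 1) :
    hyperPhi ((starRingEnd ℂ) z) = (starRingEnd ℂ) (hyperPhi z) := by
  rw [hyperPhi, hyperPhi, ← intervalIntegral.intervalIntegral_conj]
  refine intervalIntegral.integral_congr_ae ?_
  filter_upwards [ae_ne_one] with t ht1 ht
  rw [uIoc_of_le zero_le_one] at ht
  have m : 1 - z * t ∈ slitPlane := by
    rcases hz with hz | hz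
    · exact one_sub_mul_mem_slitPlane hz ⟨ht.1.le, ht.2⟩
    · exact Or.inl ((sub_pos.2 (lt_of_le_of_ne ht.2 ht1)).trans_le (re_one_sub_mul_le hz ht.1.le))
  have h := conj_cpow (1 - z * t) ((-1 / 3 : ℝ) : ℂ) (mem_slitPlane_iff_arg.1 m).1
  rw [conj_ofReal] at h
  simp only [eulerKernel, map_mul, conj_ofReal, ← h, map_sub, map_one]

theorem hyperY_conj {z : ℂ} (hz : z ∈ slitDomain ∨ z.re ≤ 1) :
    hyperY ((starRingEnd ℂ) z) = (starRingEnd ℂ) (hyperY z) := by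
  rw [hyperY, hyperY, hyperPhi_conj hz, map_mul]

/-- The bound depends only on |z|, so positivity survives in limits onto the cut z ≥ 1. This is what
`boundary_false` needs. -/
theorem le_re_hyperPhi {z : ℂ} (hz : z ∈ slitDomain) :
    (1 + ‖z‖) ^ (-1 / 3 : ℝ) / 2 * ∫ t in (0 : ℝ)..1, weightPhi t ≤ (hyperPhi z).re := by
  have hint := intervalIntegrable_weightPhi_mul hz
  rw [hyperPhi, ← reCLM_apply, ← reCLM.intervalIntegral_comp_comm hint,
    ← intervalIntegral.integral_const_mul]
  refine intervalIntegral.integral_mono_on_of_le_Ioo zero_le_one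
    (intervalIntegrable_weightPhi.const_mul _)
    ⟨reCLM.integrable_comp hint.1, reCLM.integrable_comp hint.2⟩ fun t ht => ?_
  have m := one_sub_mul_mem_slitPlane hz (Ioo_subset_Icc_self ht)
  have h1 := half_norm_rpow_le_re_cpow m
  have h2 : ‖1 - z * t‖ ≤ 1 + ‖z‖ := by
    refine (norm_sub_le _ _).trans ?_
    rw [norm_one, norm_mul, Complex.norm_real, Real.norm_eq_abs, abs_of_pos ht.1]
    have := mul_le_mul_of_nonneg_left ht.2.le (norm_nonneg z)
    linarith
  have h3 : (1 + ‖z‖) ^ (-1 / 3 : ℝ) ≤ ‖1 - z * t‖ ^ (-1 / 3 : ℝ) :=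
    Real.rpow_le_rpow_of_nonpos (norm_pos_iff.2 (slitPlane_ne_zero m)) h2 (by norm_num)
  have h4 := weightPhi_pos ht
  rw [reCLM_apply, re_ofReal_mul, mul_comm]
  refine mul_le_mul_of_nonneg_left ?_ h4.le
  rw [eulerKernel]
  linarith

theorem integral_weightPhi_pos : 0 < ∫ t in (0 : ℝ)..1, weightPhi t :=
  intervalIntegral.intervalIntegral_pos_of_pos_on intervalIntegrable_weightPhi
    (fun _ ht => weightPhi_pos ht) zero_lt_one

theorem re_hyperPhi_pos {z : ℂ} (hz : z ∈ slitDomain) : 0 < (hyperPhi z).re := by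
  refine lt_of_lt_of_le ?_ (le_re_hyperPhi hz)
  have := integral_weightPhi_pos
  positivity

theorem im_one_sub_mul_neg {z : ℂ} (hz : 0 < z.im) {t : ℝ} (ht : 0 < t) : (1 - z * t).im < 0 := by
  simp
  positivity

theorem im_hyperPhi_pos {z : ℂ} (hz : 0 < z.im) : 0 < (hyperPhi z).im := by
  have := integral_weight_functional_pos (α := 0) (β := 1)
    (intervalIntegrable_weightPhi_mul (mem_slitDomain_of_im_ne hz.ne')) (fun _ => weightPhi_pos)
    (fun t ht => by simpa [eulerKernel] using im_cpow_pos (im_one_sub_mul_neg hz ht.1))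
  simpa [hyperPhi] using this

/-- On the whole cut plane the kernel only satisfies |arg| < π/3. Combined with the sector of
half-angle π/6 available for Re z ≤ 1, this still keeps a sum of two arguments below π/2. -/
theorem im_hyperPhi_lt {z : ℂ} (hz : z ∈ slitDomain) :
    (hyperPhi z).im < √3 * (hyperPhi z).re := by
  have := integral_weight_functional_pos (α := √3) (β := -1)
    (intervalIntegrable_weightPhi_mul hz) (fun _ => weightPhi_pos)
    (fun t ht => by
      have := im_cpow_lt (one_sub_mul_mem_slitPlane hz (Ioo_subset_Icc_self ht))
      rw [eulerKernel]
      linarith)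
  rw [hyperPhi]
  linarith

/-- For 0 < t < 1 the number 1-zt has positive real part, so the kernel lies in the sector |arg| <
π/6, a convex cone, and so does its average against a positive weight. -/
theorem abs_im_hyperPhi_lt {z : ℂ} (hz : z.re ≤ 1) :
    √3 * |(hyperPhi z).im| < (hyperPhi z).re := by
  have key : ∀ t ∈ Ioo (0 : ℝ) 1, 0 < (1 - z * t).re := fun t ht =>
    (sub_pos.2 ht.2).trans_le (re_one_sub_mul_le hz ht.1.le)
  have h1 := integral_weight_functional_pos (α := 1) (β := -√3)
    (intervalIntegrable_weightPhi_mul_of_re_le hz) (fun _ => weightPhi_pos)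
    (fun t ht => by
      have := (sqrt_three_mul_im_cpow_lt (key t ht)).1
      rw [eulerKernel]
      linarith)
  have h2 := integral_weight_functional_pos (α := 1) (β := √3)
    (intervalIntegrable_weightPhi_mul_of_re_le hz) (fun _ => weightPhi_pos)
    (fun t ht => by
      have := (sqrt_three_mul_im_cpow_lt (key t ht)).2
      rw [eulerKernel]
      linarith)
  rw [hyperPhi]
  rcases abs_cases (∫ t in (0 : ℝ)..1, (weightPhi t : ℂ) * eulerKernel z t).im with h | h <;>
  · rw [h.1]
    linarith

theorem abs_im_hyperF_lt {z : ℂ} (hz : z.re < 1) :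
    √3 * |(hyperF z).im| < (hyperF z).re := by
  have key : ∀ t ∈ Ioo (0 : ℝ) 1, 0 < (1 - z * t).re := fun t ht =>
    (sub_pos.2 ht.2).trans_le (re_one_sub_mul_le hz.le ht.1.le)
  have hint := intervalIntegrable_weightF_mul' (mem_slitDomain_of_re_lt hz)
  have h1 := integral_weight_functional_pos (α := 1) (β := -√3) hint (fun _ => weightF_pos)
    (fun t ht => by
      have := (sqrt_three_mul_im_cpow_lt (key t ht)).1
      rw [eulerKernel]
      linarith)
  have h2 := integral_weight_functional_pos (α := 1) (β := √3) hint (fun _ => weightF_pos)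
    (fun t ht => by
      have := (sqrt_three_mul_im_cpow_lt (key t ht)).2
      rw [eulerKernel]
      linarith)
  have e : hyperF z = ((1 / 3 : ℝ) : ℂ) * ∫ t in (0 : ℝ)..1, (weightF t : ℂ) * eulerKernel z t := by
    rw [hyperF]; push_cast; rfl
  rw [e, re_ofReal_mul, im_ofReal_mul, abs_mul, abs_of_pos (by norm_num : (0 : ℝ) < 1 / 3)]
  rcases abs_cases (∫ t in (0 : ℝ)..1, (weightF t : ℂ) * eulerKernel z t).im with h | h <;>
  · rw [h.1]
    linarith

theorem re_hyperPhi_pos_of_re_le {z : ℂ} (hz : z.re ≤ 1) : 0 < (hyperPhi z).re :=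
  lt_of_le_of_lt (by positivity) (abs_im_hyperPhi_lt hz)

theorem re_hyperF_pos {z : ℂ} (hz : z.re < 1) : 0 < (hyperF z).re :=
  lt_of_le_of_lt (by positivity) (abs_im_hyperF_lt hz)

theorem hyperY_zero : hyperY 0 = 0 := by simp [hyperY]

/-- `hyperY` is real on the real axis to the left of `1`, with the sign of its argument. -/
theorem exists_hyperPhi_ofReal {x : ℝ} (hx : x ≤ 1) : ∃ r : ℝ, 0 < r ∧ hyperPhi x = r := by
  refine ⟨(hyperPhi x).re, re_hyperPhi_pos_of_re_le (by simpa using hx), ?_⟩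
  have h := hyperPhi_conj (z := x) (Or.inr (by simpa using hx))
  rw [conj_ofReal] at h
  exact (conj_eq_iff_re.1 h.symm).symm

/-! ### Parametrization of the roots of the cubic -/

/-- Vieta's relations ζ₁+ζ₃+ζ₅ = -4 and ζ₁ζ₃+ζ₁ζ₅+ζ₃ζ₅ = 4 cut out a conic, on which m = (ζ₃-ζ₁)/ζ₅
is a rational coordinate. Exchanging ζ₁ and ζ₃ is m ↦ -m. -/
noncomputable def zetaFive (m : ℂ) : ℂ := -8 / (3 + m ^ 2)

noncomputable def zetaThree (m : ℂ) : ℂ := -2 * (1 + m) ^ 2 / (3 + m ^ 2)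

noncomputable def zetaOne (m : ℂ) : ℂ := -2 * (1 - m) ^ 2 / (3 + m ^ 2)

/-- The value of `A` as a function of the parameter. -/
noncomputable def paramA (m : ℂ) : ℂ := 8 * (m ^ 2 - 1) ^ 2 / (3 + m ^ 2) ^ 3

/-- The normalized value `27 A / 8` as a function of the parameter. -/
noncomputable def paramX (m : ℂ) : ℂ := 27 * (m ^ 2 - 1) ^ 2 / (3 + m ^ 2) ^ 3

/-- The parameters for which `zetaFive, zetaThree, zetaOne` are ordered by their real parts. -/
structure Admissible (m : ℂ) : Prop where
  ne_zero : 3 + m ^ 2 ≠ 0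
  re_nonneg : 0 ≤ m.re
  disc : 0 ≤ 3 - normSq m - 2 * m.re

/-- The open set of parameters corresponding to `0 < Im A`. -/
def openSector : Set ℂ := {m | 0 < m.re ∧ m.im < 0 ∧ 0 < 3 - normSq m - 2 * m.re}

theorem paramA_eq (m : ℂ) : paramA m = 8 / 27 * paramX m := by
  rw [paramA, paramX]; ring

theorem re_sq_param (m : ℂ) : (3 + m ^ 2).re = 3 + m.re ^ 2 - m.im ^ 2 := by
  simp [pow_two, add_sub_assoc]

theorem im_sq_param (m : ℂ) : (3 + m ^ 2).im = 2 * m.re * m.im := by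
  simp [pow_two]; ring

/-- Since 3 + |m|² is positive, the order of ζ₃ and ζ₁ is decided by the sign of Re m. Likewise that
of ζ₃ and ζ₅ is decided by 3 - |m|² - 2 Re m = 4 - |m+1|², so ordered triples correspond to a
half-disc. -/
theorem re_zetaThree_sub_zetaOne (m : ℂ) :
    (zetaThree m - zetaOne m).re = -(8 * m.re * (3 + normSq m)) / normSq (3 + m ^ 2) := by
  have : zetaThree m - zetaOne m = -8 * m / (3 + m ^ 2) := by
    rw [zetaThree, zetaOne, ← sub_div]; ring
  rw [this, div_re, re_sq_param, im_sq_param, ← add_div]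
  congr 1
  simp [normSq_apply]
  ring

theorem re_zetaThree_sub_zetaFive (m : ℂ) :
    (zetaThree m - zetaFive m).re =
      2 * (3 - normSq m - 2 * m.re) * (3 + normSq m) / normSq (3 + m ^ 2) := by
  have : zetaThree m - zetaFive m = 2 * ((1 - m) * (3 + m)) / (3 + m ^ 2) := by
    rw [zetaThree, zetaFive, ← sub_div]; ring
  rw [this, div_re, re_sq_param, im_sq_param, ← add_div]
  congr 1
  simp [normSq_apply]
  ring

theorem im_zetaThree (m : ℂ) :
    (zetaThree m).im = -(4 * m.im * (3 - normSq m + 2 * m.re)) / normSq (3 + m ^ 2) := by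
  rw [zetaThree, div_im, re_sq_param, im_sq_param, ← sub_div]
  congr 1
  simp [normSq_apply, pow_two]
  ring

theorem im_zetaOne (m : ℂ) :
    (zetaOne m).im = 4 * m.im * (3 - normSq m - 2 * m.re) / normSq (3 + m ^ 2) := by
  rw [zetaOne, div_im, re_sq_param, im_sq_param, ← sub_div]
  congr 1
  simp [normSq_apply, pow_two]
  ring

theorem im_zetaFive (m : ℂ) :
    (zetaFive m).im = 16 * m.re * m.im / normSq (3 + m ^ 2) := by
  rw [zetaFive, div_im, re_sq_param, im_sq_param, ← sub_div]
  congr 1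
  simp
  ring

theorem paramX_eq_div_normSq (m : ℂ) : paramX m =
    27 * (m ^ 2 - 1) ^ 2 * (starRingEnd ℂ) (3 + m ^ 2) ^ 3 /
      ((normSq (3 + m ^ 2) ^ 3 : ℝ) : ℂ) := by
  rcases eq_or_ne (3 + m ^ 2) 0 with h | h
  · simp [paramX, h]
  · have h' : (starRingEnd ℂ) (3 + m ^ 2) ≠ 0 := by simpa only [ne_eq, map_eq_zero] using h
    rw [paramX, ofReal_pow, ← mul_conj, mul_pow, mul_div_mul_right _ _ (pow_ne_zero 3 h')]

/-- Over a real denominator the imaginary part splits into factors of known sign on the half-disc;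
the last factor is always positive. So the sign of Im x there is opposite to that of Im m. -/
theorem im_paramX (m : ℂ) :
    (paramX m).im = -(54 * m.re * m.im) * (3 - normSq m + 2 * m.re) * (3 - normSq m - 2 * m.re) *
      (9 + 8 * normSq m + normSq m ^ 2 - 2 * (m.re ^ 2 - m.im ^ 2)) / normSq (3 + m ^ 2) ^ 3 := by
  rw [paramX_eq_div_normSq, div_ofReal_im]
  congr 1
  have e1 : (starRingEnd ℂ) (3 + m ^ 2) = ⟨3 + m.re ^ 2 - m.im ^ 2, -(2 * m.re * m.im)⟩ := by
    rw [← re_sq_param, ← im_sq_param]; rfl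
  have e2 : m ^ 2 - 1 = ⟨m.re ^ 2 - m.im ^ 2 - 1, 2 * m.re * m.im⟩ := by
    apply Complex.ext
    · simp [pow_two]
    · simp [pow_two]; ring
  rw [e1, e2]
  simp only [pow_succ, pow_zero, one_mul, mul_re, mul_im, normSq_apply]
  simp
  ring

theorem Admissible.normSq_pos {m : ℂ} (h : Admissible m) : 0 < normSq (3 + m ^ 2) :=
  Complex.normSq_pos.2 h.ne_zero

theorem Admissible.re_le_one {m : ℂ} (h : Admissible m) : m.re ≤ 1 := by
  have := h.disc
  rw [normSq_apply] at this
  nlinarith [h.re_nonneg, sq_nonneg m.im]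

theorem Admissible.re_lt_one {m : ℂ} (h : Admissible m) (hm : m.im ≠ 0) : m.re < 1 := by
  have := h.disc
  rw [normSq_apply] at this
  have : 0 < m.im * m.im := mul_self_pos.2 hm
  nlinarith [h.re_nonneg]

theorem im_param_factor_pos (m : ℂ) :
    0 < 9 + 8 * normSq m + normSq m ^ 2 - 2 * (m.re ^ 2 - m.im ^ 2) := by
  rw [normSq_apply]
  nlinarith [sq_nonneg m.re, sq_nonneg m.im, sq_nonneg (m.re * m.re + m.im * m.im)]

theorem Admissible.im_zetaThree_nonneg {m : ℂ} (h : Admissible m) (hm : m.im ≤ 0) :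
    0 ≤ (zetaThree m).im := by
  rw [im_zetaThree]
  have h2 : 0 ≤ 3 - normSq m + 2 * m.re := by linarith [h.re_nonneg, h.disc]
  have h3 : 0 ≤ -(4 * m.im * (3 - normSq m + 2 * m.re)) := by
    nlinarith [mul_nonneg (neg_nonneg.2 hm) h2]
  have h5 := h.normSq_pos
  positivity

theorem Admissible.im_zetaOne_nonpos {m : ℂ} (h : Admissible m) (hm : m.im ≤ 0) :
    (zetaOne m).im ≤ 0 := by
  rw [im_zetaOne]
  refine div_nonpos_of_nonpos_of_nonneg ?_ h.normSq_pos.le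
  nlinarith [mul_nonneg (neg_nonneg.2 hm) h.disc]

theorem Admissible.im_zetaFive_nonpos {m : ℂ} (h : Admissible m) (hm : m.im ≤ 0) :
    (zetaFive m).im ≤ 0 := by
  rw [im_zetaFive]
  refine div_nonpos_of_nonpos_of_nonneg ?_ h.normSq_pos.le
  nlinarith [mul_nonneg (neg_nonneg.2 hm) h.re_nonneg]

theorem admissible_of_mem_openSector {m : ℂ} (hm : m ∈ openSector) : Admissible m := by
  refine ⟨fun h => ?_, hm.1.le, hm.2.2.le⟩
  have h1 := congrArg Complex.im h
  rw [im_sq_param] at h1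
  have := mul_neg_of_pos_of_neg hm.1 hm.2.1
  simp at h1
  rcases h1 with h1 | h1
  · exact hm.1.ne' h1
  · exact hm.2.1.ne h1

section openSector

variable {m : ℂ} (hm : m ∈ openSector)
include hm

theorem im_paramX_pos : 0 < (paramX m).im := by
  rw [im_paramX]
  have h1 := hm.2.2
  have h2 : 0 < 3 - normSq m + 2 * m.re := by linarith [hm.1]
  have h3 : 0 < -(54 * m.re * m.im) := by nlinarith [mul_pos hm.1 (neg_pos.2 hm.2.1)]
  have h4 := im_param_factor_pos m
  have h5 := (admissible_of_mem_openSector hm).normSq_pos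
  positivity

theorem im_zetaThree_pos : 0 < (zetaThree m).im := by
  rw [im_zetaThree]
  have h2 : 0 < 3 - normSq m + 2 * m.re := by linarith [hm.1, hm.2.2]
  have h3 : 0 < -(4 * m.im * (3 - normSq m + 2 * m.re)) := by
    nlinarith [mul_pos (neg_pos.2 hm.2.1) h2]
  exact div_pos h3 (admissible_of_mem_openSector hm).normSq_pos

theorem im_zetaOne_neg : (zetaOne m).im < 0 := by
  rw [im_zetaOne]
  refine div_neg_of_neg_of_pos ?_ (admissible_of_mem_openSector hm).normSq_pos
  nlinarith [mul_pos (neg_pos.2 hm.2.1) hm.2.2]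

theorem im_zetaFive_neg : (zetaFive m).im < 0 := by
  rw [im_zetaFive]
  refine div_neg_of_neg_of_pos ?_ (admissible_of_mem_openSector hm).normSq_pos
  nlinarith [mul_pos (neg_pos.2 hm.2.1) hm.1]

end openSector

theorem isOpen_openSector : IsOpen openSector := by
  have h : Continuous fun m : ℂ => 3 - normSq m - 2 * m.re :=
    (continuous_const.sub continuous_normSq).sub (continuous_const.mul continuous_re)
  exact (isOpen_lt continuous_const continuous_re).inter
    ((isOpen_lt continuous_im continuous_const).inter (isOpen_lt continuous_const h))

/-- Concavity of 4 - |m+1|² with its exact defect. It gives convexity of the sector and moves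
boundary points into its interior. -/
theorem disc_combo (p q : ℂ) {s t : ℝ} (hst : s + t = 1) :
    3 - normSq (s • p + t • q) - 2 * (s • p + t • q).re =
      s * (3 - normSq p - 2 * p.re) + t * (3 - normSq q - 2 * q.re) + s * t * normSq (p - q) := by
  obtain rfl : t = 1 - s := by linarith
  simp [normSq_apply]
  ring

theorem convex_openSector : Convex ℝ openSector := by
  rw [convex_iff_forall_pos]
  intro p hp q hq s t hs ht hst
  refine ⟨?_, ?_, ?_⟩
  · have := mul_pos hs hp.1; have := mul_pos ht hq.1
    simp; linarith
  · have := mul_neg_of_pos_of_neg hs hp.2.1; have := mul_neg_of_pos_of_neg ht hq.2.1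
    simp; linarith
  · rw [disc_combo p q hst]
    have := mul_pos hs hp.2.2; have := mul_pos ht hq.2.2
    have := mul_nonneg (mul_pos hs ht).le (normSq_nonneg (p - q))
    linarith

theorem half_mem_openSector : (1 / 2 - I / 2 : ℂ) ∈ openSector := by
  refine ⟨?_, ?_, ?_⟩
  · simp
  · simp
  · simp [normSq_apply]; norm_num

/-- Every admissible parameter with nonpositive imaginary part is a limit of interior ones. -/
theorem Admissible.mem_closure_openSector {m : ℂ} (h : Admissible m) (hm : m.im ≤ 0) :
    m ∈ closure openSector := by
  have hc : Tendsto (fun t : ℝ => (1 - t) • m + t • (1 / 2 - I / 2 : ℂ)) (𝓝[>] 0) (𝓝 m) := by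
    have : Continuous fun t : ℝ => (1 - t) • m + t • (1 / 2 - I / 2 : ℂ) := by fun_prop
    simpa using (this.tendsto 0).mono_left nhdsWithin_le_nhds
  refine mem_closure_of_tendsto hc ?_
  filter_upwards [Ioo_mem_nhdsGT (zero_lt_one : (0 : ℝ) < 1)] with t ht
  have h1 := sub_pos.2 ht.2
  obtain ⟨q1, q2, q3⟩ := half_mem_openSector
  refine ⟨?_, ?_, ?_⟩
  · have := mul_nonneg h1.le h.re_nonneg; have := mul_pos ht.1 q1
    simp only [add_re, real_smul, re_ofReal_mul]; linarith
  · have := mul_nonpos_of_nonneg_of_nonpos h1.le hm; have := mul_neg_of_pos_of_neg ht.1 q2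
    simp only [add_im, real_smul, im_ofReal_mul]; linarith
  · rw [disc_combo _ _ (by ring)]
    have := mul_nonneg h1.le h.disc; have := mul_pos ht.1 q3
    have := mul_nonneg (mul_pos h1 ht.1).le (normSq_nonneg (m - (1 / 2 - I / 2)))
    linarith

/-! ### Root numberings -/

theorem IsRootNumbering.exists_param {A ζ₁ ζ₃ ζ₅ : ℂ} (h : IsRootNumbering A ζ₁ ζ₃ ζ₅) :
    ∃ m : ℂ, Admissible m ∧ ζ₁ = zetaOne m ∧ ζ₃ = zetaThree m ∧ ζ₅ = zetaFive m ∧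
      A = paramA m := by
  have f0 := h.factor 0
  have f1 := h.factor 1
  have f2 := h.factor (-1)
  have hs : ζ₁ + ζ₃ + ζ₅ = -4 := by linear_combination (f1 / 2 + f2 / 2 - f0)
  have he : ζ₁ * ζ₃ + ζ₁ * ζ₅ + ζ₃ * ζ₅ = 4 := by linear_combination (f2 - f1) / 2
  have hA : 4 * A = -(ζ₁ * ζ₃ * ζ₅) := by linear_combination f0
  -- The roots sum to -4 and ζ₅ has the smallest real part, so Re ζ₅ ≤ -4/3.
  have h5 : ζ₅ ≠ 0 := by
    rintro rfl
    have := congrArg Complex.re hs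
    have h1 := h.re_five_le_three
    have h2 := h.re_three_le_one
    simp at this h1
    linarith
  set m := (ζ₃ - ζ₁) / ζ₅ with hm
  have hm' : m * ζ₅ = ζ₃ - ζ₁ := div_mul_cancel₀ _ h5
  have key : (3 + m ^ 2) * ζ₅ = -8 := by
    apply mul_right_cancel₀ h5
    linear_combination (m * ζ₅ + ζ₃ - ζ₁) * hm' + (ζ₃ + ζ₁ - 4 - ζ₅ + 4 * ζ₅) * hs - 4 * he
  have hw : 3 + m ^ 2 ≠ 0 := by
    intro h0
    rw [h0, zero_mul] at key
    norm_num at key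
  have e5 : ζ₅ = zetaFive m := by rw [zetaFive, eq_div_iff hw]; linear_combination key
  have e3 : ζ₃ = zetaThree m := by
    rw [zetaThree, eq_div_iff hw]
    linear_combination (3 + m ^ 2) * hs / 2 - (3 + m ^ 2) * hm' / 2 + (m - 1) / 2 * key
  have e1 : ζ₁ = zetaOne m := by
    rw [zetaOne, eq_div_iff hw]
    linear_combination (3 + m ^ 2) * hs / 2 + (3 + m ^ 2) * hm' / 2 + (-m - 1) / 2 * key
  have hN := Complex.normSq_pos.2 hw
  have hR := normSq_nonneg m
  refine ⟨m, ⟨hw, ?_, ?_⟩, e1, e3, e5, ?_⟩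
  · have h2 : (zetaThree m - zetaOne m).re ≤ 0 := by
      rw [← e3, ← e1, sub_re]; linarith [h.re_three_le_one]
    rw [re_zetaThree_sub_zetaOne] at h2
    replace h2 := le_of_not_gt fun h => (div_pos h hN).not_ge h2
    by_contra hcon
    nlinarith [mul_neg_of_neg_of_pos (not_le.1 hcon) (by linarith : 0 < 3 + normSq m)]
  · have h2 : 0 ≤ (zetaThree m - zetaFive m).re := by
      rw [← e3, ← e5, sub_re]; linarith [h.re_five_le_three]
    rw [re_zetaThree_sub_zetaFive] at h2
    replace h2 := le_of_not_gt fun h => (div_neg_of_neg_of_pos h hN).not_ge h2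
    by_contra hcon
    nlinarith [mul_neg_of_neg_of_pos (not_le.1 hcon) (by linarith : 0 < 3 + normSq m)]
  · have : A = -(ζ₁ * ζ₃ * ζ₅) / 4 := by linear_combination hA / 4
    rw [this, e1, e3, e5, zetaOne, zetaThree, zetaFive, paramA]
    field_simp
    ring

theorem Admissible.isRootNumbering {m : ℂ} (h : Admissible m) :
    IsRootNumbering (paramA m) (zetaOne m) (zetaThree m) (zetaFive m) := by
  have hw := h.ne_zero
  have hN := h.normSq_pos
  have hR := normSq_nonneg m
  refine ⟨fun ζ => ?_, ?_, ?_⟩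
  · rw [zetaOne, zetaThree, zetaFive, paramA]
    field_simp
    ring
  · rw [← sub_nonneg, ← sub_re, re_zetaThree_sub_zetaFive]
    have := h.disc
    positivity
  · rw [← sub_nonpos, ← sub_re, re_zetaThree_sub_zetaOne, neg_div]
    have := h.re_nonneg
    have : 0 ≤ 8 * m.re * (3 + normSq m) / normSq (3 + m ^ 2) := by positivity
    linarith

/-- Every `A` has a root numbering. -/
theorem exists_isRootNumbering (A : ℂ) : ∃ ζ₁ ζ₃ ζ₅ : ℂ, IsRootNumbering A ζ₁ ζ₃ ζ₅ := by
  obtain ⟨p, hp⟩ := IsAlgClosed.exists_root (k := ℂ)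
    (Polynomial.X ^ 3 + Polynomial.C 4 * Polynomial.X ^ 2 + Polynomial.C 4 * Polynomial.X +
      Polynomial.C (4 * A)) (by
        intro h
        have : (Polynomial.X ^ 3 + Polynomial.C 4 * Polynomial.X ^ 2 +
          Polynomial.C 4 * Polynomial.X + Polynomial.C (4 * A) : Polynomial ℂ).degree = 3 := by
            compute_degree!
        rw [this] at h
        norm_num at h)
  have hp' : p ^ 3 + 4 * p ^ 2 + 4 * p + 4 * A = 0 := by simpa [Polynomial.IsRoot] using hp
  -- d² is the discriminant of the quadratic cofactor ζ² + (4+p)ζ + (4+4p+p²) left after splitting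
  -- off the root p.
  obtain ⟨d, hd⟩ := IsAlgClosed.exists_pow_nat_eq ((4 + p) ^ 2 - 4 * (4 + 4 * p + p ^ 2))
    (n := 2) two_pos
  have hfac : ∀ ζ : ℂ, ζ ^ 3 + 4 * ζ ^ 2 + 4 * ζ + 4 * A =
      (ζ - p) * (ζ - (-(4 + p) + d) / 2) * (ζ - (-(4 + p) - d) / 2) := fun ζ => by
    linear_combination hp' + (ζ - p) / 4 * hd
  generalize (-(4 + p) + d) / 2 = q at hfac
  generalize (-(4 + p) - d) / 2 = r at hfac
  rcases le_total p.re q.re with h1 | h1 <;> rcases le_total p.re r.re with h2 | h2 <;>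
    rcases le_total q.re r.re with h3 | h3
  · exact ⟨r, q, p, fun ζ => by rw [hfac]; ring, h1, h3⟩
  · exact ⟨q, r, p, fun ζ => by rw [hfac]; ring, h2, h3⟩
  · exact ⟨q, p, r, fun ζ => by rw [hfac]; ring, h2, h1⟩
  · exact ⟨q, p, r, fun ζ => by rw [hfac]; ring, h2, h1⟩
  · exact ⟨r, p, q, fun ζ => by rw [hfac]; ring, h1, h2⟩
  · exact ⟨r, p, q, fun ζ => by rw [hfac]; ring, h1, h2⟩
  · exact ⟨p, r, q, fun ζ => by rw [hfac]; ring, h3, h2⟩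
  · exact ⟨p, q, r, hfac, h3, h1⟩

theorem exists_admissible (A : ℂ) : ∃ m : ℂ, Admissible m ∧ A = paramA m := by
  obtain ⟨ζ₁, ζ₃, ζ₅, h⟩ := exists_isRootNumbering A
  obtain ⟨m, hm, -, -, -, hA⟩ := h.exists_param
  exact ⟨m, hm, hA⟩

/-! ### The boundary of the parameter domain -/

theorem paramX_ofReal (a : ℝ) :
    paramX a = ((27 * (a ^ 2 - 1) ^ 2 / (3 + a ^ 2) ^ 3 : ℝ) : ℂ) := by
  rw [paramX]; push_cast; rfl

theorem Admissible.paramX_of_im_eq_zero {m : ℂ} (h : Admissible m) (hm : m.im = 0) :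
    ∃ x : ℝ, paramX m = x ∧ 0 ≤ x ∧ x ≤ 1 := by
  obtain ⟨a, rfl⟩ : ∃ a : ℝ, m = a := ⟨m.re, Complex.ext rfl (by simpa using hm)⟩
  refine ⟨_, paramX_ofReal a, by positivity, ?_⟩
  have h0 := h.re_nonneg
  have h1 := h.re_le_one
  rw [ofReal_re] at h0 h1
  rw [div_le_one (by positivity)]
  nlinarith [sq_nonneg a, sq_nonneg (a ^ 2), mul_nonneg (sq_nonneg a) (sub_nonneg.2 (pow_le_one₀ h0 h1 : a ^ 2 ≤ 1))]

/-- On the straight edge of the half-disc ζ₁ and ζ₃ have equal real parts; with m = bi and 0 < b² <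
3 the numerator of x exceeds its denominator. -/
theorem Admissible.paramX_of_re_eq_zero {m : ℂ} (h : Admissible m) (hm : m.re = 0) (hb : m.im < 0) :
    ∃ x : ℝ, paramX m = x ∧ 1 < x := by
  obtain ⟨b, rfl⟩ : ∃ b : ℝ, m = b * I := ⟨m.im, Complex.ext (by simpa using hm) (by simp)⟩
  have e : ((b : ℂ) * I) ^ 2 = -((b ^ 2 : ℝ) : ℂ) := by rw [mul_pow, I_sq]; push_cast; ring
  have hb0 : b < 0 := by simpa using hb
  have h3 : 0 < 3 - b ^ 2 := by
    have h1 := h.disc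
    have h2 := h.ne_zero
    simp [normSq_apply] at h1
    refine lt_of_le_of_ne (by linarith) fun h4 => h2 ?_
    rw [e, ← sub_eq_add_neg]
    exact_mod_cast h4.symm
  refine ⟨27 * (-b ^ 2 - 1) ^ 2 / (3 - b ^ 2) ^ 3, ?_, ?_⟩
  · rw [paramX, e]; push_cast; ring
  · rw [one_lt_div (by positivity)]
    have hb2 : 0 < b ^ 2 := sq_pos_of_neg hb0
    nlinarith [mul_pos hb2 hb2, mul_pos hb2 h3]

theorem paramX_eq_zetaOne {m : ℂ} (h : 3 + m ^ 2 ≠ 0) :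
    paramX m = -(27 / 32) * (zetaOne m * (zetaOne m + 2) ^ 2) := by
  rw [paramX, zetaOne]; field_simp; ring

theorem paramX_eq_zetaThree {m : ℂ} (h : 3 + m ^ 2 ≠ 0) :
    paramX m = -(27 / 32) * (zetaThree m * (zetaThree m + 2) ^ 2) := by
  rw [paramX, zetaThree]; field_simp; ring

theorem paramX_eq_zetaFive {m : ℂ} (h : 3 + m ^ 2 ≠ 0) :
    paramX m = -(27 / 32) * (zetaFive m * (zetaFive m + 2) ^ 2) := by
  rw [paramX, zetaFive]; field_simp; ring

/-- On the circular edge ζ₃ and ζ₅ have equal real parts, and ζ₁ is real and positive. Since x is a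
negative multiple of ζ₁(ζ₁+2)², it is negative. -/
theorem Admissible.paramX_of_disc_eq_zero {m : ℂ} (h : Admissible m)
    (hm : 3 - normSq m - 2 * m.re = 0) (hb : m.im < 0) : ∃ x : ℝ, paramX m = x ∧ x < 0 := by
  have him : (zetaOne m).im = 0 := by rw [im_zetaOne, hm]; simp
  have hlt := h.re_lt_one hb.ne
  have hpos : 0 < m.re := by
    refine lt_of_le_of_ne h.re_nonneg fun h0 => h.ne_zero ?_
    rw [normSq_apply, ← h0] at hm
    apply Complex.ext
    · rw [re_sq_param, ← h0, zero_re]; linarith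
    · rw [im_sq_param, ← h0]; simp
  have hre : (zetaOne m).re = 32 * m.re * (1 - m.re) / normSq (3 + m ^ 2) := by
    rw [zetaOne, div_re, re_sq_param, im_sq_param, ← add_div]
    congr 1
    rw [normSq_apply] at hm
    simp [pow_two]
    have : m.im * m.im = 3 - m.re * m.re - 2 * m.re := by linarith
    linear_combination -2 * (m.im ^ 2 + m.re ^ 2 - 4 * m.re - 1) * this
  obtain ⟨y, hy⟩ : ∃ y : ℝ, y = 32 * m.re * (1 - m.re) / normSq (3 + m ^ 2) := ⟨_, rfl⟩
  have hy0 : 0 < y := by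
    rw [hy]
    exact div_pos (mul_pos (by linarith) (by linarith)) h.normSq_pos
  have hz : zetaOne m = y := Complex.ext (by rw [hre, hy, ofReal_re]) (by rw [him, ofReal_im])
  refine ⟨-(27 / 32) * (y * (y + 2) ^ 2), ?_, ?_⟩
  · rw [paramX_eq_zetaOne h.ne_zero, hz]; push_cast; ring
  · have : 0 < y * (y + 2) ^ 2 := by positivity
    linarith

theorem Admissible.mem_openSector_or {m : ℂ} (h : Admissible m) (hb : m.im < 0) :
    m ∈ openSector ∨ m.re = 0 ∨ 3 - normSq m - 2 * m.re = 0 := by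
  rcases h.re_nonneg.eq_or_lt with h1 | h1
  · exact Or.inr (Or.inl h1.symm)
  rcases h.disc.eq_or_lt with h2 | h2
  · exact Or.inr (Or.inr h2.symm)
  · exact Or.inl ⟨h1, hb, h2⟩

/-! ### The periods in terms of hypergeometric functions -/

theorem hasDerivAt_conj_conj {f : ℂ → ℂ} {f' z : ℂ} (h : HasDerivAt f f' ((starRingEnd ℂ) z)) :
    HasDerivAt (fun z => (starRingEnd ℂ) (f ((starRingEnd ℂ) z))) ((starRingEnd ℂ) f') z := by
  have := h.star_conj
  rw [Complex.conj_conj] at this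
  exact this

/-- For m in the sector ζ₁ and ζ₅ lie in the lower half-plane, where J is continued by reflection;
only ζ₃ lies above the axis. -/
noncomputable def periodJOne (m : ℂ) : ℂ :=
  (starRingEnd ℂ) (periodJ ((starRingEnd ℂ) (zetaOne m)))

noncomputable def periodJThree (m : ℂ) : ℂ := periodJ (zetaThree m)

noncomputable def periodJFive (m : ℂ) : ℂ :=
  (starRingEnd ℂ) (periodJ ((starRingEnd ℂ) (zetaFive m)))

/-- Where both `hyperY x` and `hyperY (1 - x)` are holomorphic. -/
def twoSlitDomain : Set ℂ := {x | x ∈ slitDomain ∧ 1 - x ∈ slitDomain}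

theorem mem_twoSlitDomain_of_im_ne {x : ℂ} (h : x.im ≠ 0) : x ∈ twoSlitDomain :=
  ⟨mem_slitDomain_of_im_ne h, mem_slitDomain_of_im_ne (by simpa using h)⟩

theorem mem_twoSlitDomain_of_re {x : ℂ} (h : 0 < x.re) (h' : x.re < 1) : x ∈ twoSlitDomain :=
  ⟨mem_slitDomain_of_re_lt h', mem_slitDomain_of_re_lt (by simpa using h)⟩

theorem hasDerivAt_hyperY_one_sub {x : ℂ} (hx : 1 - x ∈ slitDomain) :
    HasDerivAt (fun x => hyperY (1 - x)) (-hyperF (1 - x)) x := by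
  simpa using (hasDerivAt_hyperY hx).comp_const_sub 1 x

theorem hasDerivAt_hyperF_one_sub {x : ℂ} (hx : 1 - x ∈ slitDomain) :
    HasDerivAt (fun x => hyperF (1 - x)) (-(2 / 9 * hyperPhi (1 - x) / x)) x := by
  simpa using (hasDerivAt_hyperF hx).comp_const_sub 1 x

/-- The Wronskian of Y(x) and Y(1-x). It is constant because the equation has no first-order term.
-/
noncomputable def hyperWronskian (x : ℂ) : ℂ :=
  hyperF x * hyperY (1 - x) + hyperF (1 - x) * hyperY x

theorem hasDerivAt_hyperWronskian {x : ℂ} (hx : x ∈ twoSlitDomain) :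
    HasDerivAt hyperWronskian 0 x := by
  have h1 : 1 - x ≠ 0 := slitPlane_ne_zero hx.1
  have h2 : x ≠ 0 := by simpa using slitPlane_ne_zero hx.2
  refine (((hasDerivAt_hyperF hx.1).mul (hasDerivAt_hyperY_one_sub hx.2)).add
    ((hasDerivAt_hyperF_one_sub hx.2).mul (hasDerivAt_hyperY hx.1))).congr_deriv ?_
  rw [hyperY, hyperY]
  field_simp
  ring

theorem hyperWronskian_half_ne_zero : hyperWronskian (1 / 2) ≠ 0 := by
  have e : hyperWronskian (1 / 2) = hyperF (1 / 2) * hyperPhi (1 / 2) := by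
    simp only [hyperWronskian, hyperY]
    norm_num
    ring
  rw [e]
  have hF : 0 < (hyperF (1 / 2)).re := re_hyperF_pos (by norm_num)
  have hP : 0 < (hyperPhi (1 / 2)).re := re_hyperPhi_pos_of_re_le (by norm_num)
  refine mul_ne_zero (fun h => ?_) (fun h => ?_)
  · rw [h] at hF; simp at hF
  · rw [h] at hP; simp at hP

theorem hyperWronskian_eq {x : ℂ} (hx : 0 < x.im) :
    hyperWronskian x = hyperWronskian (1 / 2) := by
  -- The vertical strip is adjoined to connect the upper half-plane to x = 1/2, where positivity of
  -- F and Φ shows that the constant is nonzero.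
  set V : Set ℂ := {x | 0 < x.im} ∪ {x | 0 < x.re ∧ x.re < 1} with hV
  have hsub : V ⊆ twoSlitDomain := by
    rintro y (hy | hy)
    · exact mem_twoSlitDomain_of_im_ne (ne_of_gt hy)
    · exact mem_twoSlitDomain_of_re hy.1 hy.2
  have hopen : IsOpen V := isOpen_upper.union
    ((isOpen_lt continuous_const continuous_re).inter (isOpen_lt continuous_re continuous_const))
  have hconn : IsPreconnected V := by
    have h1 : IsPreconnected {x : ℂ | 0 < x.im} := (convex_halfSpace_im_gt 0).isPreconnected
    have h2 : IsPreconnected {x : ℂ | 0 < x.re ∧ x.re < 1} :=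
      ((convex_halfSpace_re_gt 0).inter (convex_halfSpace_re_lt 1)).isPreconnected
    refine h1.union (1 / 2 + I) ?_ ?_ h2
    · simp
    · simp; norm_num
  refine hopen.is_const_of_deriv_eq_zero hconn (fun y hy =>
    (hasDerivAt_hyperWronskian (hsub hy)).differentiableAt.differentiableWithinAt)
    (fun y hy => (hasDerivAt_hyperWronskian (hsub hy)).deriv) (Or.inl hx) (Or.inr ?_)
  simp; norm_num

/-- A solution of the Picard–Fuchs equation, pulled back to the parameter domain, is a
combination of two hypergeometric functions. -/
theorem exists_hyper_combination {J K u : ℂ → ℂ} {U : Set ℂ}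
    (hJ : ∀ z ∈ U, HasDerivAt J ((z + 2) * (3 * z + 2) * K z) z)
    (hK : ∀ z ∈ U, HasDerivAt K (-6 * J z / (z * (z + 2) * (3 * z + 2) * (3 * z + 8))) z)
    (hu : ∀ m ∈ openSector, u m ∈ U ∧ DifferentiableAt ℂ u m)
    (hU : ∀ z ∈ U, z.im ≠ 0)
    (hx : ∀ m ∈ openSector, paramX m = -(27 / 32) * (u m * (u m + 2) ^ 2)) :
    ∃ a b : ℂ, ∀ m ∈ openSector, J (u m) = a * hyperY (paramX m) + b * hyperY (1 - paramX m) := by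
  have hconn := convex_openSector.isPreconnected
  have hu' : ∀ m ∈ openSector, HasDerivAt u (deriv u m) m := fun m hm => (hu m hm).2.hasDerivAt
  have hx' : ∀ m ∈ openSector, HasDerivAt paramX
      (-(27 / 32) * ((u m + 2) * (3 * u m + 2)) * deriv u m) m := by
    intro m hm
    have h1 := (((hu' m hm).mul (((hu' m hm).add_const (2 : ℂ)).pow 2))).const_mul (-(27 / 32) : ℂ)
    refine (h1.congr_of_eventuallyEq ?_).congr_deriv ?_
    · filter_upwards [isOpen_openSector.mem_nhds hm] with y hy
      exact hx y hy
    · simp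
      ring
  have hne : ∀ m ∈ openSector, u m ≠ 0 ∧ u m + 2 ≠ 0 ∧ 3 * u m + 2 ≠ 0 ∧ 3 * u m + 8 ≠ 0 := by
    intro m hm
    have h0 := hU _ (hu m hm).1
    refine ⟨?_, ?_, ?_, ?_⟩ <;> intro h <;> apply h0 <;> have := congrArg im h <;> simpa using this
  have hone : ∀ m ∈ openSector, 1 - paramX m = (3 * u m + 2) ^ 2 * (3 * u m + 8) / 32 := by
    intro m hm
    rw [hx m hm]; ring
  have hmem : ∀ m ∈ openSector, paramX m ∈ twoSlitDomain := fun m hm =>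
    mem_twoSlitDomain_of_im_ne (im_paramX_pos hm).ne'
  have hJ' : ∀ m ∈ openSector, HasDerivAt (fun m => J (u m)) _ m := fun m hm =>
    (hJ _ (hu m hm).1).comp m (hu' m hm)
  have hK' : ∀ m ∈ openSector, HasDerivAt (fun m => K (u m)) _ m := fun m hm =>
    (hK _ (hu m hm).1).comp m (hu' m hm)
  have hY0 : ∀ m ∈ openSector, HasDerivAt (fun m => hyperY (paramX m)) _ m := fun m hm =>
    (hasDerivAt_hyperY (hmem m hm).1).comp m (hx' m hm)
  have hF0 : ∀ m ∈ openSector, HasDerivAt (fun m => hyperF (paramX m)) _ m := fun m hm =>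
    (hasDerivAt_hyperF (hmem m hm).1).comp m (hx' m hm)
  have hY1 : ∀ m ∈ openSector, HasDerivAt (fun m => hyperY (1 - paramX m)) _ m := fun m hm =>
    (hasDerivAt_hyperY_one_sub (hmem m hm).2).comp m (hx' m hm)
  have hF1 : ∀ m ∈ openSector, HasDerivAt (fun m => hyperF (1 - paramX m)) _ m := fun m hm =>
    (hasDerivAt_hyperF_one_sub (hmem m hm).2).comp m (hx' m hm)
  -- Because dx/du = -(27/32)(u+2)(3u+2), one has dJ/dx = -(32/27)K. So this is the Wronskian of J
  -- with Y(x), and the next expression is minus that with Y(1-x). Both are constant, and J is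
  -- recovered from them by Cramer's rule.
  have hc0 : ∀ m ∈ openSector, HasDerivAt (fun m => J (u m) * hyperF (paramX m) +
      32 / 27 * (K (u m) * hyperY (paramX m))) 0 m := by
    intro m hm
    refine (((hJ' m hm).mul (hF0 m hm)).add
      (((hK' m hm).mul (hY0 m hm)).const_mul (32 / 27 : ℂ))).congr_deriv ?_
    obtain ⟨n1, n2, n3, n4⟩ := hne m hm
    rw [hyperY]
    generalize hyperF (paramX m) = F
    generalize hyperPhi (paramX m) = P
    rw [hone m hm, hx m hm]
    generalize J (u m) = j
    generalize u m = w at *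
    generalize h4 : 3 * w + 8 = q at *
    obtain rfl : w = (q - 8) / 3 := by rw [← h4]; ring
    have n1' : q - 8 ≠ 0 := fun h => n1 (by linear_combination h / 3)
    have n2' : q - 2 ≠ 0 := fun h => n2 (by linear_combination h / 3)
    have n3' : q - 6 ≠ 0 := fun h => n3 (by linear_combination h)
    rw [show (q - 8) / 3 + 2 = (q - 2) / 3 by ring, show 3 * ((q - 8) / 3) + 2 = q - 6 by ring]
    field_simp
    ring
  have hc1 : ∀ m ∈ openSector, HasDerivAt (fun m => J (u m) * hyperF (1 - paramX m) -
      32 / 27 * (K (u m) * hyperY (1 - paramX m))) 0 m := by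
    intro m hm
    refine (((hJ' m hm).mul (hF1 m hm)).sub
      (((hK' m hm).mul (hY1 m hm)).const_mul (32 / 27 : ℂ))).congr_deriv ?_
    obtain ⟨n1, n2, n3, n4⟩ := hne m hm
    rw [hyperY]
    generalize hyperF (1 - paramX m) = F
    generalize hyperPhi (1 - paramX m) = P
    rw [hone m hm, hx m hm]
    generalize J (u m) = j
    generalize u m = w at *
    generalize h4 : 3 * w + 8 = q at *
    obtain rfl : w = (q - 8) / 3 := by rw [← h4]; ring
    have n1' : q - 8 ≠ 0 := fun h => n1 (by linear_combination h / 3)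
    have n2' : q - 2 ≠ 0 := fun h => n2 (by linear_combination h / 3)
    have n3' : q - 6 ≠ 0 := fun h => n3 (by linear_combination h)
    rw [show (q - 8) / 3 + 2 = (q - 2) / 3 by ring, show 3 * ((q - 8) / 3) + 2 = q - 6 by ring]
    field_simp
    ring
  obtain ⟨c0, h0⟩ := isOpen_openSector.exists_is_const_of_deriv_eq_zero hconn
    (fun m hm => (hc0 m hm).differentiableAt.differentiableWithinAt) fun m hm => (hc0 m hm).deriv
  obtain ⟨c1, h1⟩ := isOpen_openSector.exists_is_const_of_deriv_eq_zero hconn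
    (fun m hm => (hc1 m hm).differentiableAt.differentiableWithinAt) fun m hm => (hc1 m hm).deriv
  have hW := hyperWronskian_half_ne_zero
  refine ⟨c1 / hyperWronskian (1 / 2), c0 / hyperWronskian (1 / 2), fun m hm => ?_⟩
  have h2 := hyperWronskian_eq (im_paramX_pos hm)
  rw [← h0 m hm, ← h1 m hm, ← h2]
  rw [← h2] at hW
  field_simp
  rw [hyperWronskian]
  ring

theorem differentiableAt_zetaThree {m : ℂ} (h : 3 + m ^ 2 ≠ 0) :
    DifferentiableAt ℂ zetaThree m := by
  unfold zetaThree
  exact DifferentiableAt.div (by fun_prop) (by fun_prop) h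

theorem differentiableAt_zetaOne {m : ℂ} (h : 3 + m ^ 2 ≠ 0) :
    DifferentiableAt ℂ zetaOne m := by
  unfold zetaOne
  exact DifferentiableAt.div (by fun_prop) (by fun_prop) h

theorem differentiableAt_zetaFive {m : ℂ} (h : 3 + m ^ 2 ≠ 0) :
    DifferentiableAt ℂ zetaFive m := by
  unfold zetaFive
  exact DifferentiableAt.div (by fun_prop) (by fun_prop) h

theorem differentiableAt_paramX {m : ℂ} (h : 3 + m ^ 2 ≠ 0) :
    DifferentiableAt ℂ paramX m := by
  unfold paramX
  exact DifferentiableAt.div (by fun_prop) (by fun_prop) (pow_ne_zero 3 h)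

theorem hasDerivAt_periodK_periodJ {u : ℂ} (hu : 0 < u.im) : HasDerivAt periodK
    (-6 * periodJ u / (u * (u + 2) * (3 * u + 2) * (3 * u + 8))) u := by
  refine (hasDerivAt_periodK' hu).congr_deriv ?_
  have h0 : u ≠ 0 := by rintro rfl; simp at hu
  rw [periodJ, mul_assoc u, mul_assoc u, ← mul_div_mul_left _ _ h0]
  ring

theorem exists_periodJThree_eq : ∃ a b : ℂ, ∀ m ∈ openSector,
    periodJThree m = a * hyperY (paramX m) + b * hyperY (1 - paramX m) :=
  exists_hyper_combination (J := periodJ) (u := zetaThree) (U := {z | 0 < z.im}) (fun _ hz => hasDerivAt_periodJ hz)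
    (fun _ hz => hasDerivAt_periodK_periodJ hz)
    (fun _ hm => ⟨im_zetaThree_pos hm,
      differentiableAt_zetaThree (admissible_of_mem_openSector hm).ne_zero⟩)
    (fun _ hz => ne_of_gt hz)
    (fun _ hm => paramX_eq_zetaThree (admissible_of_mem_openSector hm).ne_zero)

theorem exists_hyper_combination_conj {u : ℂ → ℂ}
    (hu : ∀ m ∈ openSector, (u m).im < 0 ∧ DifferentiableAt ℂ u m)
    (hx : ∀ m ∈ openSector, paramX m = -(27 / 32) * (u m * (u m + 2) ^ 2)) :
    ∃ a b : ℂ, ∀ m ∈ openSector, (starRingEnd ℂ) (periodJ ((starRingEnd ℂ) (u m))) =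
      a * hyperY (paramX m) + b * hyperY (1 - paramX m) := by
  refine exists_hyper_combination (U := {z | z.im < 0})
    (J := fun z => (starRingEnd ℂ) (periodJ ((starRingEnd ℂ) z)))
    (K := fun z => (starRingEnd ℂ) (periodK ((starRingEnd ℂ) z)))
    (fun z hz => ?_) (fun z hz => ?_) hu (fun _ hz => ne_of_lt hz) hx
  · refine (hasDerivAt_conj_conj (hasDerivAt_periodJ (by simpa using hz))).congr_deriv ?_
    simp [Complex.conj_ofNat]
  · refine (hasDerivAt_conj_conj (hasDerivAt_periodK_periodJ (by simpa using hz))).congr_deriv ?_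
    simp [Complex.conj_ofNat]

theorem exists_periodJOne_eq : ∃ a b : ℂ, ∀ m ∈ openSector,
    periodJOne m = a * hyperY (paramX m) + b * hyperY (1 - paramX m) :=
  exists_hyper_combination_conj (fun _ hm => ⟨im_zetaOne_neg hm,
    differentiableAt_zetaOne (admissible_of_mem_openSector hm).ne_zero⟩)
    (fun _ hm => paramX_eq_zetaOne (admissible_of_mem_openSector hm).ne_zero)

theorem exists_periodJFive_eq : ∃ a b : ℂ, ∀ m ∈ openSector,
    periodJFive m = a * hyperY (paramX m) + b * hyperY (1 - paramX m) :=
  exists_hyper_combination_conj (fun _ hm => ⟨im_zetaFive_neg hm,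
    differentiableAt_zetaFive (admissible_of_mem_openSector hm).ne_zero⟩)
    (fun _ hm => paramX_eq_zetaFive (admissible_of_mem_openSector hm).ne_zero)

/-- The closed lower half of the parameter domain. -/
def closedSector : Set ℂ := {m | Admissible m ∧ m.im ≤ 0}

theorem continuousOn_conj_periodJ_conj :
    ContinuousOn (fun z => (starRingEnd ℂ) (periodJ ((starRingEnd ℂ) z))) {z | z.im ≤ 0} :=
  continuous_conj.comp_continuousOn (continuousOn_periodJ.comp continuous_conj.continuousOn
    fun z hz => by simpa using hz)

theorem continuousOn_periodJThree : ContinuousOn periodJThree closedSector :=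
  continuousOn_periodJ.comp
    (fun _ hm => (differentiableAt_zetaThree hm.1.ne_zero).continuousAt.continuousWithinAt)
    fun _ hm => hm.1.im_zetaThree_nonneg hm.2

theorem continuousOn_periodJOne : ContinuousOn periodJOne closedSector :=
  continuousOn_conj_periodJ_conj.comp
    (fun _ hm => (differentiableAt_zetaOne hm.1.ne_zero).continuousAt.continuousWithinAt)
    fun _ hm => hm.1.im_zetaOne_nonpos hm.2

theorem continuousOn_periodJFive : ContinuousOn periodJFive closedSector :=
  continuousOn_conj_periodJ_conj.comp
    (fun _ hm => (differentiableAt_zetaFive hm.1.ne_zero).continuousAt.continuousWithinAt)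
    fun _ hm => hm.1.im_zetaFive_nonpos hm.2

theorem openSector_subset_closedSector : openSector ⊆ closedSector :=
  fun _ hm => ⟨admissible_of_mem_openSector hm, hm.2.1.le⟩

theorem closedSector_subset_closure : closedSector ⊆ closure openSector :=
  fun _ hm => hm.1.mem_closure_openSector hm.2

theorem ofReal_mem_closedSector {a : ℝ} (ha : a ∈ Icc (0 : ℝ) 1) : (a : ℂ) ∈ closedSector := by
  refine ⟨⟨?_, by simpa using ha.1, ?_⟩, by simp⟩
  · have : 3 + (a : ℂ) ^ 2 = ((3 + a ^ 2 : ℝ) : ℂ) := by push_cast; rfl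
    rw [this, ofReal_ne_zero]
    positivity
  · simp [normSq_apply]
    nlinarith [ha.1, ha.2]

theorem paramX_ofReal_mem {a : ℝ} (ha : a ∈ Icc (0 : ℝ) 1) :
    0 ≤ (paramX a).re ∧ (paramX a).re ≤ 1 := by
  obtain ⟨x, hx, h0, h1⟩ := (ofReal_mem_closedSector ha).1.paramX_of_im_eq_zero (by simp)
  rw [hx]
  exact ⟨by simpa using h0, by simpa using h1⟩

theorem paramX_ofReal_mem_Ioo {a : ℝ} (ha : a ∈ Ioo (0 : ℝ) 1) :
    0 < (paramX a).re ∧ (paramX a).re < 1 := by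
  rw [paramX_ofReal, ofReal_re]
  have h1 : a ^ 2 < 1 := by nlinarith [ha.1, ha.2]
  have h2 : 0 < a ^ 2 := pow_pos ha.1 2
  constructor
  · have : 0 < (a ^ 2 - 1) ^ 2 := by
      have : a ^ 2 - 1 ≠ 0 := by linarith
      positivity
    positivity
  · rw [div_lt_one (by positivity)]
    nlinarith [mul_pos h2 h2, mul_pos h2 (sub_pos.2 h1)]

/-- Linear relations extend from the open sector to the real segment `[0, 1]`. -/
theorem eq_combination_ofReal {J : ℂ → ℂ} (hJ : ContinuousOn J closedSector) {α β : ℂ}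
    (h : ∀ m ∈ openSector, J m = α * hyperY (paramX m) + β * hyperY (1 - paramX m))
    {a : ℝ} (ha : a ∈ Icc (0 : ℝ) 1) :
    J a = α * hyperY (paramX a) + β * hyperY (1 - paramX a) := by
  have hX : ∀ a ∈ Icc (0 : ℝ) 1, ContinuousAt paramX a := fun a ha =>
    (differentiableAt_paramX (ofReal_mem_closedSector ha).1.ne_zero).continuousAt
  have key : ∀ a ∈ Ioo (0 : ℝ) 1,
      J a = α * hyperY (paramX a) + β * hyperY (1 - paramX a) := by
    intro a ha
    have ha' := ofReal_mem_closedSector (Ioo_subset_Icc_self ha)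
    obtain ⟨h1, h2⟩ := paramX_ofReal_mem_Ioo ha
    have hV := mem_twoSlitDomain_of_re h1 h2
    have c1 : ContinuousAt (fun m => hyperY (paramX m)) a :=
      (hasDerivAt_hyperY hV.1).continuousAt.comp (hX a (Ioo_subset_Icc_self ha))
    have c2 : ContinuousAt (fun m => hyperY (1 - paramX m)) a :=
      ContinuousAt.comp (g := fun x => hyperY (1 - x))
        (hasDerivAt_hyperY_one_sub hV.2).continuousAt (hX a (Ioo_subset_Icc_self ha))
    have hne : (𝓝[openSector] (a : ℂ)).NeBot :=
      mem_closure_iff_nhdsWithin_neBot.1 (closedSector_subset_closure ha')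
    have t1 : Tendsto J (𝓝[openSector] (a : ℂ)) (𝓝 (J a)) :=
      (hJ a ha').mono openSector_subset_closedSector
    have t2 : Tendsto (fun m => α * hyperY (paramX m) + β * hyperY (1 - paramX m))
        (𝓝[openSector] (a : ℂ)) (𝓝 (α * hyperY (paramX a) + β * hyperY (1 - paramX a))) :=
      ((continuousAt_const.mul c1).add (continuousAt_const.mul c2)).continuousWithinAt
    refine tendsto_nhds_unique (t1.congr' ?_) t2
    filter_upwards [self_mem_nhdsWithin] with m hm using h m hm
  have hXr : ContinuousOn (fun a : ℝ => paramX a) (Icc 0 1) := fun a ha =>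
    (ContinuousAt.comp (g := paramX) (hX a ha) continuous_ofReal.continuousAt).continuousWithinAt
  -- At a = 0 and a = 1 one of x, 1-x equals 1, where Y is only known to be continuous; the
  -- endpoints are therefore reached by density.
  refine EqOn.of_subset_closure (s := Ioo 0 1) (t := Icc 0 1) (f := fun a : ℝ => J a)
    (g := fun a : ℝ => α * hyperY (paramX a) + β * hyperY (1 - paramX a))
    (fun a ha => key a ha) ?_ ?_ Ioo_subset_Icc_self (closure_Ioo zero_ne_one).ge ha
  · exact hJ.comp continuous_ofReal.continuousOn fun a ha => ofReal_mem_closedSector ha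
  · refine (continuousOn_const.mul ?_).add (continuousOn_const.mul ?_)
    · exact continuousOn_hyperY.comp hXr fun a ha => (paramX_ofReal_mem ha).2
    · refine continuousOn_hyperY.comp (continuousOn_const.sub hXr) fun a ha => ?_
      have := (paramX_ofReal_mem ha).1
      simpa using this

theorem exists_hyperY_one : ∃ r : ℝ, 0 < r ∧ hyperY 1 = r := by
  obtain ⟨r, h, h'⟩ := exists_hyperPhi_ofReal le_rfl
  exact ⟨r, h, by rw [hyperY, one_mul, ← h', ofReal_one]⟩

/-- The periods in terms of `hyperY`. -/
theorem exists_period_relations : ∃ α β μ : ℝ, α ≠ 0 ∧ β ≠ 0 ∧ μ ≠ 0 ∧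
    (∀ m ∈ openSector, periodJOne m = α * hyperY (paramX m)) ∧
    (∀ m ∈ openSector, periodJThree m =
      α * hyperY (paramX m) + β * I * hyperY (1 - paramX m)) ∧
    ∀ m ∈ closedSector, periodJThree m + periodJFive m = μ * periodJOne m := by
  obtain ⟨a1, b1, h1⟩ := exists_periodJOne_eq
  obtain ⟨a3, b3, h3⟩ := exists_periodJThree_eq
  obtain ⟨a5, b5, h5⟩ := exists_periodJFive_eq
  obtain ⟨y, hy, hy1⟩ := exists_hyperY_one
  have m0 : (0 : ℝ) ∈ Icc (0 : ℝ) 1 := by simp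
  have m1 : (1 : ℝ) ∈ Icc (0 : ℝ) 1 := by simp
  have x0 : paramX 0 = 1 := by norm_num [paramX]
  have x1 : paramX 1 = 0 := by norm_num [paramX]
  have p1 := eq_combination_ofReal continuousOn_periodJOne h1 m0
  have q1 := eq_combination_ofReal continuousOn_periodJOne h1 m1
  have p3 := eq_combination_ofReal continuousOn_periodJThree h3 m0
  have q3 := eq_combination_ofReal continuousOn_periodJThree h3 m1
  have p5 := eq_combination_ofReal continuousOn_periodJFive h5 m0
  have q5 := eq_combination_ofReal continuousOn_periodJFive h5 m1
  simp only [ofReal_zero, ofReal_one, x0, x1, sub_self, sub_zero, hyperY_zero, hy1, mul_zero,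
    add_zero, zero_add] at p1 q1 p3 q3 p5 q5
  obtain ⟨r, hr, hr0, hr1⟩ := periodJ_neg_two_thirds
  obtain ⟨s, hs, hs0⟩ := periodJ_neg_two
  obtain ⟨t, ht, ht1⟩ := periodJ_neg_eight_thirds
  have z10 : zetaOne 0 = -2 / 3 := by norm_num [zetaOne]
  have z11 : zetaOne 1 = 0 := by norm_num [zetaOne]
  have z30 : zetaThree 0 = -2 / 3 := by norm_num [zetaThree]
  have z31 : zetaThree 1 = -2 := by norm_num [zetaThree]
  have z50 : zetaFive 0 = -8 / 3 := by norm_num [zetaFive]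
  have z51 : zetaFive 1 = -2 := by norm_num [zetaFive]
  have cc : ∀ n : ℝ, (starRingEnd ℂ) (n : ℂ) = n := conj_ofReal
  rw [periodJOne, z10] at p1
  rw [periodJOne, z11] at q1
  rw [periodJThree, z30] at p3
  rw [periodJThree, z31] at q3
  rw [periodJFive, z50] at p5
  rw [periodJFive, z51] at q5
  simp only [map_div₀, map_neg, map_ofNat, map_zero, periodJ_zero, hr, hs, ht, map_mul, conj_I,
    conj_ofReal] at p1 q1 p3 q3 p5 q5
  have hy' : (y : ℂ) ≠ 0 := ofReal_ne_zero.2 hy.ne'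
  have e1 : a1 = r / y := by rw [p1, mul_div_cancel_right₀ _ hy']
  have e3 : a3 = r / y := by rw [p3, mul_div_cancel_right₀ _ hy']
  have e5 : a5 = t / y := by rw [p5, mul_div_cancel_right₀ _ hy']
  have f1 : b1 = 0 := by simpa [hy'] using q1.symm
  have f3 : b3 = s / y * I := by rw [eq_comm, ← eq_div_iff hy'] at q3; rw [q3]; ring
  have f5 : b5 = -(s / y * I) := by rw [eq_comm, ← eq_div_iff hy'] at q5; rw [q5]; ring
  have hr' : (r : ℂ) ≠ 0 := ofReal_ne_zero.2 hr0.ne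
  -- At x = 1 the triple (J₁, J₃, J₅) is (r, r, t), at x = 0 it is (0, si, -si). Thus Y(1-x) cancels
  -- from J₃ + J₅, leaving the ratio (r+t)/r to J₁. It is nonzero because r ≥ -32/27 while t >
  -- 32/27.
  refine ⟨r / y, s / y, (r + t) / r, (div_neg_of_neg_of_pos hr0 hy).ne,
    (div_neg_of_neg_of_pos hs0 hy).ne, div_ne_zero (by linarith) hr0.ne, fun m hm => ?_,
    fun m hm => ?_, ?_⟩
  · rw [h1 m hm, e1, f1]; push_cast; ring
  · rw [h3 m hm, e3, f3]; push_cast; ring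
  · refine EqOn.of_subset_closure (s := openSector) (f := fun m => periodJThree m + periodJFive m)
      (fun m hm => ?_) (continuousOn_periodJThree.add continuousOn_periodJFive)
      (continuousOn_const.mul continuousOn_periodJOne) openSector_subset_closedSector
      closedSector_subset_closure
    simp only [h1 m hm, h3 m hm, h5 m hm, e1, e3, e5, f1, f3, f5]
    push_cast
    field_simp
    ring

/-! ### Incomplete periods along segments -/

theorem csqrt_sq {w : ℂ} (hw : 0 < w.re) : Complex.sqrt (w ^ 2) = w := by
  have h := abs_lt.1 (abs_arg_lt_pi_div_two_iff.2 (Or.inl hw))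
  rw [Complex.sqrt]
  exact_mod_cast Complex.pow_cpow_nat_inv (x := w) (n := 2) two_ne_zero
    (by push_cast; linarith [h.1]) (by push_cast; linarith [h.2])

theorem csqrt_one : Complex.sqrt 1 = 1 := by
  have := csqrt_sq (w := 1) (by simp)
  rwa [one_pow] at this

/-- The points where `w ↦ sqrt (1 - w)` is continuous. -/
def slitClosure : Set ℂ := {w | 0 ≤ (1 - w).re ∨ (1 - w).im ≠ 0}

theorem slitDomain_subset_slitClosure : slitDomain ⊆ slitClosure := fun _ h =>
  h.imp (fun h => le_of_lt h) id

theorem one_mem_slitClosure : (1 : ℂ) ∈ slitClosure := Or.inl (by simp)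

theorem mul_mem_slitDomain {w : ℂ} (hw : w ∈ slitDomain) {t : ℝ} (ht : t ∈ Icc (0 : ℝ) 1) :
    w * t ∈ slitDomain := one_sub_mul_mem_slitPlane hw ht

theorem mul_mem_slitClosure {w : ℂ} (hw : w ∈ slitClosure) {t : ℝ} (ht : t ∈ Icc (0 : ℝ) 1) :
    w * t ∈ slitClosure := by
  rcases eq_or_lt_of_le ht.1 with h | h
  · rw [← h]; exact Or.inl (by simp)
  rcases hw with hw | hw
  · refine Or.inl ?_
    simp at hw ⊢
    nlinarith [ht.2, ht.1]
  · refine Or.inr ?_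
    simp at hw ⊢
    exact ⟨hw, h.ne'⟩

theorem mem_slitDomain_of_forall {w : ℂ} (h : ∀ ρ : ℝ, 1 ≤ ρ → w ≠ ρ) : w ∈ slitDomain := by
  by_contra hw
  simp only [slitDomain, mem_ofPred_eq, mem_slitPlane_iff, not_or, not_lt, not_not] at hw
  refine h w.re (by simpa using hw.1) (Complex.ext (by simp) ?_)
  simpa [neg_eq_zero] using hw.2

/-- A non-real number with real square is purely imaginary, so that square is negative. The roots
(1-m)², (1+m)², 4 are squares, which brings all their quotients under this criterion. -/
theorem sq_mem_slitDomain {ρ : ℂ} (h : ρ.im ≠ 0) : ρ ^ 2 ∈ slitDomain := by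
  refine mem_slitDomain_of_forall fun s hs hρ => ?_
  have h1 := congrArg im hρ
  have h2 := congrArg re hρ
  simp [pow_two] at h1 h2
  have h3 : ρ.re = 0 := by
    have : ρ.re * ρ.im = 0 := by linarith
    simpa [h] using this
  rw [h3] at h2
  nlinarith [mul_self_pos.2 h]

/-- The branch with value 1 at 0; its cuts run outward from each root along the ray from 0, so the
domain is star-shaped about 0. -/
noncomputable def tripleSqrt (r₁ r₃ r₅ z : ℂ) : ℂ :=
  Complex.sqrt (1 - z / r₁) * Complex.sqrt (1 - z / r₃) * Complex.sqrt (1 - z / r₅)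

def tripleDomain (r₁ r₃ r₅ : ℂ) : Set ℂ :=
  {z | z / r₁ ∈ slitDomain ∧ z / r₃ ∈ slitDomain ∧ z / r₅ ∈ slitDomain}

def tripleClosure (r₁ r₃ r₅ : ℂ) : Set ℂ :=
  {z | z / r₁ ∈ slitClosure ∧ z / r₃ ∈ slitClosure ∧ z / r₅ ∈ slitClosure}

/-- The integral of S(z)/√z from 0 to z divided by √z, via the substitution z ↦ z sin²η. Dividing
out √z leaves a function that is single-valued near 0. -/
noncomputable def incompletePeriod (r₁ r₃ r₅ z : ℂ) : ℂ :=
  ∫ η in (0 : ℝ)..Real.pi / 2, 2 * tripleSqrt r₁ r₃ r₅ (z * (Real.sin η ^ 2 : ℝ)) * Real.cos η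

section triple

variable {r₁ r₃ r₅ : ℂ}

theorem isOpen_tripleDomain : IsOpen (tripleDomain r₁ r₃ r₅) :=
  (isOpen_slitDomain.preimage (continuous_id.div_const _)).inter
    ((isOpen_slitDomain.preimage (continuous_id.div_const _)).inter
      (isOpen_slitDomain.preimage (continuous_id.div_const _)))

theorem mul_mem_tripleDomain {z : ℂ} (hz : z ∈ tripleDomain r₁ r₃ r₅) {t : ℝ}
    (ht : t ∈ Icc (0 : ℝ) 1) : z * t ∈ tripleDomain r₁ r₃ r₅ := by
  refine ⟨?_, ?_, ?_⟩ <;> rw [mul_div_right_comm] <;> apply mul_mem_slitDomain _ ht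
  exacts [hz.1, hz.2.1, hz.2.2]

theorem mul_mem_tripleClosure {z : ℂ} (hz : z ∈ tripleClosure r₁ r₃ r₅) {t : ℝ}
    (ht : t ∈ Icc (0 : ℝ) 1) : z * t ∈ tripleClosure r₁ r₃ r₅ := by
  refine ⟨?_, ?_, ?_⟩ <;> rw [mul_div_right_comm] <;> apply mul_mem_slitClosure _ ht
  exacts [hz.1, hz.2.1, hz.2.2]

theorem tripleDomain_subset : tripleDomain r₁ r₃ r₅ ⊆ tripleClosure r₁ r₃ r₅ := fun _ hz =>
  ⟨slitDomain_subset_slitClosure hz.1, slitDomain_subset_slitClosure hz.2.1,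
    slitDomain_subset_slitClosure hz.2.2⟩

theorem continuousOn_csqrt_slit (r : ℂ) :
    ContinuousOn (fun z => Complex.sqrt (1 - z / r)) {z | z / r ∈ slitClosure} := fun z hz =>
  (ContinuousAt.comp (g := Complex.sqrt) (f := fun z => 1 - z / r) (continuousAt_sqrt hz)
    (by fun_prop)).continuousWithinAt

theorem continuousOn_tripleSqrt :
    ContinuousOn (tripleSqrt r₁ r₃ r₅) (tripleClosure r₁ r₃ r₅) :=
  (((continuousOn_csqrt_slit r₁).mono fun _ h => h.1).mul
    ((continuousOn_csqrt_slit r₃).mono fun _ h => h.2.1)).mul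
    ((continuousOn_csqrt_slit r₅).mono fun _ h => h.2.2)

theorem differentiableOn_tripleSqrt :
    DifferentiableOn ℂ (tripleSqrt r₁ r₃ r₅) (tripleDomain r₁ r₃ r₅) := by
  have key : ∀ r z : ℂ, z / r ∈ slitDomain →
      DifferentiableAt ℂ (fun z => Complex.sqrt (1 - z / r)) z := fun r z hz =>
    DifferentiableAt.comp (g := Complex.sqrt) (f := fun z => 1 - z / r) z
      (differentiableAt_sqrt hz) (by fun_prop)
  exact fun z hz => (((key _ _ hz.1).mul (key _ _ hz.2.1)).mul
    (key _ _ hz.2.2)).differentiableWithinAt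

theorem tripleSqrt_ne_zero {z : ℂ} (hz : z ∈ tripleDomain r₁ r₃ r₅) :
    tripleSqrt r₁ r₃ r₅ z ≠ 0 :=
  mul_ne_zero (mul_ne_zero (csqrt_ne_zero (slitPlane_ne_zero hz.1))
    (csqrt_ne_zero (slitPlane_ne_zero hz.2.1))) (csqrt_ne_zero (slitPlane_ne_zero hz.2.2))

theorem sq_tripleSqrt (z : ℂ) :
    tripleSqrt r₁ r₃ r₅ z ^ 2 = (1 - z / r₁) * (1 - z / r₃) * (1 - z / r₅) := by
  rw [tripleSqrt, mul_pow, mul_pow, sq_csqrt, sq_csqrt, sq_csqrt]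

theorem sin_sq_mem (η : ℝ) : Real.sin η ^ 2 ∈ Icc (0 : ℝ) 1 :=
  ⟨sq_nonneg _, Real.sin_sq_le_one η⟩

theorem continuousOn_incompletePeriod :
    ContinuousOn (incompletePeriod r₁ r₃ r₅) (tripleClosure r₁ r₃ r₅) := by
  refine continuousOn_integral_of_continuousOn (by positivity) ?_
  refine ContinuousOn.mul (continuousOn_const.mul ?_) (by fun_prop)
  exact continuousOn_tripleSqrt.comp
    (f := fun p : ℂ × ℝ => p.1 * (Real.sin p.2 ^ 2 : ℝ)) (by fun_prop)
    fun p hp => mul_mem_tripleClosure hp.1 (sin_sq_mem _)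

/-- The equation 2zk' + k = 2S says that √z·k is a primitive of S/√z, whichever branch of √z is
used. -/
theorem exists_hasDerivAt_incompletePeriod {z : ℂ} (hz : z ∈ tripleDomain r₁ r₃ r₅) :
    ∃ k' : ℂ, HasDerivAt (incompletePeriod r₁ r₃ r₅) k' z ∧
      2 * z * k' + incompletePeriod r₁ r₃ r₅ z = 2 * tripleSqrt r₁ r₃ r₅ z := by
  set S := tripleSqrt r₁ r₃ r₅ with hS
  have hd : ∀ w ∈ tripleDomain r₁ r₃ r₅, HasDerivAt S (deriv S w) w := fun w hw =>
    (differentiableOn_tripleSqrt.differentiableAt (isOpen_tripleDomain.mem_nhds hw)).hasDerivAt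
  have hS' : ContinuousOn (deriv S) (tripleDomain r₁ r₃ r₅) :=
    (differentiableOn_tripleSqrt.deriv isOpen_tripleDomain).continuousOn
  have hmem : ∀ w ∈ tripleDomain r₁ r₃ r₅, ∀ η : ℝ,
      w * (Real.sin η ^ 2 : ℝ) ∈ tripleDomain r₁ r₃ r₅ := fun w hw η =>
    mul_mem_tripleDomain hw (sin_sq_mem η)
  have hc : ∀ w ∈ tripleDomain r₁ r₃ r₅, Continuous fun η : ℝ => S (w * (Real.sin η ^ 2 : ℝ)) :=
    fun w hw => differentiableOn_tripleSqrt.continuousOn.comp_continuous (by fun_prop) (hmem w hw)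
  have hc' : ∀ w ∈ tripleDomain r₁ r₃ r₅,
      Continuous fun η : ℝ => deriv S (w * (Real.sin η ^ 2 : ℝ)) :=
    fun w hw => hS'.comp_continuous (by fun_prop) (hmem w hw)
  have hmain := hasDerivAt_integral_of_continuousOn_deriv (a := 0) (b := Real.pi / 2)
    (f := fun w η => 2 * S (w * (Real.sin η ^ 2 : ℝ)) * Real.cos η)
    (f' := fun w η => 2 * (deriv S (w * (Real.sin η ^ 2 : ℝ)) * (Real.sin η ^ 2 : ℝ)) * Real.cos η)
    isOpen_tripleDomain
    (fun w hw => ((continuous_const.mul (hc w hw)).mul (by fun_prop)).continuousOn)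
    (by
      refine ContinuousOn.mul (continuousOn_const.mul (ContinuousOn.mul ?_ (by fun_prop)))
        (by fun_prop)
      exact hS'.comp (f := fun p : ℂ × ℝ => p.1 * (Real.sin p.2 ^ 2 : ℝ)) (by fun_prop)
        fun p hp => hmem _ hp.1 _)
    (fun w hw η _ => by
      have h1 := (hd _ (hmem w hw η)).comp w ((hasDerivAt_id' w).mul_const ((Real.sin η ^ 2 : ℝ) : ℂ))
      simpa [Function.comp_def] using (h1.const_mul (2 : ℂ)).mul_const (Real.cos η : ℂ)) hz
  refine ⟨_, hmain, ?_⟩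
  -- Integrating this total derivative over [0, π/2] gives the equation at once: the boundary value
  -- is 2S(z) at π/2 and 0 at 0.
  have hFTC : ∀ η : ℝ, HasDerivAt
      (fun η : ℝ => 2 * (Real.sin η : ℂ) * S (z * (Real.sin η ^ 2 : ℝ)))
      (2 * z * (2 * (deriv S (z * (Real.sin η ^ 2 : ℝ)) * (Real.sin η ^ 2 : ℝ)) * Real.cos η) +
        2 * S (z * (Real.sin η ^ 2 : ℝ)) * Real.cos η) η := by
    intro η
    have hs : HasDerivAt (fun η : ℝ => (Real.sin η : ℂ)) (Real.cos η : ℂ) η :=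
      (Real.hasDerivAt_sin η).ofReal_comp
    have hs2 : HasDerivAt (fun η : ℝ => z * ((Real.sin η ^ 2 : ℝ) : ℂ))
        (z * ((2 * Real.sin η * Real.cos η : ℝ) : ℂ)) η := by
      have := ((Real.hasDerivAt_sin η).pow 2).ofReal_comp.const_mul z
      simpa using this
    have h1 := (hd _ (hmem z hz η)).comp_of_eq η hs2 rfl
    refine ((hs.const_mul 2).mul h1).congr_deriv ?_
    simp only [Function.comp_apply]
    push_cast
    ring
  have c1 : Continuous fun η : ℝ =>
      2 * (deriv S (z * (Real.sin η ^ 2 : ℝ)) * (Real.sin η ^ 2 : ℝ)) * (Real.cos η : ℂ) :=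
    (continuous_const.mul ((hc' z hz).mul (by fun_prop))).mul (by fun_prop)
  have c2 : Continuous fun η : ℝ => 2 * S (z * (Real.sin η ^ 2 : ℝ)) * (Real.cos η : ℂ) :=
    (continuous_const.mul (hc z hz)).mul (by fun_prop)
  have c3 : Continuous fun η : ℝ =>
      2 * z * (2 * (deriv S (z * (Real.sin η ^ 2 : ℝ)) * (Real.sin η ^ 2 : ℝ)) *
        (Real.cos η : ℂ)) := continuous_const.mul c1
  have hI := intervalIntegral.integral_eq_sub_of_hasDerivAt (a := 0) (b := Real.pi / 2)
    (fun η _ => hFTC η) ((c3.add c2).intervalIntegrable _ _)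
  rw [intervalIntegral.integral_add (c3.intervalIntegrable _ _)
    (c2.intervalIntegrable _ _), intervalIntegral.integral_const_mul] at hI
  simp only [Real.sin_pi_div_two, Real.sin_zero] at hI
  simpa [incompletePeriod] using hI

/-- The primitive of `S(z) / √z dz` along a segment, on which `√z = c √(z / c²)`. -/
theorem hasDerivAt_sqrt_mul_incompletePeriod {c z₀ d : ℂ} (hc : c ≠ 0) {t : ℝ}
    (h1 : (z₀ + t * d) / c ^ 2 ∈ slitPlane) (h2 : z₀ + t * d ∈ tripleDomain r₁ r₃ r₅) :
    HasDerivAt (fun t : ℝ => c * Complex.sqrt ((z₀ + t * d) / c ^ 2) *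
      incompletePeriod r₁ r₃ r₅ (z₀ + t * d))
      (c * Complex.sqrt ((z₀ + t * d) / c ^ 2) * tripleSqrt r₁ r₃ r₅ (z₀ + t * d) /
        (z₀ + t * d) * d) t := by
  obtain ⟨k', hk, hk'⟩ := exists_hasDerivAt_incompletePeriod h2
  have hz : HasDerivAt (fun t : ℝ => z₀ + t * d) d t := by
    simpa using ((hasDerivAt_id' t).ofReal_comp.mul_const d).const_add z₀
  have e1 := (hasDerivAt_csqrt h1).comp_of_eq t (hz.div_const (c ^ 2)) rfl
  have e2 := hk.comp_of_eq t hz rfl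
  refine ((e1.const_mul c).mul e2).congr_deriv ?_
  have n1 := csqrt_ne_zero (slitPlane_ne_zero h1)
  have s1 := sq_csqrt ((z₀ + t * d) / c ^ 2)
  simp only [Function.comp_apply]
  have hz0 : z₀ + t * d ≠ 0 := by
    intro h; rw [h, zero_div] at h1; exact slitPlane_ne_zero h1 rfl
  generalize Complex.sqrt ((z₀ + t * d) / c ^ 2) = n at *
  generalize z₀ + t * d = z at *
  have hcz : c ^ 2 * n ^ 2 = z := by rw [s1]; field_simp
  have hT : tripleSqrt r₁ r₃ r₅ z = z * k' + incompletePeriod r₁ r₃ r₅ z / 2 := by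
    linear_combination -hk' / 2
  rw [hT]
  generalize incompletePeriod r₁ r₃ r₅ z = k at *
  subst hcz
  field_simp
  ring

/-- The integral of `v / z dz` along a segment, where `v² = κ² z S(z)²`. -/
theorem exists_integral_eq_of_sq_eq {c z₀ d κ : ℂ} (hc : c ≠ 0) {a b : ℝ} (hab : a ≤ b)
    (h1 : ∀ t ∈ Ioo a b, (z₀ + t * d) / c ^ 2 ∈ slitPlane)
    (h2 : ∀ t ∈ Ioo a b, z₀ + t * d ∈ tripleDomain r₁ r₃ r₅)
    (h1' : ∀ t ∈ Icc a b, 0 ≤ ((z₀ + t * d) / c ^ 2).re ∨ ((z₀ + t * d) / c ^ 2).im ≠ 0)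
    (h2' : ∀ t ∈ Icc a b, z₀ + t * d ∈ tripleClosure r₁ r₃ r₅) (hκ : κ ≠ 0) {v : ℝ → ℂ}
    (hv : ContinuousOn v (Icc a b))
    (hv2 : ∀ t ∈ Icc a b, v t ^ 2 =
      κ ^ 2 * (z₀ + t * d) * tripleSqrt r₁ r₃ r₅ (z₀ + t * d) ^ 2)
    (hint : IntervalIntegrable (fun t : ℝ => v t / (z₀ + t * d) * d) volume a b) :
    ∃ ε : ℂ, (ε = 1 ∨ ε = -1) ∧ ∫ t in a..b, v t / (z₀ + t * d) * d = ε * κ *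
      (c * Complex.sqrt ((z₀ + b * d) / c ^ 2) * incompletePeriod r₁ r₃ r₅ (z₀ + b * d) -
        c * Complex.sqrt ((z₀ + a * d) / c ^ 2) * incompletePeriod r₁ r₃ r₅ (z₀ + a * d)) := by
  set g : ℝ → ℂ := fun t => κ * (c * Complex.sqrt ((z₀ + t * d) / c ^ 2) *
    tripleSqrt r₁ r₃ r₅ (z₀ + t * d)) with hg
  have hcn : ContinuousOn (fun t : ℝ => c * Complex.sqrt ((z₀ + t * d) / c ^ 2)) (Icc a b) :=
    continuousOn_const.mul fun t ht => (ContinuousAt.comp (g := Complex.sqrt)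
      (f := fun t : ℝ => (z₀ + t * d) / c ^ 2)
      (continuousAt_sqrt (h1' t ht)) (by fun_prop)).continuousWithinAt
  have hgc : ContinuousOn g (Icc a b) := by
    refine continuousOn_const.mul (hcn.mul ?_)
    exact continuousOn_tripleSqrt.comp (f := fun t : ℝ => z₀ + t * d) (by fun_prop) h2'
  have hsq : ∀ t ∈ Icc a b, v t ^ 2 = g t ^ 2 := by
    intro t ht
    rw [hv2 t ht, hg]
    simp only [mul_pow, sq_csqrt]
    field_simp
  -- Two continuous functions with equal squares and no zeros on a connected set agree up to one
  -- global sign. The endpoints are excluded because v may vanish there.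
  obtain ⟨ε, hε, hεv⟩ : ∃ ε : ℂ, (ε = 1 ∨ ε = -1) ∧ ∀ t ∈ Ioo a b, v t = ε * g t := by
    have := isPreconnected_Ioo.eq_or_eq_neg_of_sq_eq (S := Ioo a b) (hv.mono Ioo_subset_Icc_self)
      (hgc.mono Ioo_subset_Icc_self) (fun t ht => hsq t (Ioo_subset_Icc_self ht))
      (fun {t} ht => mul_ne_zero hκ (mul_ne_zero (mul_ne_zero hc
        (csqrt_ne_zero (slitPlane_ne_zero (h1 t ht)))) (tripleSqrt_ne_zero (h2 t ht))))
    rcases this with h | h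
    · exact ⟨1, Or.inl rfl, fun t ht => by rw [h ht, one_mul]⟩
    · exact ⟨-1, Or.inr rfl, fun t ht => by rw [h ht]; simp⟩
  refine ⟨ε, hε, ?_⟩
  rw [intervalIntegral.integral_eq_sub_of_hasDerivAt_of_le hab
    (f := fun t : ℝ => ε * κ * (c * Complex.sqrt ((z₀ + t * d) / c ^ 2) *
      incompletePeriod r₁ r₃ r₅ (z₀ + t * d))) ?_ ?_ hint]
  · ring
  · refine continuousOn_const.mul (hcn.mul ?_)
    exact continuousOn_incompletePeriod.comp (f := fun t : ℝ => z₀ + t * d) (by fun_prop) h2'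
  · intro t ht
    refine ((hasDerivAt_sqrt_mul_incompletePeriod hc (h1 t ht) (h2 t ht)).const_mul
      (ε * κ)).congr_deriv ?_
    rw [hεv t ht, hg]
    ring

end triple

/-! ### Integrals over the cycles -/

theorem thereAndBack_of_le_one (p q : ℂ) {t : ℝ} (ht : t ≤ 1) :
    thereAndBack p q t = p + t * (q - p) := by
  rw [thereAndBack, abs_of_nonneg (sub_nonneg.2 ht)]
  simp

theorem thereAndBack_two_sub (p q : ℂ) (t : ℝ) :
    thereAndBack p q (2 - t) = thereAndBack p q t := by
  rw [thereAndBack, thereAndBack, ← abs_neg (1 - (2 - t))]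
  congr 5
  ring

theorem deriv_thereAndBack_of_lt_one (p q : ℂ) {t : ℝ} (ht : t < 1) :
    deriv (thereAndBack p q) t = q - p := by
  have h : HasDerivAt (fun t : ℝ => p + t * (q - p)) (q - p) t := by
    simpa using ((hasDerivAt_id' t).ofReal_comp.mul_const (q - p)).const_add p
  refine (h.congr_of_eventuallyEq ?_).deriv
  filter_upwards [Iio_mem_nhds ht] with s hs using thereAndBack_of_le_one p q (le_of_lt hs)

theorem deriv_thereAndBack_two_sub (p q : ℂ) (t : ℝ) :
    deriv (thereAndBack p q) (2 - t) = -deriv (thereAndBack p q) t := by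
  have h := deriv_comp_const_sub (f := thereAndBack p q) (a := 2) (x := t)
  simp only [thereAndBack_two_sub] at h
  rw [h, neg_neg]

/-- On the way back both the direction and the sheet are reversed; the two signs cancel, so the legs
contribute equally. -/
theorem cycleIntegral_eq_two_mul {A p q : ℂ} {v : ℝ → ℂ} (hv : IsCycleOver A p q v)
    (hint : IntervalIntegrable (fun t : ℝ => v t / (p + t * (q - p)) * (q - p)) volume 0 1) :
    cycleIntegral p q v = 2 * ∫ t in (0 : ℝ)..1, v t / (p + t * (q - p)) * (q - p) := by
  set f : ℝ → ℂ := fun t => v t / thereAndBack p q t * deriv (thereAndBack p q) t with hf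
  have hae : ∀ᵐ t : ℝ, t ∈ uIoc 0 1 → v t / (p + t * (q - p)) * (q - p) = f t := by
    filter_upwards [ae_ne_one] with t ht1 ht
    rw [uIoc_of_le zero_le_one] at ht
    rw [hf]
    simp only [thereAndBack_of_le_one p q ht.2,
      deriv_thereAndBack_of_lt_one p q (lt_of_le_of_ne ht.2 ht1)]
  have h01 : IntervalIntegrable f volume 0 1 :=
    hint.congr_ae (by rwa [EventuallyEq, ae_restrict_iff' measurableSet_uIoc])
  have hsym : ∀ t ∈ Icc (0 : ℝ) 2, f (2 - t) = f t := by
    intro t ht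
    rw [hf]
    simp only [thereAndBack_two_sub, deriv_thereAndBack_two_sub, hv.opposite_sheet t ht]
    ring
  have h12' : IntervalIntegrable (fun t => f (2 - t)) volume 1 2 := by
    have := (h01.comp_sub_left 2).symm
    norm_num at this
    exact this
  have h12 : IntervalIntegrable f volume 1 2 :=
    h12'.congr fun t ht => hsym t (by
      rw [uIoc_of_le one_le_two] at ht; exact ⟨by linarith [ht.1], ht.2⟩)
  have e12 : ∫ t in (1 : ℝ)..2, f t = ∫ t in (0 : ℝ)..1, f t := by
    have h : ∫ t in (1 : ℝ)..2, f (2 - t) = ∫ t in (2 - 2 : ℝ)..(2 - 1), f t :=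
      intervalIntegral.integral_comp_sub_left f 2
    rw [show (2 - 2 : ℝ) = 0 by norm_num, show (2 - 1 : ℝ) = 1 by norm_num] at h
    rw [← h]
    refine intervalIntegral.integral_congr fun t ht => ?_
    rw [uIcc_of_le one_le_two] at ht
    exact (hsym t ⟨by linarith [ht.1], ht.2⟩).symm
  rw [cycleIntegral, ← intervalIntegral.integral_add_adjacent_intervals h01 h12, e12, ← two_mul,
    intervalIntegral.integral_congr_ae hae]

/-- A branch of `v` over the segment extends to a cycle. -/
theorem exists_isCycleOver {A p q : ℂ} {v₀ : ℝ → ℂ} (hc : ContinuousOn v₀ (Icc 0 1))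
    (h2 : ∀ t ∈ Icc (0 : ℝ) 1, v₀ t ^ 2 = quartic A (p + t * (q - p))) (hq : v₀ 1 = 0) :
    ∃ v, IsCycleOver A p q v := by
  refine ⟨fun t => if t ≤ 1 then v₀ t else -v₀ (2 - t), ?_, ?_, ?_⟩
  · have hunion : Icc (0 : ℝ) 2 = Icc 0 1 ∪ Icc 1 2 := (Icc_union_Icc_eq_Icc zero_le_one one_le_two).symm
    rw [hunion]
    refine ContinuousOn.union_of_isClosed ?_ ?_ isClosed_Icc isClosed_Icc
    · exact hc.congr fun t ht => by simp [ht.2]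
    · have : ContinuousOn (fun t => -v₀ (2 - t)) (Icc 1 2) :=
        (hc.comp (by fun_prop) fun t ht => ⟨by linarith [ht.2], by linarith [ht.1]⟩).neg
      refine this.congr fun t ht => ?_
      rcases eq_or_lt_of_le ht.1 with h | h
      · rw [← h]; norm_num [hq]
      · simp [h.not_ge]
  · intro t ht
    by_cases h : t ≤ 1
    · simp only [h, if_true]
      rw [h2 t ⟨ht.1, h⟩, thereAndBack_of_le_one p q h]
    · simp only [h, if_false]
      have h' : 2 - t ≤ 1 := by linarith [not_le.1 h]
      rw [neg_sq, h2 _ ⟨by linarith [ht.2], h'⟩, ← thereAndBack_of_le_one p q h',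
        thereAndBack_two_sub]
  · intro t ht
    rcases lt_trichotomy t 1 with h | h | h
    · simp [h.le, show ¬ 2 - t ≤ 1 by linarith]
    · subst h; norm_num [hq]
    · simp [h.not_ge, show 2 - t ≤ 1 by linarith]

theorem IsCycleOver.continuousOn_unit {A p q : ℂ} {v : ℝ → ℂ} (hv : IsCycleOver A p q v) :
    ContinuousOn v (Icc 0 1) := hv.continuousOn.mono (Icc_subset_Icc_right one_le_two)

theorem IsCycleOver.sq_eq {A p q : ℂ} {v : ℝ → ℂ} (hv : IsCycleOver A p q v) {t : ℝ}
    (ht : t ∈ Icc (0 : ℝ) 1) : v t ^ 2 = quartic A (p + t * (q - p)) := by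
  rw [hv.on_curve t ⟨ht.1, ht.2.trans one_le_two⟩, thereAndBack_of_le_one p q ht.2]

theorem cycleIntegral_self (p : ℂ) (v : ℝ → ℂ) : cycleIntegral p p v = 0 := by
  have : thereAndBack p p = fun _ => p := by funext t; simp [thereAndBack]
  simp [cycleIntegral, this]

theorem exists_isCycleOver_self {A p : ℂ} (hp : quartic A p = 0) : ∃ v, IsCycleOver A p p v :=
  exists_isCycleOver (v₀ := fun _ => 0) continuousOn_const (fun t _ => by simp [hp]) rfl

/-! ### Complex conjugation -/

theorem thereAndBack_conj (p q : ℂ) (t : ℝ) : thereAndBack ((starRingEnd ℂ) p) ((starRingEnd ℂ) q) t =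
    (starRingEnd ℂ) (thereAndBack p q t) := by
  simp only [thereAndBack, map_add, map_mul, map_sub, conj_ofReal]

theorem quartic_conj (A z : ℂ) : quartic ((starRingEnd ℂ) A) ((starRingEnd ℂ) z) =
    (starRingEnd ℂ) (quartic A z) := by
  simp [quartic, Complex.conj_ofNat]

theorem IsCycleOver.conj {A p q : ℂ} {v : ℝ → ℂ} (h : IsCycleOver A p q v) :
    IsCycleOver ((starRingEnd ℂ) A) ((starRingEnd ℂ) p) ((starRingEnd ℂ) q)
      fun t => (starRingEnd ℂ) (v t) := by
  refine ⟨continuous_conj.comp_continuousOn h.continuousOn, fun t ht => ?_, fun t ht => ?_⟩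
  · rw [thereAndBack_conj, quartic_conj, ← h.on_curve t ht, map_pow]
  · rw [h.opposite_sheet t ht, map_neg]

theorem cycleIntegral_conj (p q : ℂ) (v : ℝ → ℂ) :
    cycleIntegral ((starRingEnd ℂ) p) ((starRingEnd ℂ) q) (fun t => (starRingEnd ℂ) (v t)) =
      (starRingEnd ℂ) (cycleIntegral p q v) := by
  have e : thereAndBack ((starRingEnd ℂ) p) ((starRingEnd ℂ) q) =
      fun t => (starRingEnd ℂ) (thereAndBack p q t) := funext (thereAndBack_conj p q)
  have hd : ∀ t, deriv (fun t => (starRingEnd ℂ) (thereAndBack p q t)) t =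
      (starRingEnd ℂ) (deriv (thereAndBack p q) t) := fun t =>
    deriv.star (f := thereAndBack p q) (x := t)
  rw [cycleIntegral, cycleIntegral, e, ← intervalIntegral.intervalIntegral_conj]
  simp only [hd, map_mul, map_div₀]

/-! ### Integrability near the branch point `0` -/

theorem intervalIntegrable_of_norm_le_rpow_right {f : ℝ → ℂ} {a b C : ℝ} (hab : a ≤ b)
    (hf : ContinuousOn f (Ioo a b)) (h : ∀ t ∈ Ioo a b, ‖f t‖ ≤ C * (b - t) ^ (-1 / 2 : ℝ)) :
    IntervalIntegrable f volume a b := by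
  have h0 : IntervalIntegrable (fun t : ℝ => C * (b - t) ^ (-1 / 2 : ℝ)) volume a b := by
    have := ((intervalIntegral.intervalIntegrable_rpow' (a := b - a) (b := 0)
      (r := -1 / 2) (by norm_num)).comp_sub_left b).const_mul C
    simpa using this
  rw [intervalIntegrable_iff_integrableOn_Ioo_of_le hab] at h0 ⊢
  refine Integrable.mono' h0 (hf.aestronglyMeasurable measurableSet_Ioo) ?_
  rw [ae_restrict_iff' measurableSet_Ioo]
  exact Eventually.of_forall h

theorem intervalIntegrable_of_norm_le_rpow_left {f : ℝ → ℂ} {a b C : ℝ} (hab : a ≤ b)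
    (hf : ContinuousOn f (Ioo a b)) (h : ∀ t ∈ Ioo a b, ‖f t‖ ≤ C * (t - a) ^ (-1 / 2 : ℝ)) :
    IntervalIntegrable f volume a b := by
  have h0 : IntervalIntegrable (fun t : ℝ => C * (t - a) ^ (-1 / 2 : ℝ)) volume a b := by
    have := ((intervalIntegral.intervalIntegrable_rpow' (a := 0) (b := b - a)
      (r := -1 / 2) (by norm_num)).comp_sub_right a).const_mul C
    simpa using this
  rw [intervalIntegrable_iff_integrableOn_Ioo_of_le hab] at h0 ⊢
  refine Integrable.mono' h0 (hf.aestronglyMeasurable measurableSet_Ioo) ?_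
  rw [ae_restrict_iff' measurableSet_Ioo]
  exact Eventually.of_forall h

/-- The bound for `v / z` in terms of `|z|`. -/
theorem exists_norm_div_le {v S : ℝ → ℂ} {z : ℝ → ℂ} {κ : ℂ} (hS : ContinuousOn S (Icc 0 1))
    (h : ∀ t ∈ Icc (0 : ℝ) 1, v t ^ 2 = κ ^ 2 * z t * S t ^ 2) (d : ℂ) :
    ∃ C : ℝ, 0 ≤ C ∧ ∀ t ∈ Icc (0 : ℝ) 1, z t ≠ 0 →
      ‖v t / z t * d‖ ≤ C * ‖z t‖ ^ (-1 / 2 : ℝ) := by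
  obtain ⟨M, hM⟩ := isCompact_Icc.exists_bound_of_continuousOn hS
  have hM0 : 0 ≤ M := (norm_nonneg _).trans (hM 0 (by simp))
  refine ⟨‖κ‖ * M * ‖d‖, by positivity, fun t ht hz => ?_⟩
  have hz' : 0 < ‖z t‖ := norm_pos_iff.2 hz
  have e : ‖v t‖ = ‖κ‖ * ‖z t‖ ^ (1 / 2 : ℝ) * ‖S t‖ := by
    have h1 : ‖v t‖ ^ 2 = (‖κ‖ * ‖z t‖ ^ (1 / 2 : ℝ) * ‖S t‖) ^ 2 := by
      rw [← norm_pow, h t ht, norm_mul, norm_mul, norm_pow, norm_pow, mul_pow, mul_pow,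
        ← Real.rpow_natCast (‖z t‖ ^ (1 / 2 : ℝ)), ← Real.rpow_mul hz'.le]
      norm_num
    exact (pow_left_inj₀ (norm_nonneg _) (by positivity) two_ne_zero).1 h1
  have e2 : ‖z t‖ ^ (1 / 2 : ℝ) / ‖z t‖ = ‖z t‖ ^ (-1 / 2 : ℝ) := by
    rw [← Real.rpow_sub_one hz'.ne']; norm_num
  rw [norm_mul, norm_div, e, ← e2]
  calc ‖κ‖ * ‖z t‖ ^ (1 / 2 : ℝ) * ‖S t‖ / ‖z t‖ * ‖d‖
      = ‖κ‖ * ‖S t‖ * ‖d‖ * (‖z t‖ ^ (1 / 2 : ℝ) / ‖z t‖) := by ring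
    _ ≤ ‖κ‖ * M * ‖d‖ * (‖z t‖ ^ (1 / 2 : ℝ) / ‖z t‖) := by
        gcongr
        exact hM t ht

/-! ### Evaluation of the complete periods -/

/-- If `ρ` is a square root of `(c √(1 - α s²) √(1 - β s²))²` starting at `c`, it is this function. -/
theorem eq_mul_csqrt_mul_csqrt {α β c : ℂ} (hα : α ∈ slitDomain) (hβ : β ∈ slitDomain) (hc : c ≠ 0)
    {ρ : ℝ → ℂ} (hρ : ContinuousOn ρ (Icc 0 1)) (h0 : ρ 0 = c)
    (h2 : ∀ s : ℝ, ρ s ^ 2 = c ^ 2 * (1 - α * s ^ 2) * (1 - β * s ^ 2)) {s : ℝ}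
    (hs : s ∈ Icc (0 : ℝ) 1) :
    ρ s = c * (Complex.sqrt (1 - α * (s ^ 2 : ℝ)) * Complex.sqrt (1 - β * (s ^ 2 : ℝ))) := by
  have hsq : ∀ s ∈ Icc (0 : ℝ) 1, s ^ 2 ∈ Icc (0 : ℝ) 1 := fun s hs =>
    ⟨sq_nonneg s, pow_le_one₀ hs.1 hs.2⟩
  have hcont : ∀ α ∈ slitDomain, ContinuousOn (fun s : ℝ => Complex.sqrt (1 - α * (s ^ 2 : ℝ)))
      (Icc 0 1) := fun α hα s hs =>
    (ContinuousAt.comp (g := Complex.sqrt) (f := fun s : ℝ => 1 - α * ((s ^ 2 : ℝ) : ℂ))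
      (differentiableAt_sqrt (one_sub_mul_mem_slitPlane hα (hsq s hs))).continuousAt
      (by fun_prop)).continuousWithinAt
  refine isPreconnected_Icc.eq_of_sq_eq hρ
    (continuousOn_const.mul ((hcont α hα).mul (hcont β hβ))) (fun s hs => ?_) (fun {s} hs => ?_)
    (y := 0) (by simp) ?_ hs
  · simp only [Pi.pow_apply, Pi.mul_apply, h2, mul_pow, sq_csqrt]
    push_cast
    ring
  · exact mul_ne_zero hc (mul_ne_zero
      (csqrt_ne_zero (slitPlane_ne_zero (one_sub_mul_mem_slitPlane hα (hsq s hs))))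
      (csqrt_ne_zero (slitPlane_ne_zero (one_sub_mul_mem_slitPlane hβ (hsq s hs)))))
  · simp [h0]

theorem rootSqrt_zero (u : ℂ) : rootSqrt u 0 = u + 2 := by
  have := sq_csqrt (u + 2)
  simpa [rootSqrt, pow_two] using this

theorem continuous_rootSqrt_of_im_nonneg {u : ℂ} (hu : 0 ≤ u.im) : Continuous (rootSqrt u) :=
  continuousOn_rootSqrt.comp_continuous (f := fun w : ℝ => (u, w)) (by fun_prop)
    fun _ => ⟨hu, mem_univ _⟩

/-- `rootSqrt` and (u+2) times the product of principal roots have the same square and the same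
value u+2 at s = 0, so they agree on [0, 1] by continuity. One identity thus links the half-period
in u to the scaled picture. -/
theorem integral_csqrt_eq {α β u : ℂ} (hα : α ∈ slitDomain) (hβ : β ∈ slitDomain) (hu : u + 2 ≠ 0)
    (him : 0 ≤ u.im)
    (h : ∀ t : ℂ, rootQuad u t = (u + 2) ^ 2 * (1 - α * t) * (1 - β * t)) :
    ∫ η in (0 : ℝ)..Real.pi / 2, 2 * (Real.cos η * (Complex.sqrt (1 - α * (Real.sin η ^ 2 : ℝ)) *
      Complex.sqrt (1 - β * (Real.sin η ^ 2 : ℝ)))) * Real.cos η =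
      2 * periodL u / (u + 2) := by
  rw [periodL, ← intervalIntegral.integral_const_mul, ← intervalIntegral.integral_div]
  refine intervalIntegral.integral_congr fun η hη => ?_
  rw [uIcc_of_le (by positivity)] at hη
  obtain ⟨h1, h2, -⟩ := sin_cos_mem_of_mem_Icc hη
  have := eq_mul_csqrt_mul_csqrt hα hβ hu (continuous_rootSqrt_of_im_nonneg him).continuousOn
    (rootSqrt_zero u) (fun s => by rw [rootSqrt_sq, h]) ⟨h1, h2⟩
  simp only [this]
  field_simp

theorem integral_csqrt_eq_conj {α β u : ℂ} (hα : α ∈ slitDomain) (hβ : β ∈ slitDomain)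
    (hu : u + 2 ≠ 0) (him : u.im ≤ 0)
    (h : ∀ t : ℂ, rootQuad u t = (u + 2) ^ 2 * (1 - α * t) * (1 - β * t)) :
    ∫ η in (0 : ℝ)..Real.pi / 2, 2 * (Real.cos η * (Complex.sqrt (1 - α * (Real.sin η ^ 2 : ℝ)) *
      Complex.sqrt (1 - β * (Real.sin η ^ 2 : ℝ)))) * Real.cos η =
      2 * (starRingEnd ℂ) (periodL ((starRingEnd ℂ) u)) / (u + 2) := by
  rw [periodL, ← intervalIntegral.intervalIntegral_conj, ← intervalIntegral.integral_const_mul,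
    ← intervalIntegral.integral_div]
  refine intervalIntegral.integral_congr fun η hη => ?_
  rw [uIcc_of_le (by positivity)] at hη
  obtain ⟨h1, h2, -⟩ := sin_cos_mem_of_mem_Icc hη
  have hq : ∀ t : ℝ, (starRingEnd ℂ) (rootQuad ((starRingEnd ℂ) u) t) = rootQuad u t := fun t => by
    simp [rootQuad, Complex.conj_ofNat]
  have := eq_mul_csqrt_mul_csqrt hα hβ hu
    (ρ := fun s => (starRingEnd ℂ) (rootSqrt ((starRingEnd ℂ) u) s))
    (continuous_conj.comp (continuous_rootSqrt_of_im_nonneg (by simpa using him))).continuousOn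
    (by simp [rootSqrt_zero, Complex.conj_ofNat])
    (fun s => by
      rw [← map_pow, rootSqrt_sq, ← ofReal_pow, hq, h]) ⟨h1, h2⟩
  simp only [map_mul, map_pow, conj_ofReal, this]
  field_simp

theorem div_im_ne_zero {p q : ℂ} (h : p.im * q.re - p.re * q.im ≠ 0) : (p / q).im ≠ 0 := by
  have hq : q ≠ 0 := by rintro rfl; simp at h
  rw [div_im, ← sub_div]
  exact div_ne_zero h (Complex.normSq_pos.2 hq).ne'

theorem csqrt_cos_sq {η : ℝ} (hη : η ∈ Icc 0 (Real.pi / 2)) :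
    Complex.sqrt (1 - (Real.sin η ^ 2 : ℝ)) = Real.cos η := by
  have h : (1 - (Real.sin η ^ 2 : ℝ) : ℂ) = ((Real.cos η ^ 2 : ℝ) : ℂ) := by
    rw [Real.cos_sq']; push_cast; ring
  rw [h, csqrt_ofReal_of_nonneg (sq_nonneg _),
    Real.sqrt_sq (sin_cos_mem_of_mem_Icc hη).2.2]

section evaluation

variable {m : ℂ}

theorem one_add_ne_zero_of_im (hb : m.im ≠ 0) : 1 + m ≠ 0 := fun h => hb (by
  simpa using congrArg im h)

theorem one_sub_ne_zero_of_im (hb : m.im ≠ 0) : 1 - m ≠ 0 := fun h => hb (by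
  simpa using congrArg im h)

variable (hb : m.im ≠ 0)
include hb

theorem ratio_three_one : (1 + m) ^ 2 / (1 - m) ^ 2 ∈ slitDomain := by
  rw [← div_pow]
  exact sq_mem_slitDomain (div_im_ne_zero (by simp; ring_nf; simpa using hb))

theorem ratio_one_three : (1 - m) ^ 2 / (1 + m) ^ 2 ∈ slitDomain := by
  rw [← div_pow]
  exact sq_mem_slitDomain (div_im_ne_zero (by simp; ring_nf; simpa using hb))

theorem ratio_three_five : (1 + m) ^ 2 / 4 ∈ slitDomain := by
  rw [show (4 : ℂ) = 2 ^ 2 by norm_num, ← div_pow]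
  exact sq_mem_slitDomain (div_im_ne_zero (by simpa using hb))

theorem ratio_one_five : (1 - m) ^ 2 / 4 ∈ slitDomain := by
  rw [show (4 : ℂ) = 2 ^ 2 by norm_num, ← div_pow]
  exact sq_mem_slitDomain (div_im_ne_zero (by simpa using hb))

theorem ratio_five_three : 4 / (1 + m) ^ 2 ∈ slitDomain := by
  rw [show (4 : ℂ) = 2 ^ 2 by norm_num, ← div_pow]
  exact sq_mem_slitDomain (div_im_ne_zero (by simpa using hb))

theorem ratio_five_one : 4 / (1 - m) ^ 2 ∈ slitDomain := by
  rw [show (4 : ℂ) = 2 ^ 2 by norm_num, ← div_pow]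
  exact sq_mem_slitDomain (div_im_ne_zero (by simpa using hb))

/-- The incomplete period for the roots `(1 - m)²`, `(1 + m)²`, `4`. -/
theorem incompletePeriod_three (hw : 3 + m ^ 2 ≠ 0) (him : 0 ≤ (zetaThree m).im) :
    (2 * (-2 / (3 + m ^ 2)) ^ 2 * (1 - m ^ 2)) *
      ((1 + m) * incompletePeriod ((1 - m) ^ 2) ((1 + m) ^ 2) 4 ((1 + m) ^ 2)) =
      -periodJThree m := by
  have n1 := one_add_ne_zero_of_im hb
  have n2 := one_sub_ne_zero_of_im hb
  have hu2 : zetaThree m + 2 = 4 * (1 - m) / (3 + m ^ 2) := by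
    rw [zetaThree]; field_simp; ring
  have h := integral_csqrt_eq (ratio_three_one hb) (ratio_three_five hb) (u := zetaThree m)
    (by rw [hu2]; exact div_ne_zero (mul_ne_zero (by norm_num) n2) hw) him
    (fun t => by rw [hu2, rootQuad, zetaThree]; field_simp; ring)
  have e : incompletePeriod ((1 - m) ^ 2) ((1 + m) ^ 2) 4 ((1 + m) ^ 2) =
      2 * periodL (zetaThree m) / (zetaThree m + 2) := by
    rw [← h, incompletePeriod]
    refine intervalIntegral.integral_congr fun η hη => ?_
    rw [uIcc_of_le (by positivity)] at hη
    simp only [tripleSqrt, mul_div_right_comm, div_self (pow_ne_zero 2 n1), one_mul,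
      csqrt_cos_sq hη]
    ring
  rw [e, hu2, periodJThree, periodJ]
  nth_rw 2 [zetaThree]
  field_simp
  ring

theorem incompletePeriod_one (hw : 3 + m ^ 2 ≠ 0) (him : (zetaOne m).im ≤ 0) :
    (2 * (-2 / (3 + m ^ 2)) ^ 2 * (1 - m ^ 2)) *
      ((1 - m) * incompletePeriod ((1 - m) ^ 2) ((1 + m) ^ 2) 4 ((1 - m) ^ 2)) =
      -periodJOne m := by
  have n1 := one_add_ne_zero_of_im hb
  have n2 := one_sub_ne_zero_of_im hb
  have hu2 : zetaOne m + 2 = 4 * (1 + m) / (3 + m ^ 2) := by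
    rw [zetaOne]; field_simp; ring
  have h := integral_csqrt_eq_conj (ratio_one_three hb) (ratio_one_five hb) (u := zetaOne m)
    (by rw [hu2]; exact div_ne_zero (mul_ne_zero (by norm_num) n1) hw) him
    (fun t => by rw [hu2, rootQuad, zetaOne]; field_simp; ring)
  have e : incompletePeriod ((1 - m) ^ 2) ((1 + m) ^ 2) 4 ((1 - m) ^ 2) =
      2 * (starRingEnd ℂ) (periodL ((starRingEnd ℂ) (zetaOne m))) / (zetaOne m + 2) := by
    rw [← h, incompletePeriod]
    refine intervalIntegral.integral_congr fun η hη => ?_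
    rw [uIcc_of_le (by positivity)] at hη
    simp only [tripleSqrt, mul_div_right_comm, div_self (pow_ne_zero 2 n2), one_mul,
      csqrt_cos_sq hη]
    ring
  rw [e, hu2, periodJOne, periodJ]
  simp only [map_mul, Complex.conj_conj, Complex.conj_ofNat]
  generalize (starRingEnd ℂ) (periodL ((starRingEnd ℂ) (zetaOne m))) = L
  rw [zetaOne]
  field_simp
  ring

/-- The sign is opposite to that for the other two roots because ζ₅ + 2 = -2(1-m²)/(3+m²) carries a
minus sign. This is why the difference of primitives along [ζ₅, ζ₃] produces the sum J₃ + J₅. -/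
theorem incompletePeriod_five (hw : 3 + m ^ 2 ≠ 0) (him : (zetaFive m).im ≤ 0) :
    (2 * (-2 / (3 + m ^ 2)) ^ 2 * (1 - m ^ 2)) *
      (2 * incompletePeriod ((1 - m) ^ 2) ((1 + m) ^ 2) 4 4) = periodJFive m := by
  have n1 := one_add_ne_zero_of_im hb
  have n2 := one_sub_ne_zero_of_im hb
  have n4 : (4 : ℂ) ≠ 0 := by norm_num
  have n3 : 1 - m ^ 2 ≠ 0 := by
    rw [show 1 - m ^ 2 = (1 + m) * (1 - m) by ring]; exact mul_ne_zero n1 n2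
  have hu2 : zetaFive m + 2 = -2 * (1 - m ^ 2) / (3 + m ^ 2) := by
    rw [zetaFive]; field_simp; ring
  have h := integral_csqrt_eq_conj (ratio_five_one hb) (ratio_five_three hb) (u := zetaFive m)
    (by rw [hu2]; exact div_ne_zero (mul_ne_zero (by norm_num) n3) hw) him
    (fun t => by rw [hu2, rootQuad, zetaFive]; field_simp; ring)
  have e : incompletePeriod ((1 - m) ^ 2) ((1 + m) ^ 2) 4 4 =
      2 * (starRingEnd ℂ) (periodL ((starRingEnd ℂ) (zetaFive m))) / (zetaFive m + 2) := by
    rw [← h, incompletePeriod]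
    refine intervalIntegral.integral_congr fun η hη => ?_
    rw [uIcc_of_le (by positivity)] at hη
    simp only [tripleSqrt, mul_div_right_comm, div_self n4, one_mul,
      csqrt_cos_sq hη]
    ring
  rw [e, hu2, periodJFive, periodJ]
  simp only [map_mul, Complex.conj_conj, Complex.conj_ofNat]
  generalize (starRingEnd ℂ) (periodL ((starRingEnd ℂ) (zetaFive m))) = L
  rw [zetaFive]
  field_simp
  ring

end evaluation

/-! ### The cycles for a complex parameter -/

theorem sq_ne_ofReal_of_im_ne {ρ : ℂ} (h : ρ.im ≠ 0) {s : ℝ} (hs : 0 ≤ s) : ρ ^ 2 ≠ s := by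
  intro hρ
  have h1 := congrArg im hρ
  have h2 := congrArg re hρ
  simp [pow_two] at h1 h2
  have h3 : ρ.re = 0 := by
    have : ρ.re * ρ.im = 0 := by linarith
    simpa [h] using this
  rw [h3] at h2
  nlinarith [mul_self_pos.2 h]

theorem mem_slitPlane_of_forall {w : ℂ} (h : ∀ ρ : ℝ, 0 ≤ ρ → w ≠ -ρ) : w ∈ slitPlane := by
  by_contra hw
  simp only [mem_slitPlane_iff, not_or, not_lt, not_not] at hw
  exact h (-w.re) (by linarith [hw.1]) (Complex.ext (by simp) (by simpa using hw.2))

/-- The constant in `v / ζ dζ = κ √z S(z) / z dz`, where `ζ = -2 z / (3 + m²)`. -/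
noncomputable def scaleKappa (m : ℂ) : ℂ := I * (2 * (-2 / (3 + m ^ 2)) ^ 2 * (1 - m ^ 2))

section
variable {m : ℂ}

theorem quartic_scaled (hw : 3 + m ^ 2 ≠ 0) (n1 : 1 + m ≠ 0) (n2 : 1 - m ≠ 0) (z : ℂ) :
    quartic (paramA m) (-2 / (3 + m ^ 2) * z) =
      scaleKappa m ^ 2 * z * tripleSqrt ((1 - m) ^ 2) ((1 + m) ^ 2) 4 z ^ 2 := by
  rw [sq_tripleSqrt, scaleKappa, mul_pow I, I_sq, quartic, paramA]
  have : m ^ 2 - 1 ≠ 0 := by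
    rw [show m ^ 2 - 1 = -((1 + m) * (1 - m)) by ring]; exact neg_ne_zero.2 (mul_ne_zero n1 n2)
  field_simp
  ring

theorem scaleKappa_ne_zero (hw : 3 + m ^ 2 ≠ 0) (n1 : 1 + m ≠ 0) (n2 : 1 - m ≠ 0) :
    scaleKappa m ≠ 0 := by
  have : 1 - m ^ 2 ≠ 0 := by
    rw [show 1 - m ^ 2 = (1 + m) * (1 - m) by ring]; exact mul_ne_zero n1 n2
  exact mul_ne_zero I_ne_zero (mul_ne_zero (mul_ne_zero two_ne_zero
    (pow_ne_zero 2 (div_ne_zero (by norm_num) hw))) this)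

/-- The segment between the roots `4` and `(1 + m)²`. -/
noncomputable def segA (m : ℂ) (t : ℝ) : ℂ := 4 + t * ((1 + m) ^ 2 - 4)

/-- The segment between the roots `(1 + m)²` and `(1 - m)²`. -/
noncomputable def segB (m : ℂ) (t : ℝ) : ℂ := (1 + m) ^ 2 + t * ((1 - m) ^ 2 - (1 + m) ^ 2)

theorem segA_scaled (t : ℝ) :
    zetaFive m + t * (zetaThree m - zetaFive m) = -2 / (3 + m ^ 2) * segA m t := by
  rw [zetaFive, zetaThree, segA]
  ring

theorem segB_scaled (t : ℝ) :
    zetaThree m + t * (zetaOne m - zetaThree m) = -2 / (3 + m ^ 2) * segB m t := by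
  rw [zetaOne, zetaThree, segB]
  ring

theorem im_segA (t : ℝ) : (segA m t).im = t * (2 * m.im * (1 + m.re)) := by
  simp [segA, pow_two]
  left
  ring

theorem segB_eq (t : ℝ) :
    segB m t = ((1 - normSq m : ℝ) : ℂ) + ((2 * (1 + m.re - 2 * t) : ℝ) : ℂ) * m := by
  rw [segB, normSq_apply]
  apply Complex.ext
  · simp [pow_two]; ring
  · simp [pow_two]; ring

theorem im_segB (t : ℝ) : (segB m t).im = 2 * (1 + m.re - 2 * t) * m.im := by
  rw [segB_eq, add_im, im_ofReal_mul, ofReal_im, zero_add]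

theorem re_segB (t : ℝ) : (segB m t).re = 1 - normSq m + 2 * (1 + m.re - 2 * t) * m.re := by
  rw [segB_eq, add_re, re_ofReal_mul, ofReal_re]

variable (h : Admissible m) (hb : m.im < 0)
include h hb

/-- Imaginary parts decide: the segment lies strictly below the real axis, the ray of (1-m)² above
it, and meeting the ray of (1+m)² at ratio ρ would force ρ = t < 1. -/
theorem segA_mem_tripleDomain {t : ℝ} (ht : t ∈ Ioo (0 : ℝ) 1) :
    segA m t ∈ tripleDomain ((1 - m) ^ 2) ((1 + m) ^ 2) 4 := by
  have n1 := pow_ne_zero 2 (one_add_ne_zero_of_im hb.ne)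
  have n2 := pow_ne_zero 2 (one_sub_ne_zero_of_im hb.ne)
  have h0 := h.re_nonneg
  have h1 := h.re_lt_one hb.ne
  have him := im_segA (m := m) t
  refine ⟨mem_slitDomain_of_forall fun ρ hρ e => ?_,
    mem_slitDomain_of_forall fun ρ hρ e => ?_, mem_slitDomain_of_im_ne ?_⟩
  · rw [div_eq_iff n2] at e
    rw [e, im_ofReal_mul] at him
    have e2 : m.im * (t * (1 + m.re) + ρ * (1 - m.re)) = 0 := by
      simp [pow_two] at him
      linarith
    have : 0 < t * (1 + m.re) + ρ * (1 - m.re) := by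
      have := mul_pos ht.1 (by linarith : 0 < 1 + m.re)
      have := mul_nonneg (zero_le_one.trans hρ) (sub_pos.2 h1).le
      linarith
    rcases mul_eq_zero.1 e2 with e3 | e3
    · exact hb.ne e3
    · exact this.ne' e3
  · rw [div_eq_iff n1] at e
    rw [e, im_ofReal_mul] at him
    have e2 : (ρ - t) * ((1 + m.re) * m.im) = 0 := by
      simp [pow_two] at him
      linarith
    rcases mul_eq_zero.1 e2 with e3 | e3
    · linarith [ht.2]
    · rcases mul_eq_zero.1 e3 with e4 | e4
      · linarith
      · exact hb.ne e4
  · rw [show (4 : ℂ) = ((4 : ℝ) : ℂ) by norm_num, div_ofReal_im, him]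
    have := mul_ne_zero ht.1.ne' (mul_ne_zero (mul_ne_zero two_ne_zero hb.ne)
      (by linarith : (1 + m.re) ≠ 0))
    exact div_ne_zero this (by norm_num)

theorem segA_mem_tripleClosure {t : ℝ} (ht : t ∈ Icc (0 : ℝ) 1) :
    segA m t ∈ tripleClosure ((1 - m) ^ 2) ((1 + m) ^ 2) 4 := by
  have n1 := pow_ne_zero 2 (one_add_ne_zero_of_im hb.ne)
  rcases eq_endpoints_or_mem_Ioo_of_mem_Icc ht with rfl | rfl | ht
  · rw [show segA m 0 = 4 by simp [segA]]
    refine ⟨slitDomain_subset_slitClosure (ratio_five_one hb.ne),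
      slitDomain_subset_slitClosure (ratio_five_three hb.ne), ?_⟩
    rw [div_self (by norm_num)]
    exact one_mem_slitClosure
  · rw [show segA m 1 = (1 + m) ^ 2 by simp [segA]]
    refine ⟨slitDomain_subset_slitClosure (ratio_three_one hb.ne), ?_,
      slitDomain_subset_slitClosure (ratio_three_five hb.ne)⟩
    rw [div_self n1]
    exact one_mem_slitClosure
  · exact tripleDomain_subset (segA_mem_tripleDomain h hb ht)

-- Meeting the ray of (1-m)² or (1+m)² would make the square of a non-real quotient of 1+m and 1-m a
-- nonnegative real. If the segment crosses the real axis, it does so at 1-|m|², which is too small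
-- for the ray from 4.
omit h in
theorem segB_mem_tripleDomain {t : ℝ} (ht : t ∈ Ioo (0 : ℝ) 1) :
    segB m t ∈ tripleDomain ((1 - m) ^ 2) ((1 + m) ^ 2) 4 := by
  have m1 := one_add_ne_zero_of_im hb.ne
  have m2 := one_sub_ne_zero_of_im hb.ne
  have n1 := pow_ne_zero 2 m1
  have n2 := pow_ne_zero 2 m2
  have h1t := sub_pos.2 ht.2
  refine ⟨mem_slitDomain_of_forall fun ρ hρ e => ?_,
    mem_slitDomain_of_forall fun ρ hρ e => ?_, mem_slitDomain_of_forall fun ρ hρ e => ?_⟩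
  · rw [div_eq_iff n2, segB] at e
    have hi : ((1 + m) / (1 - m)).im ≠ 0 := div_im_ne_zero (by simp; ring_nf; simpa using hb.ne)
    refine sq_ne_ofReal_of_im_ne hi (s := (ρ - t) / (1 - t))
      (div_nonneg (by linarith [ht.2]) h1t.le) ?_
    have : (1 - t : ℂ) ≠ 0 := by exact_mod_cast h1t.ne'
    push_cast
    rw [div_pow, div_eq_div_iff n2 this]
    linear_combination e
  · rw [div_eq_iff n1, segB] at e
    have hi : ((1 - m) / (1 + m)).im ≠ 0 := div_im_ne_zero (by simp; ring_nf; simpa using hb.ne)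
    refine sq_ne_ofReal_of_im_ne hi (s := (ρ - 1 + t) / t)
      (div_nonneg (by linarith [ht.1]) ht.1.le) ?_
    have : (t : ℂ) ≠ 0 := by exact_mod_cast ht.1.ne'
    push_cast
    rw [div_pow, div_eq_div_iff n1 this]
    linear_combination e
  · rw [div_eq_iff (by norm_num)] at e
    have e' : segB m t = ((ρ * 4 : ℝ) : ℂ) := by rw [e]; push_cast; ring
    have h3 := im_segB (m := m) t
    have h4 := re_segB (m := m) t
    rw [e', ofReal_im] at h3
    rw [e', ofReal_re] at h4
    have h5 : 1 + m.re - 2 * t = 0 := by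
      rcases mul_eq_zero.1 h3.symm with h6 | h6
      · linarith
      · exact absurd h6 hb.ne
    rw [h5] at h4
    linarith [normSq_nonneg m]

omit h in
theorem segB_mem_tripleClosure {t : ℝ} (ht : t ∈ Icc (0 : ℝ) 1) :
    segB m t ∈ tripleClosure ((1 - m) ^ 2) ((1 + m) ^ 2) 4 := by
  have n1 := pow_ne_zero 2 (one_add_ne_zero_of_im hb.ne)
  have n2 := pow_ne_zero 2 (one_sub_ne_zero_of_im hb.ne)
  rcases eq_endpoints_or_mem_Ioo_of_mem_Icc ht with rfl | rfl | ht
  · rw [show segB m 0 = (1 + m) ^ 2 by simp [segB]]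
    refine ⟨slitDomain_subset_slitClosure (ratio_three_one hb.ne), ?_,
      slitDomain_subset_slitClosure (ratio_three_five hb.ne)⟩
    rw [div_self n1]
    exact one_mem_slitClosure
  · rw [show segB m 1 = (1 - m) ^ 2 by simp [segB]]
    refine ⟨?_, slitDomain_subset_slitClosure (ratio_one_three hb.ne),
      slitDomain_subset_slitClosure (ratio_one_five hb.ne)⟩
    rw [div_self n2]
    exact one_mem_slitClosure
  · exact tripleDomain_subset (segB_mem_tripleDomain hb ht)

/-- The line through the two roots crosses the real axis at 1-|m|². It can meet the closed ray
opposite to (1-m)² only when |m| = 1, where it passes through 0 itself. -/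
theorem segB_div_mem_slitPlane (hR : normSq m ≠ 1) {t : ℝ} :
    segB m t / (1 - m) ^ 2 ∈ slitPlane := by
  have n2 := pow_ne_zero 2 (one_sub_ne_zero_of_im hb.ne)
  have h1 := h.re_lt_one hb.ne
  have h0 := h.re_nonneg
  refine mem_slitPlane_of_forall fun ρ hρ e => hR ?_
  rw [div_eq_iff n2, segB] at e
  have e1 := congrArg im e
  have e2 := congrArg re e
  simp [pow_two] at e1 e2
  have e3 : (1 - t) * (1 + m.re) = (ρ + t) * (1 - m.re) := by
    apply mul_right_cancel₀ hb.ne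
    linarith
  have e4 : (1 - t) * ((1 + m.re) ^ 2 - m.im ^ 2) + (ρ + t) * ((1 - m.re) ^ 2 - m.im ^ 2) = 0 := by
    linear_combination e2
  have e5 : (ρ + 1) * (normSq m - 1) = 0 := by
    rw [normSq_apply]
    linear_combination (1 + m.re - (1 - m.re)) * e3 - e4
  rcases mul_eq_zero.1 e5 with e6 | e6
  · linarith
  · linarith

/-- The integral over the cycle around the cut `[ζ₅, ζ₃]`. -/
theorem cycleIntegral_a {v : ℝ → ℂ} (hv : IsCycleOver (paramA m) (zetaFive m) (zetaThree m) v) :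
    ∃ ε : ℂ, (ε = 1 ∨ ε = -1) ∧ cycleIntegral (zetaFive m) (zetaThree m) v =
      2 * ε * I * (periodJThree m + periodJFive m) := by
  have m1 := one_add_ne_zero_of_im hb.ne
  have m2 := one_sub_ne_zero_of_im hb.ne
  have hw := h.ne_zero
  have hh : (-2 / (3 + m ^ 2)) ≠ 0 := div_ne_zero (by norm_num) hw
  have h0 := h.re_nonneg
  have him : ∀ t : ℝ, 0 < t → (segA m t / 2 ^ 2).im ≠ 0 := by
    intro t ht
    rw [show (2 ^ 2 : ℂ) = ((4 : ℝ) : ℂ) by norm_num, div_ofReal_im, im_segA]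
    exact div_ne_zero (mul_ne_zero ht.ne' (mul_ne_zero (mul_ne_zero two_ne_zero hb.ne)
      (by linarith : (1 + m.re) ≠ 0))) (by norm_num)
  have hslit : ∀ t ∈ Icc (0 : ℝ) 1, segA m t / 2 ^ 2 ∈ slitPlane := by
    intro t ht
    rcases eq_or_lt_of_le ht.1 with rfl | ht0
    · rw [show segA m 0 / 2 ^ 2 = 1 by norm_num [segA]]
      exact one_mem_slitPlane
    · exact Or.inr (him t ht0)
  have hzc : Continuous (segA m) := by unfold segA; fun_prop
  have hz0 : ∀ t ∈ Icc (0 : ℝ) 1, segA m t ≠ 0 := fun t ht e => by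
    have := hslit t ht
    rw [e, zero_div] at this
    exact slitPlane_ne_zero this rfl
  have hfun : ∀ t : ℝ, v t / (zetaFive m + t * (zetaThree m - zetaFive m)) *
      (zetaThree m - zetaFive m) = v t / segA m t * ((1 + m) ^ 2 - 4) := by
    intro t
    rw [segA_scaled, show zetaThree m - zetaFive m = -2 / (3 + m ^ 2) * ((1 + m) ^ 2 - 4) by
      rw [zetaThree, zetaFive]; ring, div_mul_eq_mul_div, ← mul_assoc, mul_comm (v t),
      mul_assoc, mul_div_mul_left _ _ hh, div_mul_eq_mul_div]
  have hint : IntervalIntegrable (fun t : ℝ => v t / segA m t * ((1 + m) ^ 2 - 4))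
      volume 0 1 := by
    refine ContinuousOn.intervalIntegrable ?_
    rw [uIcc_of_le zero_le_one]
    exact (hv.continuousOn_unit.div hzc.continuousOn hz0).mul continuousOn_const
  rw [cycleIntegral_eq_two_mul hv (by simp only [hfun]; exact hint)]
  simp only [hfun]
  -- With c = 2, a square root of the endpoint 4, √z equals 2 at the start. At the other end it
  -- equals 1+m with no sign ambiguity, since Re(1+m) > 0.
  obtain ⟨ε, hε, e⟩ := exists_integral_eq_of_sq_eq (r₁ := (1 - m) ^ 2) (r₃ := (1 + m) ^ 2)
    (r₅ := 4) (c := 2) (z₀ := 4) (d := (1 + m) ^ 2 - 4) (κ := scaleKappa m) two_ne_zero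
    zero_le_one (fun t ht => hslit t (Ioo_subset_Icc_self ht))
    (fun t ht => segA_mem_tripleDomain h hb ht)
    (fun t ht => (hslit t ht).imp le_of_lt id)
    (fun t ht => segA_mem_tripleClosure h hb ht) (scaleKappa_ne_zero hw m1 m2)
    hv.continuousOn_unit (fun t ht => by
      rw [hv.sq_eq ht, segA_scaled, quartic_scaled hw m1 m2]; rfl) hint
  refine ⟨-ε, by rcases hε with rfl | rfl <;> simp, ?_⟩
  have e' : ∫ t in (0 : ℝ)..1, v t / segA m t * ((1 + m) ^ 2 - 4) =
      ∫ t in (0 : ℝ)..1, v t / (4 + t * ((1 + m) ^ 2 - 4)) * ((1 + m) ^ 2 - 4) := rfl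
  rw [e', e]
  have s1 : Complex.sqrt ((4 + ((1 : ℝ) : ℂ) * ((1 + m) ^ 2 - 4)) / 2 ^ 2) = (1 + m) / 2 := by
    rw [show (4 + ((1 : ℝ) : ℂ) * ((1 + m) ^ 2 - 4)) / 2 ^ 2 = ((1 + m) / 2) ^ 2 by
      push_cast; ring]
    refine csqrt_sq ?_
    rw [show (2 : ℂ) = ((2 : ℝ) : ℂ) by norm_num, div_ofReal_re]
    simp
    linarith
  have s0 : Complex.sqrt ((4 + ((0 : ℝ) : ℂ) * ((1 + m) ^ 2 - 4)) / 2 ^ 2) = 1 := by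
    norm_num [csqrt_one]
  rw [s1, s0, show 4 + ((1 : ℝ) : ℂ) * ((1 + m) ^ 2 - 4) = (1 + m) ^ 2 by push_cast; ring,
    show 4 + ((0 : ℝ) : ℂ) * ((1 + m) ^ 2 - 4) = 4 by push_cast; ring]
  have p3 := incompletePeriod_three hb.ne hw (h.im_zetaThree_nonneg hb.le)
  have p5 := incompletePeriod_five hb.ne hw (h.im_zetaFive_nonpos hb.le)
  rw [scaleKappa]
  linear_combination (2 * ε * I) * (p3 - p5)

theorem exists_isCycleOver_a :
    ∃ v, IsCycleOver (paramA m) (zetaFive m) (zetaThree m) v := by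
  have m1 := one_add_ne_zero_of_im hb.ne
  have m2 := one_sub_ne_zero_of_im hb.ne
  have h0 := h.re_nonneg
  refine exists_isCycleOver (v₀ := fun t => scaleKappa m * (2 * Complex.sqrt (segA m t / 2 ^ 2)) *
    tripleSqrt ((1 - m) ^ 2) ((1 + m) ^ 2) 4 (segA m t)) ?_ (fun t ht => ?_) ?_
  · have hzc : Continuous (segA m) := by unfold segA; fun_prop
    refine (continuousOn_const.mul (continuousOn_const.mul fun t ht => ?_)).mul
      (continuousOn_tripleSqrt.comp hzc.continuousOn
        fun t ht => segA_mem_tripleClosure h hb ht)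
    refine (ContinuousAt.comp (g := Complex.sqrt) (f := fun t : ℝ => segA m t / 2 ^ 2)
      (continuousAt_sqrt ?_) (hzc.div_const _).continuousAt).continuousWithinAt
    rcases eq_or_lt_of_le ht.1 with rfl | ht0
    · refine Or.inl ?_
      rw [show segA m 0 / 2 ^ 2 = 1 by norm_num [segA]]
      simp
    · refine Or.inr ?_
      rw [show (2 ^ 2 : ℂ) = ((4 : ℝ) : ℂ) by norm_num, div_ofReal_im, im_segA]
      exact div_ne_zero (mul_ne_zero ht0.ne' (mul_ne_zero (mul_ne_zero two_ne_zero hb.ne)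
        (by linarith : (1 + m.re) ≠ 0))) (by norm_num)
  · rw [segA_scaled, quartic_scaled h.ne_zero m1 m2, mul_pow, mul_pow, mul_pow 2, sq_csqrt]
    ring
  · have : segA m 1 = (1 + m) ^ 2 := by simp [segA]
    simp [this, tripleSqrt, div_self (pow_ne_zero 2 m1), Complex.sqrt]

end

section
variable {m : ℂ}

theorem sqrt_endpoint_eq_or {c d : ℂ} (hc : c ≠ 0) :
    c * Complex.sqrt (d ^ 2 / c ^ 2) = d ∨ c * Complex.sqrt (d ^ 2 / c ^ 2) = -d := by
  apply sq_eq_sq_iff_eq_or_eq_neg.1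
  rw [mul_pow, sq_csqrt]
  field_simp

theorem segB_zero : segB m 0 = (1 + m) ^ 2 := by simp [segB]

theorem segB_one : segB m 1 = (1 - m) ^ 2 := by simp [segB]

theorem continuous_segB : Continuous (segB m) := by unfold segB; fun_prop

theorem segB_integrand (hw : 3 + m ^ 2 ≠ 0) (v : ℝ → ℂ) (t : ℝ) :
    v t / (zetaThree m + t * (zetaOne m - zetaThree m)) * (zetaOne m - zetaThree m) =
      v t / segB m t * ((1 - m) ^ 2 - (1 + m) ^ 2) := by
  have hh : (-2 / (3 + m ^ 2)) ≠ 0 := div_ne_zero (by norm_num) hw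
  rw [segB_scaled, show zetaOne m - zetaThree m = -2 / (3 + m ^ 2) * ((1 - m) ^ 2 - (1 + m) ^ 2) by
    rw [zetaThree, zetaOne]; ring, div_mul_eq_mul_div, ← mul_assoc, mul_comm (v t),
    mul_assoc, mul_div_mul_left _ _ hh, div_mul_eq_mul_div]

variable (h : Admissible m) (hb : m.im < 0)
include h hb

/-- Continued along the segment, √z takes the values 1-m at one end and ±(1+m) at the other, the
sign depending on the side on which 0 is passed. That sign is left undetermined, as the equations do
not see it. -/
theorem cycleIntegral_b_of_normSq_ne {v : ℝ → ℂ} (hR : normSq m ≠ 1)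
    (hv : IsCycleOver (paramA m) (zetaThree m) (zetaOne m) v) :
    ∃ ε ε' : ℂ, (ε = 1 ∨ ε = -1) ∧ (ε' = 1 ∨ ε' = -1) ∧
      cycleIntegral (zetaThree m) (zetaOne m) v =
        2 * I * (ε * periodJOne m + ε' * periodJThree m) := by
  have m1 := one_add_ne_zero_of_im hb.ne
  have m2 := one_sub_ne_zero_of_im hb.ne
  have hw := h.ne_zero
  have hslit : ∀ t ∈ Icc (0 : ℝ) 1, segB m t / (1 - m) ^ 2 ∈ slitPlane := fun t ht =>
    segB_div_mem_slitPlane h hb hR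
  have hz0 : ∀ t ∈ Icc (0 : ℝ) 1, segB m t ≠ 0 := fun t ht e => by
    have := hslit t ht
    rw [e, zero_div] at this
    exact slitPlane_ne_zero this rfl
  have hint : IntervalIntegrable (fun t : ℝ => v t / segB m t * ((1 - m) ^ 2 - (1 + m) ^ 2))
      volume 0 1 := by
    refine ContinuousOn.intervalIntegrable ?_
    rw [uIcc_of_le zero_le_one]
    exact (hv.continuousOn_unit.div continuous_segB.continuousOn hz0).mul continuousOn_const
  rw [cycleIntegral_eq_two_mul hv (by simp only [segB_integrand hw]; exact hint)]
  simp only [segB_integrand hw]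
  obtain ⟨ε, hε, e⟩ := exists_integral_eq_of_sq_eq (r₁ := (1 - m) ^ 2) (r₃ := (1 + m) ^ 2)
    (r₅ := 4) (c := 1 - m) (z₀ := (1 + m) ^ 2) (d := (1 - m) ^ 2 - (1 + m) ^ 2)
    (κ := scaleKappa m) m2
    zero_le_one (fun t ht => hslit t (Ioo_subset_Icc_self ht))
    (fun t ht => segB_mem_tripleDomain hb ht)
    (fun t ht => (hslit t ht).imp le_of_lt id)
    (fun t ht => segB_mem_tripleClosure hb ht) (scaleKappa_ne_zero hw m1 m2)
    hv.continuousOn_unit (fun t ht => by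
      rw [hv.sq_eq ht, segB_scaled, quartic_scaled hw m1 m2]; rfl) hint
  have e' : ∫ t in (0 : ℝ)..1, v t / segB m t * ((1 - m) ^ 2 - (1 + m) ^ 2) =
      ∫ t in (0 : ℝ)..1, v t / ((1 + m) ^ 2 + t * ((1 - m) ^ 2 - (1 + m) ^ 2)) *
        ((1 - m) ^ 2 - (1 + m) ^ 2) := rfl
  rw [e', e]
  rw [show (1 + m) ^ 2 + ((1 : ℝ) : ℂ) * ((1 - m) ^ 2 - (1 + m) ^ 2) = (1 - m) ^ 2 by
      push_cast; ring,
    show (1 + m) ^ 2 + ((0 : ℝ) : ℂ) * ((1 - m) ^ 2 - (1 + m) ^ 2) = (1 + m) ^ 2 by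
      push_cast; ring, div_self (pow_ne_zero 2 m2), csqrt_one, mul_one]
  have p3 := incompletePeriod_three hb.ne hw (h.im_zetaThree_nonneg hb.le)
  have p1 := incompletePeriod_one hb.ne hw (h.im_zetaOne_nonpos hb.le)
  rw [scaleKappa]
  rcases sqrt_endpoint_eq_or (c := 1 - m) (d := 1 + m) m2 with s | s
  · refine ⟨-ε, ε, by rcases hε with rfl | rfl <;> simp, hε, ?_⟩
    rw [s]
    linear_combination (2 * ε * I) * (p1 - p3)
  · refine ⟨-ε, -ε, by rcases hε with rfl | rfl <;> simp, by rcases hε with rfl | rfl <;> simp, ?_⟩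
    rw [s]
    linear_combination (2 * ε * I) * (p1 + p3)

omit h hb in
theorem segB_eq_of_normSq (hR : normSq m = 1) (t : ℝ) :
    segB m t = ((4 * ((1 + m.re) / 2 - t) : ℝ) : ℂ) * m := by
  rw [segB_eq, hR]
  push_cast
  ring

/-- Here the segment passes through the branch point 0 at t = (1+Re m)/2. There v vanishes and may
change branch freely, so the two halves carry independent signs; v/ζ has an integrable
inverse-square-root singularity. -/
theorem cycleIntegral_b_of_normSq_eq {v : ℝ → ℂ} (hR : normSq m = 1)
    (hv : IsCycleOver (paramA m) (zetaThree m) (zetaOne m) v) :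
    ∃ ε ε' : ℂ, (ε = 1 ∨ ε = -1) ∧ (ε' = 1 ∨ ε' = -1) ∧
      cycleIntegral (zetaThree m) (zetaOne m) v =
        2 * I * (ε * periodJOne m + ε' * periodJThree m) := by
  have m1 := one_add_ne_zero_of_im hb.ne
  have m2 := one_sub_ne_zero_of_im hb.ne
  have hw := h.ne_zero
  have h0 := h.re_nonneg
  have h1 := h.re_lt_one hb.ne
  have hm0 : m ≠ 0 := by rintro rfl; simp at hb
  have hnm : ‖m‖ = 1 := by
    have := Complex.normSq_eq_norm_sq m
    rw [hR] at this
    nlinarith [norm_nonneg m]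
  set τ : ℝ := (1 + m.re) / 2 with hτ
  have hτ0 : 0 < τ := by rw [hτ]; linarith
  have hτ1 : τ < 1 := by rw [hτ]; linarith
  have hz : ∀ t : ℝ, segB m t = ((4 * (τ - t) : ℝ) : ℂ) * m := segB_eq_of_normSq hR
  have r3 : (1 + m) ^ 2 = ((4 * τ : ℝ) : ℂ) * m := by
    rw [← segB_zero, hz, sub_zero]
  have r1 : (1 - m) ^ 2 = ((4 * (τ - 1) : ℝ) : ℂ) * m := by
    rw [← segB_one, hz]
  have q3 : ∀ t : ℝ, segB m t / (1 + m) ^ 2 = (((τ - t) / τ : ℝ) : ℂ) := by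
    intro t
    have : (τ : ℂ) ≠ 0 := ofReal_ne_zero.2 hτ0.ne'
    rw [r3, hz]; push_cast; field_simp
  have q1 : ∀ t : ℝ, segB m t / (1 - m) ^ 2 = (((t - τ) / (1 - τ) : ℝ) : ℂ) := by
    intro t
    have h2 : ((1 - τ : ℝ) : ℂ) ≠ 0 := ofReal_ne_zero.2 (by linarith)
    have h3 : ((τ - 1 : ℝ) : ℂ) ≠ 0 := ofReal_ne_zero.2 (by linarith)
    push_cast at h2 h3
    rw [r1, hz]; push_cast
    rw [div_eq_div_iff (mul_ne_zero (mul_ne_zero (by norm_num) h3) hm0) h2]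
    ring
  have hz0 : ∀ t : ℝ, t ≠ τ → segB m t ≠ 0 := fun t ht => by
    rw [hz]
    exact mul_ne_zero (ofReal_ne_zero.2 (mul_ne_zero four_ne_zero (sub_ne_zero.2 ht.symm))) hm0
  have hsq : ∀ t ∈ Icc (0 : ℝ) 1, v t ^ 2 = scaleKappa m ^ 2 * segB m t *
      tripleSqrt ((1 - m) ^ 2) ((1 + m) ^ 2) 4 (segB m t) ^ 2 := fun t ht => by
    rw [hv.sq_eq ht, segB_scaled, quartic_scaled hw m1 m2]
  obtain ⟨C, hC0, hC⟩ := exists_norm_div_le (continuousOn_tripleSqrt.comp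
    continuous_segB.continuousOn fun t ht => segB_mem_tripleClosure hb ht) hsq
    ((1 - m) ^ 2 - (1 + m) ^ 2)
  have hI1 : Icc (0 : ℝ) τ ⊆ Icc 0 1 := Icc_subset_Icc_right hτ1.le
  have hI2 : Icc τ 1 ⊆ Icc (0 : ℝ) 1 := Icc_subset_Icc_left hτ0.le
  have hnorm : ∀ t : ℝ, ‖segB m t‖ = 4 * |τ - t| := fun t => by
    rw [hz, norm_mul, hnm, mul_one, norm_real, Real.norm_eq_abs, abs_mul]
    norm_num
  have hcontIoo : ∀ a b : ℝ, Ioo a b ⊆ Icc 0 1 → (∀ t ∈ Ioo a b, t ≠ τ) →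
      ContinuousOn (fun t : ℝ => v t / segB m t * ((1 - m) ^ 2 - (1 + m) ^ 2)) (Ioo a b) :=
    fun a b hab hne => ((hv.continuousOn_unit.mono hab).div continuous_segB.continuousOn
      fun t ht => hz0 t (hne t ht)).mul continuousOn_const
  have hint1 : IntervalIntegrable (fun t : ℝ => v t / segB m t * ((1 - m) ^ 2 - (1 + m) ^ 2))
      volume 0 τ := by
    refine intervalIntegrable_of_norm_le_rpow_right (C := C * 4 ^ (-1 / 2 : ℝ)) hτ0.le
      (hcontIoo _ _ (Ioo_subset_Icc_self.trans hI1) fun t ht => ht.2.ne) fun t ht => ?_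
    refine (hC t (hI1 (Ioo_subset_Icc_self ht)) (hz0 t ht.2.ne)).trans_eq ?_
    rw [hnorm, abs_of_pos (sub_pos.2 ht.2), Real.mul_rpow (by norm_num) (sub_pos.2 ht.2).le]
    ring
  have hint2 : IntervalIntegrable (fun t : ℝ => v t / segB m t * ((1 - m) ^ 2 - (1 + m) ^ 2))
      volume τ 1 := by
    refine intervalIntegrable_of_norm_le_rpow_left (C := C * 4 ^ (-1 / 2 : ℝ)) hτ1.le
      (hcontIoo _ _ (Ioo_subset_Icc_self.trans hI2) fun t ht => ht.1.ne') fun t ht => ?_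
    refine (hC t (hI2 (Ioo_subset_Icc_self ht)) (hz0 t ht.1.ne')).trans_eq ?_
    rw [hnorm, abs_sub_comm, abs_of_pos (sub_pos.2 ht.1),
      Real.mul_rpow (by norm_num) (sub_pos.2 ht.1).le]
    ring
  rw [cycleIntegral_eq_two_mul hv (by simp only [segB_integrand hw]; exact hint1.trans hint2)]
  simp only [segB_integrand hw]
  rw [← intervalIntegral.integral_add_adjacent_intervals hint1 hint2]
  -- On each half √z is normalized by the square root of its own end root; z divided by that root is
  -- then a nonnegative real, and the end z = 0 contributes nothing.
  obtain ⟨ε', hε', e1⟩ := exists_integral_eq_of_sq_eq (r₁ := (1 - m) ^ 2) (r₃ := (1 + m) ^ 2)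
    (r₅ := 4) (c := 1 + m) (z₀ := (1 + m) ^ 2) (d := (1 - m) ^ 2 - (1 + m) ^ 2)
    (κ := scaleKappa m) m1 hτ0.le
    (fun t ht => by
      change segB m t / (1 + m) ^ 2 ∈ _
      rw [q3]
      exact ofReal_mem_slitPlane.2 (div_pos (sub_pos.2 ht.2) hτ0))
    (fun t ht => segB_mem_tripleDomain hb ⟨ht.1, ht.2.trans hτ1⟩)
    (fun t ht => Or.inl (by
      change 0 ≤ (segB m t / (1 + m) ^ 2).re
      rw [q3, ofReal_re]
      exact div_nonneg (sub_nonneg.2 ht.2) hτ0.le))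
    (fun t ht => segB_mem_tripleClosure hb (hI1 ht)) (scaleKappa_ne_zero hw m1 m2)
    (hv.continuousOn_unit.mono hI1) (fun t ht => hsq t (hI1 ht)) hint1
  obtain ⟨ε, hε, e2⟩ := exists_integral_eq_of_sq_eq (r₁ := (1 - m) ^ 2) (r₃ := (1 + m) ^ 2)
    (r₅ := 4) (c := 1 - m) (z₀ := (1 + m) ^ 2) (d := (1 - m) ^ 2 - (1 + m) ^ 2)
    (κ := scaleKappa m) m2 hτ1.le
    (fun t ht => by
      change segB m t / (1 - m) ^ 2 ∈ _
      rw [q1]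
      exact ofReal_mem_slitPlane.2 (div_pos (sub_pos.2 ht.1) (sub_pos.2 hτ1)))
    (fun t ht => segB_mem_tripleDomain hb ⟨hτ0.trans ht.1, ht.2⟩)
    (fun t ht => Or.inl (by
      change 0 ≤ (segB m t / (1 - m) ^ 2).re
      rw [q1, ofReal_re]
      exact div_nonneg (sub_nonneg.2 ht.1) (sub_pos.2 hτ1).le))
    (fun t ht => segB_mem_tripleClosure hb (hI2 ht)) (scaleKappa_ne_zero hw m1 m2)
    (hv.continuousOn_unit.mono hI2) (fun t ht => hsq t (hI2 ht)) hint2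
  have e1' : ∫ t in (0 : ℝ)..τ, v t / segB m t * ((1 - m) ^ 2 - (1 + m) ^ 2) =
      ε' * scaleKappa m * -((1 + m) *
        incompletePeriod ((1 - m) ^ 2) ((1 + m) ^ 2) 4 ((1 + m) ^ 2)) := by
    refine e1.trans ?_
    change ε' * scaleKappa m * ((1 + m) * Complex.sqrt (segB m τ / (1 + m) ^ 2) * _ -
      (1 + m) * Complex.sqrt (segB m 0 / (1 + m) ^ 2) * incompletePeriod _ _ _ (segB m 0)) = _
    rw [q3, sub_self, segB_zero, div_self (pow_ne_zero 2 m1), csqrt_one]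
    simp [Complex.sqrt]
  have e2' : ∫ t in τ..(1 : ℝ), v t / segB m t * ((1 - m) ^ 2 - (1 + m) ^ 2) =
      ε * scaleKappa m * ((1 - m) *
        incompletePeriod ((1 - m) ^ 2) ((1 + m) ^ 2) 4 ((1 - m) ^ 2)) := by
    refine e2.trans ?_
    change ε * scaleKappa m * ((1 - m) * Complex.sqrt (segB m 1 / (1 - m) ^ 2) *
      incompletePeriod _ _ _ (segB m 1) - (1 - m) * Complex.sqrt (segB m τ / (1 - m) ^ 2) * _) = _
    rw [q1 τ, sub_self, segB_one, div_self (pow_ne_zero 2 m2), csqrt_one]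
    simp [Complex.sqrt]
  rw [e1', e2']
  have p3 := incompletePeriod_three hb.ne hw (h.im_zetaThree_nonneg hb.le)
  have p1 := incompletePeriod_one hb.ne hw (h.im_zetaOne_nonpos hb.le)
  rw [scaleKappa]
  refine ⟨-ε, ε', by rcases hε with rfl | rfl <;> simp, hε', ?_⟩
  linear_combination (2 * ε * I) * p1 - (2 * ε' * I) * p3

/-- The integral over the cycle between `ζ₃` and `ζ₁`. -/
theorem cycleIntegral_b {v : ℝ → ℂ} (hv : IsCycleOver (paramA m) (zetaThree m) (zetaOne m) v) :
    ∃ ε ε' : ℂ, (ε = 1 ∨ ε = -1) ∧ (ε' = 1 ∨ ε' = -1) ∧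
      cycleIntegral (zetaThree m) (zetaOne m) v =
        2 * I * (ε * periodJOne m + ε' * periodJThree m) := by
  by_cases hR : normSq m = 1
  · exact cycleIntegral_b_of_normSq_eq h hb hR hv
  · exact cycleIntegral_b_of_normSq_ne h hb hR hv

theorem exists_isCycleOver_b (hR : normSq m ≠ 1) :
    ∃ v, IsCycleOver (paramA m) (zetaThree m) (zetaOne m) v := by
  have m1 := one_add_ne_zero_of_im hb.ne
  have m2 := one_sub_ne_zero_of_im hb.ne
  refine exists_isCycleOver (v₀ := fun t => scaleKappa m *
    ((1 - m) * Complex.sqrt (segB m t / (1 - m) ^ 2)) *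
    tripleSqrt ((1 - m) ^ 2) ((1 + m) ^ 2) 4 (segB m t)) ?_ (fun t ht => ?_) ?_
  · refine (continuousOn_const.mul (continuousOn_const.mul fun t ht => ?_)).mul
      (continuousOn_tripleSqrt.comp continuous_segB.continuousOn
        fun t ht => segB_mem_tripleClosure hb ht)
    exact (ContinuousAt.comp (g := Complex.sqrt) (f := fun t : ℝ => segB m t / (1 - m) ^ 2)
      (differentiableAt_sqrt (segB_div_mem_slitPlane h hb hR)).continuousAt
      (continuous_segB.div_const _).continuousAt).continuousWithinAt
  · rw [segB_scaled, quartic_scaled h.ne_zero m1 m2, mul_pow, mul_pow, mul_pow (1 - m), sq_csqrt]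
    field_simp
  · simp [segB_one, tripleSqrt, div_self (pow_ne_zero 2 m2), Complex.sqrt]

/-- For a complex parameter, the Boutroux equations in terms of the periods. -/
theorem boutroux_cycles_iff (c : ℂ) {va vb : ℝ → ℂ}
    (ha : IsCycleOver (paramA m) (zetaFive m) (zetaThree m) va)
    (hb' : IsCycleOver (paramA m) (zetaThree m) (zetaOne m) vb) :
    ((c * cycleIntegral (zetaFive m) (zetaThree m) va).re = 0 ∧
      (c * cycleIntegral (zetaThree m) (zetaOne m) vb).re = 0) ↔
    ((c * periodJOne m).im = 0 ∧ (c * periodJThree m).im = 0) := by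
  obtain ⟨ε, hε, ea⟩ := cycleIntegral_a h hb ha
  obtain ⟨ε₁, ε₃, h1, h3, eb⟩ := cycleIntegral_b h hb hb'
  obtain ⟨α, β, μ, -, -, hμ, -, -, hrel⟩ := exists_period_relations
  rw [ea, eb, hrel m ⟨h, hb.le⟩]
  have i1 : (c * (2 * ε * I * (μ * periodJOne m))).re = -(2 * μ) * (ε * (c * periodJOne m)).im := by
    rw [show c * (2 * ε * I * (μ * periodJOne m)) =
      ((2 * μ : ℝ) : ℂ) * (I * (ε * (c * periodJOne m))) by push_cast; ring, re_ofReal_mul,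
      I_mul_re]
    ring
  have i2 : (c * (2 * I * (ε₁ * periodJOne m + ε₃ * periodJThree m))).re =
      -2 * ((ε₁ * (c * periodJOne m)).im + (ε₃ * (c * periodJThree m)).im) := by
    rw [show c * (2 * I * (ε₁ * periodJOne m + ε₃ * periodJThree m)) =
      ((2 : ℝ) : ℂ) * (I * (ε₁ * (c * periodJOne m) + ε₃ * (c * periodJThree m))) by
      push_cast; ring, re_ofReal_mul, I_mul_re, add_im]
    ring
  have hs : ∀ {ε : ℂ} (z : ℂ), (ε = 1 ∨ ε = -1) → ((ε * z).im = z.im ∨ (ε * z).im = -z.im) := by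
    rintro ε z (rfl | rfl) <;> simp
  rw [i1, i2]
  constructor
  -- The a-equation gives Im cJ₁ = 0 because μ ≠ 0. The J₁-term then drops out of the b-equation
  -- whatever its sign, leaving Im cJ₃ = 0.
  · rintro ⟨h5, h6⟩
    have h7 : (c * periodJOne m).im = 0 := by
      rcases mul_eq_zero.1 h5 with h8 | h8
      · exact absurd (by linarith) hμ
      · rcases hs (c * periodJOne m) hε with h9 | h9 <;> rw [h9] at h8 <;> linarith
    refine ⟨h7, ?_⟩
    rcases hs (c * periodJOne m) h1 with h9 | h9 <;>
      rcases hs (c * periodJThree m) h3 with h10 | h10 <;> rw [h9, h10, h7] at h6 <;> linarith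
  · rintro ⟨h5, h6⟩
    rcases hs (c * periodJOne m) hε with h8 | h8 <;> rcases hs (c * periodJOne m) h1 with h9 | h9 <;>
      rcases hs (c * periodJThree m) h3 with h10 | h10 <;> rw [h8, h9, h10, h5, h6] <;> simp

end

/-! ### Real parameters -/

/-- On a real segment v/ζ is one fixed sign times the constant w times a positive function, so the
integral cannot vanish and its direction is that of w. -/
theorem cycleIntegral_of_real {A : ℂ} {p q : ℝ} {v : ℝ → ℂ} (hv : IsCycleOver A p q v) (hpq : p < q)
    {w : ℂ} (hw : w ≠ 0) {g : ℝ → ℝ} (hg : ContinuousOn g (Icc 0 1))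
    (hg0 : ∀ t ∈ Ioo (0 : ℝ) 1, 0 < g t) (hz : ∀ t ∈ Ioo (0 : ℝ) 1, p + t * (q - p) ≠ 0)
    (h : ∀ t ∈ Ioo (0 : ℝ) 1,
      quartic A ((p + t * (q - p) : ℝ) : ℂ) = (w * g t * ((p + t * (q - p) : ℝ) : ℂ)) ^ 2) :
    ∃ r : ℝ, r ≠ 0 ∧ cycleIntegral p q v = w * r := by
  obtain ⟨ε, hε, hεv⟩ : ∃ ε : ℝ, ε ≠ 0 ∧
      ∀ t ∈ Ioo (0 : ℝ) 1, v t = ε * (w * g t * ((p + t * (q - p) : ℝ) : ℂ)) := by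
    have hc : ContinuousOn (fun t : ℝ => w * g t * ((p + t * (q - p) : ℝ) : ℂ)) (Ioo 0 1) := by
      have := continuous_ofReal.comp_continuousOn (hg.mono Ioo_subset_Icc_self)
      exact (continuousOn_const.mul this).mul (by fun_prop)
    have := isPreconnected_Ioo.eq_or_eq_neg_of_sq_eq (S := Ioo (0 : ℝ) 1)
      (hv.continuousOn_unit.mono Ioo_subset_Icc_self) hc
      (fun t ht => by
        simp only [Pi.pow_apply]
        rw [hv.sq_eq (Ioo_subset_Icc_self ht), ← h t ht]
        push_cast; rfl)
      (fun {t} ht => mul_ne_zero (mul_ne_zero hw (ofReal_ne_zero.2 (hg0 t ht).ne'))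
        (ofReal_ne_zero.2 (hz t ht)))
    rcases this with h | h
    · exact ⟨1, one_ne_zero, fun t ht => by rw [h ht]; simp⟩
    · exact ⟨-1, by norm_num, fun t ht => by rw [h ht]; simp⟩
  have hgi : IntervalIntegrable g volume 0 1 :=
    ContinuousOn.intervalIntegrable (by rwa [uIcc_of_le zero_le_one])
  have hpos : 0 < ∫ t in (0 : ℝ)..1, g t :=
    intervalIntegral.intervalIntegral_pos_of_pos_on hgi hg0 zero_lt_one
  have hae : ∀ᵐ t : ℝ, t ∈ uIoc 0 1 →
      ((ε * (q - p) * g t : ℝ) : ℂ) * w = v t / (p + t * (q - p)) * (q - p) := by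
    filter_upwards [ae_ne_one] with t ht1 ht
    rw [uIoc_of_le zero_le_one] at ht
    have ht' : t ∈ Ioo (0 : ℝ) 1 := ⟨ht.1, lt_of_le_of_ne ht.2 ht1⟩
    have hz' : (p + t * (q - p) : ℂ) ≠ 0 := by exact_mod_cast hz t ht'
    rw [hεv t ht']
    push_cast
    generalize (p + t * (q - p) : ℂ) = z at hz'
    field_simp
  have hint0 : IntervalIntegrable (fun t => ((ε * (q - p) * g t : ℝ) : ℂ) * w) volume 0 1 := by
    have := hgi.const_mul (ε * (q - p))
    exact IntervalIntegrable.mul_const (f := fun t => ((ε * (q - p) * g t : ℝ) : ℂ))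
      ⟨this.1.ofReal, this.2.ofReal⟩ w
  have hint : IntervalIntegrable (fun t : ℝ => v t / (p + t * (q - p)) * ((q : ℂ) - p)) volume 0 1 :=
    hint0.congr_ae (by rwa [EventuallyEq, ae_restrict_iff' measurableSet_uIoc])
  refine ⟨2 * (ε * (q - p) * ∫ t in (0 : ℝ)..1, g t),
    mul_ne_zero two_ne_zero (mul_ne_zero (mul_ne_zero hε (sub_ne_zero.2 hpq.ne')) hpos.ne'), ?_⟩
  rw [cycleIntegral_eq_two_mul hv hint, ← intervalIntegral.integral_congr_ae hae,
    intervalIntegral.integral_mul_const, intervalIntegral.integral_ofReal,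
    intervalIntegral.integral_const_mul]
  push_cast
  ring

theorem IsRootNumbering.quartic_eq {A ζ₁ ζ₃ ζ₅ : ℂ} (h : IsRootNumbering A ζ₁ ζ₃ ζ₅) (z : ℂ) :
    quartic A z = z * ((z - ζ₁) * (z - ζ₃) * (z - ζ₅)) := by
  rw [← h.factor, quartic]
  ring

noncomputable def realZetaFive (a : ℝ) : ℝ := -8 / (3 + a ^ 2)

noncomputable def realZetaThree (a : ℝ) : ℝ := -2 * (1 + a) ^ 2 / (3 + a ^ 2)

noncomputable def realZetaOne (a : ℝ) : ℝ := -2 * (1 - a) ^ 2 / (3 + a ^ 2)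

theorem zetaFive_ofReal (a : ℝ) : zetaFive a = realZetaFive a := by
  rw [zetaFive, realZetaFive]; push_cast; rfl

theorem zetaThree_ofReal (a : ℝ) : zetaThree a = realZetaThree a := by
  rw [zetaThree, realZetaThree]; push_cast; rfl

theorem zetaOne_ofReal (a : ℝ) : zetaOne a = realZetaOne a := by
  rw [zetaOne, realZetaOne]; push_cast; rfl

theorem quartic_paramA_ofReal {a : ℝ} (ha : a ∈ Icc (0 : ℝ) 1) (z : ℝ) :
    quartic (paramA a) z = ((z * ((z - realZetaOne a) * (z - realZetaThree a) *
      (z - realZetaFive a)) : ℝ) : ℂ) := by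
  rw [(ofReal_mem_closedSector ha).1.isRootNumbering.quartic_eq, zetaFive_ofReal,
    zetaThree_ofReal, zetaOne_ofReal]
  push_cast
  rfl

theorem realZetaFive_lt {a : ℝ} (h0 : 0 ≤ a) (h1 : a < 1) : realZetaFive a < realZetaThree a := by
  rw [realZetaFive, realZetaThree]
  gcongr
  nlinarith

theorem realZetaThree_lt {a : ℝ} (h0 : 0 < a) : realZetaThree a < realZetaOne a := by
  rw [realZetaThree, realZetaOne]
  gcongr ?_ / _
  nlinarith

theorem realZetaThree_le {a : ℝ} (h0 : 0 ≤ a) : realZetaThree a ≤ realZetaOne a := by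
  rw [realZetaThree, realZetaOne]
  gcongr ?_ / _
  nlinarith

theorem realZetaThree_neg {a : ℝ} (h0 : 0 ≤ a) : realZetaThree a < 0 := by
  rw [realZetaThree]
  exact div_neg_of_neg_of_pos (by nlinarith) (by positivity)

theorem realZetaOne_neg {a : ℝ} (h1 : a < 1) : realZetaOne a < 0 := by
  rw [realZetaOne]
  exact div_neg_of_neg_of_pos (by nlinarith [pow_pos (sub_pos.2 h1) 2]) (by positivity)

theorem segment_mem_Ioo {p q t : ℝ} (hpq : p < q) (ht : t ∈ Ioo (0 : ℝ) 1) :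
    p + t * (q - p) ∈ Ioo p q := by
  have := mul_pos ht.1 (sub_pos.2 hpq)
  have := mul_pos (sub_pos.2 ht.2) (sub_pos.2 hpq)
  constructor <;> nlinarith

theorem segment_mem_Icc {p q t : ℝ} (hpq : p ≤ q) (ht : t ∈ Icc (0 : ℝ) 1) :
    p + t * (q - p) ∈ Icc p q := by
  have := mul_nonneg ht.1 (sub_nonneg.2 hpq)
  have := mul_nonneg (sub_nonneg.2 ht.2) (sub_nonneg.2 hpq)
  constructor <;> nlinarith

/-- The quartic is negative between ζ₅ and ζ₃, so v is imaginary there. For a = 1 the cycle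
collapses. -/
theorem cycleIntegral_a_ofReal {a : ℝ} (ha : a ∈ Icc (0 : ℝ) 1) (h1 : a < 1) {v : ℝ → ℂ}
    (hv : IsCycleOver (paramA a) (zetaFive a) (zetaThree a) v) :
    ∃ r : ℝ, r ≠ 0 ∧ cycleIntegral (zetaFive a) (zetaThree a) v = I * r := by
  have h53 := realZetaFive_lt ha.1 h1
  have h31 := realZetaThree_le ha.1
  have h30 := realZetaThree_neg ha.1
  rw [zetaFive_ofReal, zetaThree_ofReal] at hv ⊢
  set p := realZetaFive a
  set q := realZetaThree a
  set z : ℝ → ℝ := fun t => p + t * (q - p) with hzdef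
  have hneg : ∀ t ∈ Icc (0 : ℝ) 1, z t < 0 := fun t ht =>
    (segment_mem_Icc h53.le ht).2.trans_lt h30
  have hQ : ∀ t ∈ Ioo (0 : ℝ) 1, 0 < -(z t * ((z t - realZetaOne a) * (z t - q) * (z t - p))) := by
    intro t ht
    obtain ⟨hz1, hz2⟩ : z t ∈ Ioo p q := segment_mem_Ioo h53 ht
    have e : -(z t * ((z t - realZetaOne a) * (z t - q) * (z t - p))) =
      (-z t) * ((realZetaOne a - z t) * (q - z t) * (z t - p)) := by ring
    rw [e]
    exact mul_pos (by linarith) (mul_pos (mul_pos (by linarith) (by linarith)) (by linarith))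
  refine cycleIntegral_of_real hv h53 I_ne_zero
    (g := fun t => √(-(z t * ((z t - realZetaOne a) * (z t - q) * (z t - p)))) / -z t) ?_ ?_ ?_ ?_
  · exact ContinuousOn.div (by fun_prop) (by fun_prop) fun t ht => (neg_pos.2 (hneg t ht)).ne'
  · exact fun t ht => div_pos (Real.sqrt_pos.2 (hQ t ht))
      (neg_pos.2 (hneg t (Ioo_subset_Icc_self ht)))
  · exact fun t ht => (hneg t (Ioo_subset_Icc_self ht)).ne
  · intro t ht
    have hz0 : z t ≠ 0 := (hneg t (Ioo_subset_Icc_self ht)).ne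
    have hs := Real.sq_sqrt (hQ t ht).le
    change quartic (paramA a) ((z t : ℝ) : ℂ) = _
    rw [quartic_paramA_ofReal ha]
    have e : (I * ((√(-(z t * ((z t - realZetaOne a) * (z t - q) * (z t - p)))) / -z t : ℝ) : ℂ) *
        ((z t : ℝ) : ℂ)) = -I *
          ((√(-(z t * ((z t - realZetaOne a) * (z t - q) * (z t - p)))) : ℝ) : ℂ) := by
      have : (z t : ℂ) ≠ 0 := ofReal_ne_zero.2 hz0
      rw [ofReal_div, ofReal_neg]
      field_simp
    rw [e, mul_pow, neg_sq, I_sq, ← ofReal_pow, hs]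
    push_cast
    ring

/-- The quartic is positive between ζ₃ and ζ₁, so v is real there. For a = 0 the cycle collapses. -/
theorem cycleIntegral_b_ofReal {a : ℝ} (ha : a ∈ Icc (0 : ℝ) 1) (h0 : 0 < a) {v : ℝ → ℂ}
    (hv : IsCycleOver (paramA a) (zetaThree a) (zetaOne a) v) :
    ∃ r : ℝ, r ≠ 0 ∧ cycleIntegral (zetaThree a) (zetaOne a) v = r := by
  -- For a = 1 the quartic is ζ²(ζ+2)² and ζ₁ = 0, so the generic quotient would divide by 0 at the
  -- end; instead v/ζ = ±(ζ+2), which is ±2t on the segment from -2 to 0.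
  rcases eq_or_lt_of_le ha.2 with rfl | h1
  · have e3 : zetaThree ((1 : ℝ) : ℂ) = ((-2 : ℝ) : ℂ) := by norm_num [zetaThree]
    have e1 : zetaOne ((1 : ℝ) : ℂ) = ((0 : ℝ) : ℂ) := by norm_num [zetaOne]
    have eA : paramA ((1 : ℝ) : ℂ) = 0 := by norm_num [paramA]
    rw [e3, e1, eA] at hv
    rw [e3, e1]
    have := cycleIntegral_of_real hv (by norm_num) one_ne_zero (g := fun t => 2 * t) (by fun_prop)
      (fun t ht => mul_pos two_pos ht.1) (fun t ht => by linarith [ht.2]) (fun t ht => by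
        rw [quartic]; push_cast; ring)
    simpa using this
  have h31 := realZetaThree_lt h0
  have h53 := realZetaFive_lt ha.1 h1
  have h10 := realZetaOne_neg h1
  rw [zetaThree_ofReal, zetaOne_ofReal] at hv ⊢
  set p := realZetaThree a
  set q := realZetaOne a
  set z : ℝ → ℝ := fun t => p + t * (q - p) with hzdef
  have hneg : ∀ t ∈ Icc (0 : ℝ) 1, z t < 0 := fun t ht =>
    (segment_mem_Icc h31.le ht).2.trans_lt h10
  have hQ : ∀ t ∈ Ioo (0 : ℝ) 1, 0 < z t * ((z t - q) * (z t - p) * (z t - realZetaFive a)) := by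
    intro t ht
    obtain ⟨hz1, hz2⟩ : z t ∈ Ioo p q := segment_mem_Ioo h31 ht
    have e : z t * ((z t - q) * (z t - p) * (z t - realZetaFive a)) =
      (-z t) * ((q - z t) * (z t - p) * (z t - realZetaFive a)) := by ring
    rw [e]
    exact mul_pos (by linarith) (mul_pos (mul_pos (by linarith) (by linarith)) (by linarith))
  have := cycleIntegral_of_real hv h31 one_ne_zero
    (g := fun t => √(z t * ((z t - q) * (z t - p) * (z t - realZetaFive a))) / -z t) ?_ ?_ ?_ ?_
  · simpa using this
  · exact ContinuousOn.div (by fun_prop) (by fun_prop) fun t ht => (neg_pos.2 (hneg t ht)).ne'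
  · exact fun t ht => div_pos (Real.sqrt_pos.2 (hQ t ht))
      (neg_pos.2 (hneg t (Ioo_subset_Icc_self ht)))
  · exact fun t ht => (hneg t (Ioo_subset_Icc_self ht)).ne
  · intro t ht
    have hz0 : z t ≠ 0 := (hneg t (Ioo_subset_Icc_self ht)).ne
    have hs := Real.sq_sqrt (hQ t ht).le
    change quartic (paramA a) ((z t : ℝ) : ℂ) = _
    rw [quartic_paramA_ofReal ha]
    have e : (1 * ((√(z t * ((z t - q) * (z t - p) * (z t - realZetaFive a))) / -z t : ℝ) : ℂ) *
        ((z t : ℝ) : ℂ)) =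
          -((√(z t * ((z t - q) * (z t - p) * (z t - realZetaFive a))) : ℝ) : ℂ) := by
      have : (z t : ℂ) ≠ 0 := ofReal_ne_zero.2 hz0
      rw [ofReal_div, ofReal_neg]
      field_simp
    rw [e, neg_sq, ← ofReal_pow, hs]

theorem exists_isCycleOver_a_zero : ∃ v, IsCycleOver (paramA 0) (zetaFive 0) (zetaThree 0) v := by
  have h0 : (0 : ℝ) ∈ Icc (0 : ℝ) 1 := by simp
  have h53 := realZetaFive_lt le_rfl (zero_lt_one (α := ℝ))
  have h31 := realZetaThree_le (le_refl (0 : ℝ))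
  have h30 := realZetaThree_neg (le_refl (0 : ℝ))
  have e := quartic_paramA_ofReal h0
  have e5 := zetaFive_ofReal 0
  have e3 := zetaThree_ofReal 0
  rw [ofReal_zero] at e e5 e3
  rw [e5, e3]
  set p := realZetaFive 0
  set q := realZetaThree 0
  set z : ℝ → ℝ := fun t => p + t * (q - p) with hzdef
  refine exists_isCycleOver (v₀ := fun t =>
    I * (√(-(z t * ((z t - realZetaOne 0) * (z t - q) * (z t - p)))) : ℝ)) ?_ (fun t ht => ?_) ?_
  · exact Continuous.continuousOn (by fun_prop)
  · obtain ⟨hz1, hz2⟩ : z t ∈ Icc p q := segment_mem_Icc h53.le ht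
    have hQ : 0 ≤ -(z t * ((z t - realZetaOne 0) * (z t - q) * (z t - p))) := by
      have e : -(z t * ((z t - realZetaOne 0) * (z t - q) * (z t - p))) =
        (-z t) * ((realZetaOne 0 - z t) * (q - z t) * (z t - p)) := by ring
      rw [e]
      exact mul_nonneg (by linarith)
        (mul_nonneg (mul_nonneg (by linarith) (by linarith)) (by linarith))
    have ez : (p + t * (q - p) : ℂ) = ((z t : ℝ) : ℂ) := by rw [hzdef]; push_cast; rfl
    rw [ez, e, mul_pow, I_sq, ← ofReal_pow, Real.sq_sqrt hQ]
    push_cast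
    ring
  · have : z 1 = q := by rw [hzdef]; ring
    simp [this]

theorem exists_isCycleOver_b_one : ∃ v, IsCycleOver (paramA 1) (zetaThree 1) (zetaOne 1) v := by
  have e3 : zetaThree 1 = -2 := by norm_num [zetaThree]
  have e1 : zetaOne 1 = 0 := by norm_num [zetaOne]
  have eA : paramA 1 = 0 := by norm_num [paramA]
  rw [e3, e1, eA]
  refine exists_isCycleOver (v₀ := fun t => (2 * t - 2) * (2 * t)) (by fun_prop) (fun t ht => ?_)
    (by norm_num)
  rw [quartic]
  ring

/-! ### The Boutroux equations in terms of hypergeometric functions -/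

/-- `paramA m` solves the Boutroux equations with the root numbering given by `m`. -/
def SolvesBoutrouxAt (φ : ℝ) (m : ℂ) : Prop :=
  ∃ va vb : ℝ → ℂ, IsCycleOver (paramA m) (zetaFive m) (zetaThree m) va ∧
    IsCycleOver (paramA m) (zetaThree m) (zetaOne m) vb ∧
    (exp (2 * I * φ) * cycleIntegral (zetaFive m) (zetaThree m) va).re = 0 ∧
    (exp (2 * I * φ) * cycleIntegral (zetaThree m) (zetaOne m) vb).re = 0

/-- The reduced form of the Boutroux equations, for `x = 27 A / 8`. -/
def HyperBoutroux (φ : ℝ) (x : ℂ) : Prop :=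
  (exp (2 * I * φ) * hyperY x).im = 0 ∧ (exp (2 * I * φ) * hyperY (1 - x)).re = 0

theorem SolvesBoutroux.exists_at {φ : ℝ} {A : ℂ} (h : SolvesBoutroux φ A) :
    ∃ m, Admissible m ∧ A = paramA m ∧ SolvesBoutrouxAt φ m := by
  obtain ⟨ζ₁, ζ₃, ζ₅, va, vb, hr, ha, hb, h1, h2⟩ := h
  obtain ⟨m, hm, rfl, rfl, rfl, rfl⟩ := hr.exists_param
  exact ⟨m, hm, rfl, va, vb, ha, hb, h1, h2⟩

theorem SolvesBoutrouxAt.solves {φ : ℝ} {m : ℂ} (hm : Admissible m) (h : SolvesBoutrouxAt φ m) :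
    SolvesBoutroux φ (paramA m) := by
  obtain ⟨va, vb, ha, hb, h1, h2⟩ := h
  exact ⟨_, _, _, va, vb, hm.isRootNumbering, ha, hb, h1, h2⟩

theorem exp_neg_eq_conj (φ : ℝ) :
    exp (2 * I * ((-φ : ℝ) : ℂ)) = (starRingEnd ℂ) (exp (2 * I * φ)) := by
  rw [← exp_conj]
  simp [Complex.conj_ofNat]

theorem zetaFive_conj (m : ℂ) : zetaFive ((starRingEnd ℂ) m) = (starRingEnd ℂ) (zetaFive m) := by
  simp [zetaFive, Complex.conj_ofNat]

theorem zetaThree_conj (m : ℂ) : zetaThree ((starRingEnd ℂ) m) = (starRingEnd ℂ) (zetaThree m) := by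
  simp [zetaThree, Complex.conj_ofNat]

theorem zetaOne_conj (m : ℂ) : zetaOne ((starRingEnd ℂ) m) = (starRingEnd ℂ) (zetaOne m) := by
  simp [zetaOne, Complex.conj_ofNat]

theorem paramA_conj (m : ℂ) : paramA ((starRingEnd ℂ) m) = (starRingEnd ℂ) (paramA m) := by
  simp [paramA, Complex.conj_ofNat]

theorem paramX_conj (m : ℂ) : paramX ((starRingEnd ℂ) m) = (starRingEnd ℂ) (paramX m) := by
  simp [paramX, Complex.conj_ofNat]

theorem Admissible.conj {m : ℂ} (h : Admissible m) : Admissible ((starRingEnd ℂ) m) := by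
  refine ⟨fun h0 => h.ne_zero ?_, by simpa using h.re_nonneg, by simpa using h.disc⟩
  have := congrArg (starRingEnd ℂ) h0
  simpa [Complex.conj_ofNat] using this

theorem SolvesBoutrouxAt.conj {φ : ℝ} {m : ℂ} (h : SolvesBoutrouxAt φ m) :
    SolvesBoutrouxAt (-φ) ((starRingEnd ℂ) m) := by
  obtain ⟨va, vb, ha, hb, h1, h2⟩ := h
  refine ⟨fun t => (starRingEnd ℂ) (va t), fun t => (starRingEnd ℂ) (vb t), ?_, ?_, ?_, ?_⟩
  · rw [paramA_conj, zetaFive_conj, zetaThree_conj]; exact ha.conj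
  · rw [paramA_conj, zetaThree_conj, zetaOne_conj]; exact hb.conj
  · rw [zetaFive_conj, zetaThree_conj, exp_neg_eq_conj, cycleIntegral_conj, ← map_mul, conj_re, h1]
  · rw [zetaThree_conj, zetaOne_conj, exp_neg_eq_conj, cycleIntegral_conj, ← map_mul, conj_re, h2]

theorem HyperBoutroux.conj {φ : ℝ} {x : ℂ} (h0 : 0 ≤ x.re) (h1 : x.re ≤ 1)
    (h : HyperBoutroux φ x) : HyperBoutroux (-φ) ((starRingEnd ℂ) x) := by
  have e : (1 : ℂ) - (starRingEnd ℂ) x = (starRingEnd ℂ) (1 - x) := by simp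
  refine ⟨?_, ?_⟩
  · rw [exp_neg_eq_conj, hyperY_conj (Or.inr h1), ← map_mul, conj_im, h.1, neg_zero]
  · rw [exp_neg_eq_conj, e, hyperY_conj (Or.inr (by simpa using h0)), ← map_mul, conj_re, h.2]

/-! ### Localization of the solutions in a disc -/

/-- The disc `|x - 1/2| ≤ 1/2`. -/
def solutionDisc : Set ℂ := {x | normSq x ≤ x.re}

theorem re_mem_of_mem_solutionDisc {x : ℂ} (hx : x ∈ solutionDisc) : 0 ≤ x.re ∧ x.re ≤ 1 := by
  have hx' : normSq x ≤ x.re := hx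
  rw [normSq_apply] at hx'
  constructor <;> nlinarith [mul_self_nonneg x.re, mul_self_nonneg x.im]

theorem conj_mem_solutionDisc {x : ℂ} (hx : x ∈ solutionDisc) :
    (starRingEnd ℂ) x ∈ solutionDisc := by
  have hx' : normSq x ≤ x.re := hx
  simpa [solutionDisc] using hx'

theorem ofReal_mem_solutionDisc {x : ℝ} : (x : ℂ) ∈ solutionDisc ↔ 0 ≤ x ∧ x ≤ 1 := by
  constructor
  · intro h
    simpa using re_mem_of_mem_solutionDisc h
  · rintro ⟨h0, h1⟩
    change normSq (x : ℂ) ≤ (x : ℂ).re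
    rw [normSq_ofReal, ofReal_re]
    nlinarith

/-- Outside the disc, `hyperY x` and `hyperY (1 - x)` are never orthogonal. -/
theorem re_hyperY_mul_conj_neg {x : ℂ} (him : 0 < x.im) (hx : x.re < normSq x) :
    (hyperY (1 - x) * (starRingEnd ℂ) (hyperY x)).re < 0 := by
  set y : ℂ := (starRingEnd ℂ) (1 - x) with hy
  have hyim : 0 < y.im := by simpa [hy] using him
  have e1 : hyperPhi (1 - x) = (starRingEnd ℂ) (hyperPhi y) := by
    rw [← hyperPhi_conj (Or.inl (mem_slitDomain_of_im_ne hyim.ne')), hy, Complex.conj_conj]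
  have hy2 : y.re = 1 - x.re := by simp [hy]
  have a1 := re_hyperPhi_pos (mem_slitDomain_of_im_ne him.ne')
  have a2 := im_hyperPhi_pos him
  have a3 := im_hyperPhi_lt (mem_slitDomain_of_im_ne him.ne')
  have b1 := re_hyperPhi_pos (mem_slitDomain_of_im_ne hyim.ne')
  have b2 := im_hyperPhi_pos hyim
  have b3 := im_hyperPhi_lt (mem_slitDomain_of_im_ne hyim.ne')
  have s3 : √3 * √3 = 3 := Real.mul_self_sqrt (by norm_num)
  have s0 : 0 < √3 := by positivity
  -- At least one of x and y has real part at most 1, so one argument is below π/6 and the other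
  -- below π/3; the product of the two values of Φ has positive real part.
  have hprod : (hyperPhi x).im * (hyperPhi y).im < (hyperPhi x).re * (hyperPhi y).re := by
    have key : ∀ p q r s : ℝ, 0 < p → 0 < q → 0 < r → 0 < s → √3 * q < p → s < √3 * r →
        q * s < p * r := by
      intro p q r s hp hq hr hs h1 h2
      calc q * s < q * (√3 * r) := mul_lt_mul_of_pos_left h2 hq
        _ = √3 * q * r := by ring
        _ < p * r := mul_lt_mul_of_pos_right h1 hr
    rcases le_total x.re 1 with h | h
    · have := abs_im_hyperPhi_lt h
      rw [abs_of_pos a2] at this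
      exact key _ _ _ _ a1 a2 b1 b2 this b3
    · have := abs_im_hyperPhi_lt (z := y) (by rw [hy2]; linarith)
      rw [abs_of_pos b2] at this
      have := key _ _ _ _ b1 b2 a1 a2 this a3
      linarith
  have e2 : hyperY (1 - x) * (starRingEnd ℂ) (hyperY x) =
      ((1 - x) * (starRingEnd ℂ) x) * (starRingEnd ℂ) (hyperPhi y * hyperPhi x) := by
    rw [hyperY, hyperY, e1, map_mul, map_mul]; ring
  have k1 : ((1 - x) * (starRingEnd ℂ) x).re = x.re - normSq x := by
    simp [normSq_apply]; ring
  have k2 : ((1 - x) * (starRingEnd ℂ) x).im = -x.im := by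
    simp; ring
  rw [e2, mul_re, k1, k2, conj_re, conj_im, mul_re, mul_im]
  have p1 : 0 < (hyperPhi y).re * (hyperPhi x).re - (hyperPhi y).im * (hyperPhi x).im := by
    linarith
  have p2 : 0 < (hyperPhi y).re * (hyperPhi x).im + (hyperPhi y).im * (hyperPhi x).re := by
    positivity
  have q1 := mul_pos (sub_pos.2 hx) p1
  have q2 := mul_pos him p2
  nlinarith

theorem norm_exp_two_mul (φ : ℝ) : ‖exp (2 * I * φ)‖ = 1 := by
  rw [show 2 * I * (φ : ℂ) = ((2 * φ : ℝ) : ℂ) * I by push_cast; ring, norm_exp_ofReal_mul_I]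

theorem exp_two_ne_zero (φ : ℝ) : exp (2 * I * φ) ≠ 0 := exp_ne_zero _

theorem exp_two_not_both (φ : ℝ) (h1 : (exp (2 * I * φ)).im = 0) (h2 : (exp (2 * I * φ)).re = 0) :
    False := exp_two_ne_zero φ (Complex.ext h2 h1)

/-- The unimodular factor c cancels, leaving an imaginary number times the conjugate of a real one.
-/
theorem HyperBoutroux.re_mul_conj {φ : ℝ} {x : ℂ} (h : HyperBoutroux φ x) :
    (hyperY (1 - x) * (starRingEnd ℂ) (hyperY x)).re = 0 := by
  have e : hyperY (1 - x) * (starRingEnd ℂ) (hyperY x) =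
      (exp (2 * I * φ) * hyperY (1 - x)) * (starRingEnd ℂ) (exp (2 * I * φ) * hyperY x) := by
    have : exp (2 * I * φ) * (starRingEnd ℂ) (exp (2 * I * φ)) = 1 := by
      rw [mul_conj, normSq_eq_norm_sq, norm_exp_two_mul]; norm_num
    rw [map_mul]
    linear_combination (-(hyperY (1 - x) * (starRingEnd ℂ) (hyperY x))) * this
  rw [e, mul_re, conj_re, conj_im, h.1, h.2]
  simp

theorem im_mul_real (c : ℂ) (r : ℝ) : (c * r).im = c.im * r := by simp

theorem re_mul_real (c : ℂ) (r : ℝ) : (c * r).re = c.re * r := by simp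

theorem im_mul_mul_I (c z : ℂ) (r : ℝ) : (c * (r * I * z)).im = r * (c * z).re := by
  rw [show c * (r * I * z) = r * (I * (c * z)) by ring, im_ofReal_mul, I_mul_im]

/-- The equations on the periods, on the open sector. -/
theorem hyperBoutroux_iff {m : ℂ} (hm : m ∈ openSector) (φ : ℝ) :
    ((exp (2 * I * φ) * periodJOne m).im = 0 ∧ (exp (2 * I * φ) * periodJThree m).im = 0) ↔
      HyperBoutroux φ (paramX m) := by
  obtain ⟨α, β, μ, hα, hβ, -, h1, h3, -⟩ := exists_period_relations
  set c := exp (2 * I * φ)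
  have e1 : (c * periodJOne m).im = α * (c * hyperY (paramX m)).im := by
    rw [h1 m hm, mul_left_comm, im_ofReal_mul]
  have e3 : (c * periodJThree m).im = α * (c * hyperY (paramX m)).im +
      β * (c * hyperY (1 - paramX m)).re := by
    rw [h3 m hm, mul_add, add_im, mul_left_comm, im_ofReal_mul, im_mul_mul_I]
  rw [e1, e3]
  constructor
  · rintro ⟨h4, h5⟩
    have h6 : (c * hyperY (paramX m)).im = 0 := by simpa [hα] using h4
    rw [h6] at h5
    exact ⟨h6, by simpa [hβ] using h5⟩
  · rintro ⟨h4, h5⟩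
    rw [h4, h5]
    simp

theorem one_sub_ofReal (x : ℝ) : (1 : ℂ) - x = ((1 - x : ℝ) : ℂ) := by push_cast; rfl

theorem exists_hyperY_ofReal {x : ℝ} (hx : x ≤ 1) : ∃ r : ℝ, 0 < r ∧ hyperY x = ((x * r : ℝ) : ℂ) := by
  obtain ⟨r, h0, h⟩ := exists_hyperPhi_ofReal hx
  exact ⟨r, h0, by rw [hyperY, h]; push_cast; rfl⟩

/-- There are no solutions on the boundary of the parameter domain. -/
theorem boundary_false {m : ℂ} (hm : Admissible m) (hb : m.im < 0) {x : ℝ} (hx : paramX m = x)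
    (hx' : x < 0 ∨ 1 < x) {φ : ℝ} (h1 : (exp (2 * I * φ) * periodJOne m).im = 0)
    (h3 : (exp (2 * I * φ) * periodJThree m).im = 0) : False := by
  obtain ⟨α, β, μ, hα, hβ, -, r1, r3, -⟩ := exists_period_relations
  have hα' : (α : ℂ) ≠ 0 := ofReal_ne_zero.2 hα
  have hβc : (β : ℂ) ≠ 0 := ofReal_ne_zero.2 hβ
  have hβ' : (β : ℂ) * I ≠ 0 := mul_ne_zero (ofReal_ne_zero.2 hβ) I_ne_zero
  have hcl : m ∈ closedSector := ⟨hm, hb.le⟩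
  have hne : (𝓝[openSector] m).NeBot :=
    mem_closure_iff_nhdsWithin_neBot.1 (closedSector_subset_closure hcl)
  have t1 : Tendsto periodJOne (𝓝[openSector] m) (𝓝 (periodJOne m)) :=
    (continuousOn_periodJOne m hcl).mono openSector_subset_closedSector
  have t3 : Tendsto periodJThree (𝓝[openSector] m) (𝓝 (periodJThree m)) :=
    (continuousOn_periodJThree m hcl).mono openSector_subset_closedSector
  have tX : Tendsto paramX (𝓝[openSector] m) (𝓝 (x : ℂ)) := by
    rw [← hx]
    exact (differentiableAt_paramX hm.ne_zero).continuousAt.continuousWithinAt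
  have tX' : Tendsto (fun m => 1 - paramX m) (𝓝[openSector] m) (𝓝 (1 - (x : ℂ))) :=
    tendsto_const_nhds.sub tX
  set w := ∫ t in (0 : ℝ)..1, weightPhi t with hw
  have hw0 : 0 < w := integral_weightPhi_pos
  -- a limit of `hyperPhi` has positive real part
  have hpos : ∀ {g : ℂ → ℂ} {y L : ℂ}, Tendsto g (𝓝[openSector] m) (𝓝 y) →
      (∀ m ∈ openSector, g m ∈ slitDomain) →
      Tendsto (fun m => hyperPhi (g m)) (𝓝[openSector] m) (𝓝 L) → 0 < L.re := by
    intro g y L hg hgs hL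
    have hlim : Tendsto (fun m => (1 + ‖g m‖) ^ (-1 / 3 : ℝ) / 2 * w) (𝓝[openSector] m)
        (𝓝 ((1 + ‖y‖) ^ (-1 / 3 : ℝ) / 2 * w)) := by
      refine Tendsto.mul_const _ (Tendsto.div_const ?_ _)
      refine Tendsto.rpow_const (tendsto_const_nhds.add hg.norm) (Or.inl ?_)
      positivity
    refine lt_of_lt_of_le (b := (1 + ‖y‖) ^ (-1 / 3 : ℝ) / 2 * w) (by positivity)
      (le_of_tendsto_of_tendsto hlim ((continuous_re.tendsto _).comp hL) ?_)
    filter_upwards [self_mem_nhdsWithin] with m' hm' using le_re_hyperPhi (hgs m' hm')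
  have hs0 : ∀ m ∈ openSector, paramX m ∈ slitDomain := fun m hm =>
    mem_slitDomain_of_im_ne (im_paramX_pos hm).ne'
  have hs1 : ∀ m ∈ openSector, 1 - paramX m ∈ slitDomain := fun m hm =>
    mem_slitDomain_of_im_ne (by simpa using (im_paramX_pos hm).ne')
  have hx0 : (x : ℂ) ≠ 0 := by
    rw [ofReal_ne_zero]; rcases hx' with h | h <;> intro h0 <;> linarith
  have hx1 : (1 : ℂ) - x ≠ 0 := by
    rw [one_sub_ofReal, ofReal_ne_zero]; rcases hx' with h | h <;> intro h0 <;> linarith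
  set c := exp (2 * I * φ) with hc
  -- limits of both hypergeometric functions
  have l0 : Tendsto (fun m => hyperPhi (paramX m)) (𝓝[openSector] m)
      (𝓝 (periodJOne m / α / x)) := by
    refine ((t1.div_const (α : ℂ)).div tX hx0).congr' ?_
    filter_upwards [self_mem_nhdsWithin] with m' hm'
    have : paramX m' ≠ 0 := fun h0 => (im_paramX_pos hm').ne' (by rw [h0]; simp)
    simp only [Pi.div_apply]
    rw [r1 m' hm', hyperY]
    field_simp
  have l1 : Tendsto (fun m => hyperPhi (1 - paramX m)) (𝓝[openSector] m)
      (𝓝 ((periodJThree m - periodJOne m) / (β * I) / (1 - x))) := by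
    refine (((t3.sub t1).div_const (β * I : ℂ)).div tX' hx1).congr' ?_
    filter_upwards [self_mem_nhdsWithin] with m' hm'
    have : 1 - paramX m' ≠ 0 := fun h0 => (im_paramX_pos hm').ne' (by
      have := congrArg im h0; simpa using this)
    simp only [Pi.div_apply]
    rw [r1 m' hm', r3 m' hm', hyperY, hyperY]
    field_simp
    ring
  have p0 := hpos tX hs0 l0
  have p1 := hpos tX' hs1 l1
  set L0 := periodJOne m / α / x with hL0
  set L1 := (periodJThree m - periodJOne m) / (β * I) / (1 - x) with hL1
  have j1 : periodJOne m = ((α * x : ℝ) : ℂ) * L0 := by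
    rw [hL0]; push_cast; field_simp
  have j3 : periodJThree m = periodJOne m + ((β * (1 - x) : ℝ) : ℂ) * (I * L1) := by
    rw [hL1]; push_cast; field_simp; ring
  have hi1 : (c * L0).im = 0 := by
    rw [j1, mul_left_comm, im_ofReal_mul] at h1
    have : α * x ≠ 0 := mul_ne_zero hα (by exact_mod_cast hx0)
    simpa [this] using h1
  have hi3 : (c * L1).re = 0 := by
    rw [j3, mul_add, add_im, h1, zero_add, mul_left_comm, im_ofReal_mul, mul_left_comm,
      I_mul_im] at h3
    have : β * (1 - x) ≠ 0 := mul_ne_zero hβ (by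
      rw [one_sub_ofReal, ofReal_ne_zero] at hx1; exact hx1)
    simpa only [mul_eq_zero, this, false_or] using h3
  have hreal : ∀ {y : ℝ}, y < 1 → ∀ {g : ℂ → ℂ} {L : ℂ}, Tendsto g (𝓝[openSector] m) (𝓝 (y : ℂ)) →
      Tendsto (fun m => hyperPhi (g m)) (𝓝[openSector] m) (𝓝 L) → ∃ r : ℝ, 0 < r ∧ L = r := by
    intro y hy g L hg hL
    obtain ⟨r, hr, hr'⟩ := exists_hyperPhi_ofReal hy.le
    refine ⟨r, hr, ?_⟩
    rw [← hr']
    have hd : ContinuousAt hyperPhi (y : ℂ) :=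
      (hasDerivAt_hyperPhi (mem_slitDomain_of_re_lt (by simpa using hy))).continuousAt
    exact tendsto_nhds_unique hL (hd.tendsto.comp hg)
  -- Exactly one of x, 1-x is below 1, and there the limit of Φ is a positive real; the equation for
  -- it fixes c as real (x < 0) or imaginary (x > 1). The other limit has positive real part, so its
  -- equation forces the remaining component of c to vanish.
  rcases hx' with hx' | hx'
  · obtain ⟨r, hr, e⟩ := hreal (by linarith) tX l0
    rw [e, im_mul_real] at hi1
    have hci : c.im = 0 := by simpa [hr.ne'] using hi1
    rw [mul_re, hci, zero_mul, sub_zero] at hi3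
    have hcr : c.re = 0 := by simpa [p1.ne'] using hi3
    exact exp_two_not_both φ hci hcr
  · obtain ⟨r, hr, e⟩ := hreal (y := 1 - x) (by linarith) (by rwa [one_sub_ofReal] at tX') l1
    rw [e, re_mul_real] at hi3
    have hcr : c.re = 0 := by simpa [hr.ne'] using hi3
    rw [mul_im, hcr, zero_mul, zero_add] at hi1
    have hci : c.im = 0 := by simpa [p0.ne'] using hi1
    exact exp_two_not_both φ hci hcr

/-- Y(x) and Y(1-x) are both positive, so c would have to be real and imaginary at once. -/
theorem hyperBoutroux_ofReal_false {x φ : ℝ} (h0 : 0 < x) (h1 : x < 1) (h : HyperBoutroux φ x) :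
    False := by
  obtain ⟨r, hr, e⟩ := exists_hyperY_ofReal h1.le
  obtain ⟨s, hs, e'⟩ := exists_hyperY_ofReal (x := 1 - x) (by linarith)
  obtain ⟨h2, h3⟩ := h
  rw [e, im_mul_real] at h2
  rw [one_sub_ofReal, e', re_mul_real] at h3
  exact exp_two_not_both φ (by simpa [hr.ne', h0.ne'] using h2)
    (by simpa [hs.ne', sub_ne_zero.2 h1.ne'] using h3)

theorem hyperBoutroux_one_iff {φ : ℝ} : HyperBoutroux φ 1 ↔ (exp (2 * I * φ)).im = 0 := by
  obtain ⟨r, hr, e⟩ := exists_hyperY_one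
  rw [HyperBoutroux, sub_self, hyperY_zero, e, im_mul_real]
  simp [hr.ne']

theorem hyperBoutroux_zero_iff {φ : ℝ} : HyperBoutroux φ 0 ↔ (exp (2 * I * φ)).re = 0 := by
  obtain ⟨r, hr, e⟩ := exists_hyperY_one
  rw [HyperBoutroux, sub_zero, hyperY_zero, e, re_mul_real]
  simp [hr.ne']

theorem re_mul_I_mul_real (c : ℂ) (r : ℝ) : (c * (I * r)).re = -(c.im * r) := by simp

theorem SolvesBoutrouxAt.hyper_ofReal {φ a : ℝ} (ha : a ∈ Icc (0 : ℝ) 1)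
    (h : SolvesBoutrouxAt φ a) : paramX a ∈ solutionDisc ∧ HyperBoutroux φ (paramX a) := by
  obtain ⟨va, vb, hva, hvb, h1, h2⟩ := h
  have hci : a < 1 → (exp (2 * I * φ)).im = 0 := by
    intro ha1
    obtain ⟨r, hr, e⟩ := cycleIntegral_a_ofReal ha ha1 hva
    rw [e, re_mul_I_mul_real] at h1
    simpa [hr] using h1
  have hcr : 0 < a → (exp (2 * I * φ)).re = 0 := by
    intro ha0
    obtain ⟨r, hr, e⟩ := cycleIntegral_b_ofReal ha ha0 hvb
    rw [e, re_mul_real] at h2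
    simpa [hr] using h2
  have x0 : paramX ((0 : ℝ) : ℂ) = 1 := by norm_num [paramX]
  have x1 : paramX ((1 : ℝ) : ℂ) = 0 := by norm_num [paramX]
  rcases eq_endpoints_or_mem_Ioo_of_mem_Icc ha with rfl | rfl | ha'
  · rw [x0]
    exact ⟨by simp [solutionDisc], hyperBoutroux_one_iff.2 (hci zero_lt_one)⟩
  · rw [x1]
    exact ⟨by simp [solutionDisc], hyperBoutroux_zero_iff.2 (hcr zero_lt_one)⟩
  · exact (exp_two_not_both φ (hci ha'.2) (hcr ha'.1)).elim

theorem SolvesBoutrouxAt.hyper_of_im_nonpos {φ : ℝ} {m : ℂ} (hm : Admissible m) (him : m.im ≤ 0)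
    (h : SolvesBoutrouxAt φ m) : paramX m ∈ solutionDisc ∧ HyperBoutroux φ (paramX m) := by
  rcases eq_or_lt_of_le him with hb | hb
  · obtain ⟨a, rfl⟩ : ∃ a : ℝ, m = a := ⟨m.re, Complex.ext rfl (by simpa using hb)⟩
    exact h.hyper_ofReal ⟨by simpa using hm.re_nonneg, by simpa using hm.re_le_one⟩
  · obtain ⟨va, vb, hva, hvb, h12⟩ := h
    rw [boutroux_cycles_iff hm hb _ hva hvb] at h12
    rcases hm.mem_openSector_or hb with hs | hs | hs
    · rw [hyperBoutroux_iff hs] at h12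
      refine ⟨?_, h12⟩
      by_contra hd
      have := re_hyperY_mul_conj_neg (im_paramX_pos hs) (not_le.1 hd)
      rw [h12.re_mul_conj] at this
      exact lt_irrefl _ this
    · obtain ⟨x, hx, hx1⟩ := hm.paramX_of_re_eq_zero hs hb
      exact (boundary_false hm hb hx (Or.inr hx1) h12.1 h12.2).elim
    · obtain ⟨x, hx, hx0⟩ := hm.paramX_of_disc_eq_zero hs hb
      exact (boundary_false hm hb hx (Or.inl hx0) h12.1 h12.2).elim

/-- Points of the disc never have parameters on the unit circle, where the segment `[ζ₃, ζ₁]`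
passes through the branch point `0`. -/
theorem normSq_ne_one_of_mem {m : ℂ} (hm : Admissible m) (hb : m.im < 0)
    (hx : paramX m ∈ solutionDisc) : normSq m ≠ 1 := by
  intro hR
  have hR' := hR
  rw [normSq_apply] at hR'
  have hm0 : m ≠ 0 := by rintro rfl; simp at hb
  have hmc : m * (starRingEnd ℂ) m = 1 := by rw [mul_conj, hR]; norm_num
  set d : ℂ := (2 * m.re - m.im * I) ^ 3 with hd
  have hre : d.re = 8 * m.re ^ 3 - 6 * m.re * m.im ^ 2 := by
    rw [hd]; simp [pow_succ]; ring
  have him : d.im = -12 * m.re ^ 2 * m.im + m.im ^ 3 := by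
    rw [hd]; simp [pow_succ]; ring
  -- On |m| = 1 one can write 1 = m·conj m, which reduces both 3 + m² and m² - 1 to m times a linear
  -- expression in Re m and Im m.
  have hw : 3 + m ^ 2 = 2 * m * (2 * m.re - m.im * I) := by
    apply Complex.ext
    · rw [re_sq_param]; simp; nlinarith
    · rw [im_sq_param]; simp; ring
  have hd0 : d ≠ 0 := by
    refine pow_ne_zero 3 fun h => hm.ne_zero ?_
    rw [hw, h, mul_zero]
  have hm2 : m ^ 2 - 1 = 2 * m.im * I * m := by
    apply Complex.ext
    · simp [pow_two]; nlinarith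
    · simp [pow_two]; ring
  have hxe : paramX m = -(27 / 2) * m.im ^ 2 * (starRingEnd ℂ) m / d := by
    rw [paramX, hw, hm2, mul_pow (2 * m), ← hd, div_eq_div_iff (mul_ne_zero (pow_ne_zero 3
      (mul_ne_zero two_ne_zero hm0)) hd0) hd0]
    have hI : I ^ 2 = -1 := I_sq
    linear_combination (108 * (m.im : ℂ) ^ 2 * m ^ 2 * d) * hI + 108 * (m.im : ℂ) ^ 2 * m ^ 2 * d * hmc
  have hN : 0 < normSq d := Complex.normSq_pos.2 hd0
  have hx' : normSq (paramX m) ≤ (paramX m).re := hx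
  rw [hxe, normSq_div, div_re, ← add_div, div_le_div_iff_of_pos_right hN, hre, him] at hx'
  have n1 : (-(27 / 2) * (m.im : ℂ) ^ 2 * (starRingEnd ℂ) m) =
      ((-(27 / 2) * m.im ^ 2 : ℝ) : ℂ) * (starRingEnd ℂ) m := by push_cast; ring
  rw [n1, normSq_mul, normSq_conj, hR, normSq_ofReal, re_ofReal_mul, im_ofReal_mul, conj_re,
    conj_im] at hx'
  have hb2 : 0 < m.im ^ 2 := sq_pos_of_neg hb
  have hb1 : m.im ^ 2 ≤ 1 := by nlinarith [mul_self_nonneg m.re]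
  have : 0 < (27 / 2 * m.im ^ 2) *
      (27 / 2 * m.im ^ 2 + 8 * m.re ^ 4 + 6 * m.re ^ 2 * m.im ^ 2 - m.im ^ 4) := by
    refine mul_pos (by positivity) ?_
    nlinarith [pow_nonneg (sq_nonneg m.re) 2, mul_nonneg (sq_nonneg m.re) hb2.le]
  nlinarith

/-- Here the cycles must also be exhibited. Membership in the disc excludes |m| = 1, where no
b-cycle is constructed, and also the edges, whose x lies outside [0, 1]; at m = 0 and m = 1 one
cycle is a point and gives no condition. -/
theorem solvesBoutrouxAt_of_hyper {φ : ℝ} {m : ℂ} (hm : Admissible m) (him : m.im ≤ 0)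
    (hx : paramX m ∈ solutionDisc) (h : HyperBoutroux φ (paramX m)) : SolvesBoutrouxAt φ m := by
  rcases eq_or_lt_of_le him with hb | hb
  · obtain ⟨a, rfl⟩ : ∃ a : ℝ, m = a := ⟨m.re, Complex.ext rfl (by simpa using hb)⟩
    have ha : a ∈ Icc (0 : ℝ) 1 := ⟨by simpa using hm.re_nonneg, by simpa using hm.re_le_one⟩
    rcases eq_endpoints_or_mem_Ioo_of_mem_Icc ha with rfl | rfl | ha'
    · rw [ofReal_zero] at *
      have x0 : paramX 0 = 1 := by norm_num [paramX]
      rw [x0, hyperBoutroux_one_iff] at h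
      have e31 : zetaOne 0 = zetaThree 0 := by norm_num [zetaOne, zetaThree]
      obtain ⟨va, hva⟩ := exists_isCycleOver_a_zero
      have hq : quartic (paramA 0) (zetaThree 0) = 0 := by
        rw [hm.isRootNumbering.quartic_eq, e31]; ring
      obtain ⟨vb, hvb⟩ := exists_isCycleOver_self hq
      refine ⟨va, vb, hva, by rwa [e31], ?_, by rw [e31, cycleIntegral_self]; simp⟩
      have hva' : IsCycleOver (paramA ((0 : ℝ) : ℂ)) (zetaFive ((0 : ℝ) : ℂ))
        (zetaThree ((0 : ℝ) : ℂ)) va := by simpa using hva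
      obtain ⟨r, hr, e⟩ := cycleIntegral_a_ofReal ha zero_lt_one hva'
      rw [ofReal_zero] at e
      rw [e, re_mul_I_mul_real, h]
      simp
    · rw [ofReal_one] at *
      have x1 : paramX 1 = 0 := by norm_num [paramX]
      rw [x1, hyperBoutroux_zero_iff] at h
      have e35 : zetaFive 1 = zetaThree 1 := by norm_num [zetaFive, zetaThree]
      obtain ⟨vb, hvb⟩ := exists_isCycleOver_b_one
      have hq : quartic (paramA 1) (zetaThree 1) = 0 := by
        rw [hm.isRootNumbering.quartic_eq]; ring
      obtain ⟨va, hva⟩ := exists_isCycleOver_self hq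
      refine ⟨va, vb, by rwa [e35], hvb, by rw [e35, cycleIntegral_self]; simp, ?_⟩
      have hvb' : IsCycleOver (paramA ((1 : ℝ) : ℂ)) (zetaThree ((1 : ℝ) : ℂ))
        (zetaOne ((1 : ℝ) : ℂ)) vb := by simpa using hvb
      obtain ⟨r, hr, e⟩ := cycleIntegral_b_ofReal ha zero_lt_one hvb'
      rw [ofReal_one] at e
      rw [e, re_mul_real, h]
      simp
    · exfalso
      obtain ⟨h0, h1⟩ := paramX_ofReal_mem_Ioo ha'
      rw [paramX_ofReal] at h h0 h1
      exact hyperBoutroux_ofReal_false (by simpa only [ofReal_re] using h0)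
        (by simpa only [ofReal_re] using h1) h
  · rcases hm.mem_openSector_or hb with hs | hs | hs
    · obtain ⟨va, hva⟩ := exists_isCycleOver_a hm hb
      obtain ⟨vb, hvb⟩ := exists_isCycleOver_b hm hb (normSq_ne_one_of_mem hm hb hx)
      exact ⟨va, vb, hva, hvb, (boutroux_cycles_iff hm hb _ hva hvb).2
        ((hyperBoutroux_iff hs φ).2 h)⟩
    · obtain ⟨x, hx1, hx2⟩ := hm.paramX_of_re_eq_zero hs hb
      rw [hx1, ofReal_mem_solutionDisc] at hx
      linarith
    · obtain ⟨x, hx1, hx2⟩ := hm.paramX_of_disc_eq_zero hs hb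
      rw [hx1, ofReal_mem_solutionDisc] at hx
      linarith

/-- The Boutroux equations are equivalent to two equations between hypergeometric functions. -/
theorem solvesBoutroux_iff {φ : ℝ} {x : ℂ} :
    SolvesBoutroux φ (8 / 27 * x) ↔ x ∈ solutionDisc ∧ HyperBoutroux φ x := by
  have hinj : ∀ {m : ℂ}, 8 / 27 * x = paramA m → x = paramX m := fun {m} h => by
    rw [paramA_eq] at h
    linear_combination 27 / 8 * h
  constructor
  · intro h
    obtain ⟨m, hm, hA, hs⟩ := h.exists_at
    rw [hinj hA]
    rcases le_total m.im 0 with him | him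
    · exact hs.hyper_of_im_nonpos hm him
    · obtain ⟨h1, h2⟩ := hs.conj.hyper_of_im_nonpos hm.conj (by simpa using him)
      have hr := re_mem_of_mem_solutionDisc h1
      have h3 := h2.conj hr.1 hr.2
      rw [paramX_conj] at h1 h3
      rw [neg_neg, Complex.conj_conj] at h3
      have h4 := conj_mem_solutionDisc h1
      rw [Complex.conj_conj] at h4
      exact ⟨h4, h3⟩
  · rintro ⟨hx, h⟩
    obtain ⟨m, hm, hA⟩ := exists_admissible (8 / 27 * x)
    rw [hA]
    refine SolvesBoutrouxAt.solves hm ?_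
    rw [hinj hA] at hx h
    rcases le_total m.im 0 with him | him
    · exact solvesBoutrouxAt_of_hyper hm him hx h
    · have hr := re_mem_of_mem_solutionDisc hx
      have := (solvesBoutrouxAt_of_hyper (φ := -φ) hm.conj (by simpa using him)
        (by rw [paramX_conj]; exact conj_mem_solutionDisc hx)
        (by rw [paramX_conj]; exact h.conj hr.1 hr.2)).conj
      rwa [neg_neg, Complex.conj_conj] at this

/-! ### Uniqueness -/

/-- Difference quotients of `hyperY` lie in the sector `|arg z| < π / 6`. -/
theorem abs_im_slope_hyperY_lt {x δ : ℂ} (hδ : δ ≠ 0) (h0 : x.re ≤ 1) (h1 : (x + δ).re ≤ 1)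
    (h : x.re < 1 ∨ (x + δ).re < 1) :
    √3 * |((hyperY (x + δ) - hyperY x) / δ).im| < ((hyperY (x + δ) - hyperY x) / δ).re := by
  rw [add_re] at h1 h
  have key : ∀ s : ℝ, (s = √3 ∨ s = -√3) →
      s * ((hyperY (x + δ) - hyperY x) / δ).im < ((hyperY (x + δ) - hyperY x) / δ).re := by
    intro s hs
    -- This linear functional of Y/δ increases along the segment because F lies in the sector.
    -- Taking s = √3 and s = -√3 gives both sides of the bound on the difference quotient.
    set u : ℝ → ℝ := fun t => (hyperY (x + t * δ) / δ).re - s * (hyperY (x + t * δ) / δ).im with hu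
    have hmem : ∀ t ∈ Icc (0 : ℝ) 1, (x + t * δ).re ≤ 1 := by
      intro t ht
      rw [add_re, re_ofReal_mul]
      nlinarith [ht.1, ht.2]
    have hmem' : ∀ t ∈ Ioo (0 : ℝ) 1, (x + t * δ).re < 1 := by
      intro t ht
      rw [add_re, re_ofReal_mul]
      rcases h with h | h <;> nlinarith [ht.1, ht.2]
    have hc : ContinuousOn (fun t : ℝ => hyperY (x + t * δ) / δ) (Icc 0 1) :=
      (continuousOn_hyperY.comp (by fun_prop) hmem).div_const δ
    have hcu : ContinuousOn u (Icc 0 1) :=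
      (continuous_re.comp_continuousOn hc).sub ((continuous_im.comp_continuousOn hc).const_smul s)
    have hd : ∀ t ∈ Ioo (0 : ℝ) 1,
        HasDerivAt (fun t : ℝ => hyperY (x + t * δ) / δ) (hyperF (x + t * δ)) t := by
      intro t ht
      have e : HasDerivAt (fun t : ℝ => x + t * δ) δ t := by
        simpa using ((hasDerivAt_id' t).ofReal_comp.mul_const δ).const_add x
      refine ((HasDerivAt.comp t (hasDerivAt_hyperY (mem_slitDomain_of_re_lt (hmem' t ht)))
        e).div_const δ).congr_deriv ?_
      field_simp
    have hmono : StrictMonoOn u (Icc 0 1) := by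
      refine strictMonoOn_of_deriv_pos (convex_Icc 0 1) hcu ?_
      rw [interior_Icc]
      intro t ht
      have hr : HasDerivAt u ((hyperF (x + t * δ)).re - s * (hyperF (x + t * δ)).im) t :=
        (reCLM.hasFDerivAt.comp_hasDerivAt t (hd t ht)).sub
          ((imCLM.hasFDerivAt.comp_hasDerivAt t (hd t ht)).const_mul s)
      rw [hr.deriv, sub_pos]
      refine lt_of_le_of_lt ?_ (abs_im_hyperF_lt (hmem' t ht))
      rcases hs with rfl | rfl
      · exact mul_le_mul_of_nonneg_left (le_abs_self _) (by positivity)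
      · rw [neg_mul, ← mul_neg]
        exact mul_le_mul_of_nonneg_left (neg_le_abs _) (by positivity)
    have := hmono (left_mem_Icc.2 zero_le_one) (right_mem_Icc.2 zero_le_one) zero_lt_one
    simp only [hu, ofReal_zero, zero_mul, add_zero, ofReal_one, one_mul] at this
    rw [sub_div, sub_re, sub_im]
    linarith
  rcases abs_choice ((hyperY (x + δ) - hyperY x) / δ).im with e | e
  · rw [e]; exact key _ (Or.inl rfl)
  · rw [e, mul_neg, ← neg_mul]; exact key _ (Or.inr rfl)

/-- If `w P` is real and `w Q` is imaginary with `P`, `Q` in the sector `|arg z| < π / 6`,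
then `w = 0`. -/
theorem eq_zero_of_sector {w P Q : ℂ} (hP : √3 * |P.im| < P.re) (hQ : √3 * |Q.im| < Q.re)
    (h1 : (w * P).im = 0) (h2 : (w * Q).re = 0) : w = 0 := by
  have e : ((w * Q) * (starRingEnd ℂ) (w * P)).re = normSq w * (Q * (starRingEnd ℂ) P).re := by
    rw [← re_ofReal_mul, ← mul_conj, map_mul]
    congr 1
    ring
  rw [mul_re (w * Q), conj_re, conj_im, h1, h2, mul_re Q, conj_re, conj_im] at e
  have s1 : 1 ≤ √3 := by rw [Real.one_le_sqrt]; norm_num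
  have p1 : |P.im| < P.re := lt_of_le_of_lt (le_mul_of_one_le_left (abs_nonneg _) s1) hP
  have q1 : |Q.im| < Q.re := lt_of_le_of_lt (le_mul_of_one_le_left (abs_nonneg _) s1) hQ
  have pq : |Q.im * P.im| < Q.re * P.re := by
    rw [abs_mul]
    exact mul_lt_mul'' q1 p1 (abs_nonneg _) (abs_nonneg _)
  have pos : 0 < Q.re * P.re - Q.im * -P.im := by
    have := neg_abs_le (Q.im * P.im)
    linarith
  have : normSq w = 0 := by
    have : normSq w * (Q.re * P.re - Q.im * -P.im) = 0 := by linarith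
    exact (mul_eq_zero.1 this).resolve_right pos.ne'
  exact normSq_eq_zero.1 this

theorem eq_one_of_mem_solutionDisc {x : ℂ} (hx : x ∈ solutionDisc) (h : x.re = 1) : x = 1 := by
  have hx' : normSq x ≤ x.re := hx
  rw [normSq_apply, h] at hx'
  have : x.im = 0 := by nlinarith [mul_self_nonneg x.im]
  exact Complex.ext h this

theorem eq_zero_of_mem_solutionDisc {x : ℂ} (hx : x ∈ solutionDisc) (h : x.re = 0) : x = 0 := by
  have hx' : normSq x ≤ x.re := hx
  rw [normSq_apply, h] at hx'
  have : x.im = 0 := by nlinarith [mul_self_nonneg x.im]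
  exact Complex.ext h this

/-- For two solutions differing by δ, the equations subtract to: cδ times the slope of Y is real,
and cδ times the slope of Y taken at the reflected points is imaginary. Both slopes lie in the
narrow sector, so cδ = 0. -/
theorem HyperBoutroux.unique {φ : ℝ} {x y : ℂ} (hx : x ∈ solutionDisc) (hy : y ∈ solutionDisc)
    (h : HyperBoutroux φ x) (h' : HyperBoutroux φ y) : y = x := by
  by_contra hne
  obtain ⟨δ, rfl⟩ : ∃ δ, y = x + δ := ⟨y - x, by ring⟩
  have hδ : δ ≠ 0 := fun h0 => hne (by rw [h0, add_zero])
  have hxr := re_mem_of_mem_solutionDisc hx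
  have hyr := re_mem_of_mem_solutionDisc hy
  -- The slope bound needs one point with real part below 1; the disc touches the line Re x = 1 only
  -- at 1, so two distinct points suffice. The line Re x = 0 is handled likewise for the reflected
  -- slope.
  have hP := abs_im_slope_hyperY_lt hδ hxr.2 hyr.2 (by
    by_contra! hcon
    exact hne ((eq_one_of_mem_solutionDisc hy (le_antisymm hyr.2 hcon.2)).trans
      (eq_one_of_mem_solutionDisc hx (le_antisymm hxr.2 hcon.1)).symm))
  have e1 : 1 - (x + δ) + δ = 1 - x := by ring
  have hQ := abs_im_slope_hyperY_lt (x := 1 - (x + δ)) hδ (by simpa using hyr.1)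
    (by rw [e1]; simpa using hxr.1) (by
    rw [e1]
    by_contra! hcon
    have c1 : (x + δ).re ≤ 0 := by simpa using hcon.1
    have c2 : x.re ≤ 0 := by simpa using hcon.2
    exact hne ((eq_zero_of_mem_solutionDisc hy (le_antisymm c1 hyr.1)).trans
      (eq_zero_of_mem_solutionDisc hx (le_antisymm c2 hxr.1)).symm))
  rw [e1] at hQ
  have := eq_zero_of_sector (w := exp (2 * I * φ) * δ) hP hQ
    (by rw [mul_assoc, mul_div_cancel₀ _ hδ, mul_sub, sub_im, h.1, h'.1, sub_zero])
    (by rw [mul_assoc, mul_div_cancel₀ _ hδ, mul_sub, sub_re, h.2, h'.2, sub_zero])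
  exact mul_ne_zero (exp_two_ne_zero φ) hδ this

/-! ### Local solutions -/

theorem contDiffAt_hyperY {x : ℂ} (hx : x ∈ slitDomain) {n : WithTop ℕ∞} :
    ContDiffAt ℝ n hyperY x := by
  have hd : DifferentiableOn ℂ hyperY slitDomain := fun z hz =>
    (hasDerivAt_hyperY hz).differentiableAt.differentiableWithinAt
  exact (hd.analyticAt (isOpen_slitDomain.mem_nhds hx)).contDiffAt.restrict_scalars ℝ

/-- Both Boutroux equations as one complex equation. -/
noncomputable def boutrouxMap (p : ℝ × ℂ) : ℂ :=
  ((exp (2 * I * p.1) * hyperY p.2).im : ℂ) + ((exp (2 * I * p.1) * hyperY (1 - p.2)).re : ℂ) * I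

theorem boutrouxMap_eq_zero_iff {φ : ℝ} {x : ℂ} : boutrouxMap (φ, x) = 0 ↔ HyperBoutroux φ x := by
  rw [Complex.ext_iff, HyperBoutroux]
  simp [boutrouxMap]

theorem contDiffAt_boutrouxMap {p : ℝ × ℂ} (h : p.2 ∈ twoSlitDomain) {n : WithTop ℕ∞} :
    ContDiffAt ℝ n boutrouxMap p := by
  have hc : ContDiffAt ℝ n (fun p : ℝ × ℂ => exp (2 * I * p.1)) p :=
    (contDiffAt_const.mul (ofRealCLM.contDiff.comp contDiff_fst).contDiffAt).cexp
  have h1 : ContDiffAt ℝ n (fun p : ℝ × ℂ => hyperY p.2) p :=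
    (contDiffAt_hyperY h.1).comp p contDiffAt_snd
  have h2 : ContDiffAt ℝ n (fun p : ℝ × ℂ => hyperY (1 - p.2)) p :=
    ContDiffAt.comp p (g := hyperY) (f := fun p : ℝ × ℂ => 1 - p.2) (contDiffAt_hyperY h.2)
      (contDiffAt_const.sub contDiffAt_snd)
  have h3 : ContDiffAt ℝ n (fun p : ℝ × ℂ => ((exp (2 * I * p.1) * hyperY p.2).im : ℂ)) p :=
    (ofRealCLM.comp imCLM).contDiff.contDiffAt.comp p (hc.mul h1)
  have h4 : ContDiffAt ℝ n (fun p : ℝ × ℂ => ((exp (2 * I * p.1) * hyperY (1 - p.2)).re : ℂ)) p :=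
    (ofRealCLM.comp reCLM).contDiff.contDiffAt.comp p (hc.mul h2)
  exact h3.add (h4.mul contDiffAt_const)

theorem fderiv_boutrouxMap_inr {φ : ℝ} {x : ℂ} (hx : x ∈ twoSlitDomain) (w : ℂ) :
    fderiv ℝ boutrouxMap (φ, x) (0, w) = ((exp (2 * I * φ) * w * hyperF x).im : ℂ) +
      (-(exp (2 * I * φ) * w * hyperF (1 - x)).re : ℂ) * I := by
  set c := exp (2 * I * φ) with hc
  have hl : HasDerivAt (fun t : ℝ => x + t * w) w 0 := by
    simpa using ((hasDerivAt_id' (0 : ℝ)).ofReal_comp.mul_const w).const_add x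
  have hp : HasDerivAt (fun t : ℝ => ((φ, x + t * w) : ℝ × ℂ)) (0, w) 0 :=
    (hasDerivAt_const _ _).prodMk hl
  have hf : HasFDerivAt boutrouxMap (fderiv ℝ boutrouxMap (φ, x)) (φ, x + ((0 : ℝ) : ℂ) * w) := by
    rw [ofReal_zero, zero_mul, add_zero]
    exact ((contDiffAt_boutrouxMap (p := (φ, x)) hx (n := 1)).differentiableAt
      one_ne_zero).hasFDerivAt
  have h1 := hf.comp_hasDerivAt (0 : ℝ) hp
  have hY : HasDerivAt (fun t : ℝ => c * hyperY (x + t * w)) (c * (hyperF x * w)) 0 :=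
    (HasDerivAt.comp_of_eq (0 : ℝ) (hasDerivAt_hyperY hx.1) hl (by simp)).const_mul c
  have hY' : HasDerivAt (fun t : ℝ => c * hyperY (1 - (x + t * w))) (c * (-hyperF (1 - x) * w)) 0 :=
    (HasDerivAt.comp_of_eq (0 : ℝ) (hasDerivAt_hyperY_one_sub hx.2) hl (by simp)).const_mul c
  have h2 := ((ofRealCLM.comp imCLM).hasFDerivAt.comp_hasDerivAt (0 : ℝ) hY).add
    (((ofRealCLM.comp reCLM).hasFDerivAt.comp_hasDerivAt (0 : ℝ) hY').mul_const I)
  refine (h1.unique h2).trans ?_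
  simp only [ContinuousLinearMap.comp_apply, ofRealCLM_apply, imCLM_apply, reCLM_apply]
  rw [show c * (hyperF x * w) = c * w * hyperF x by ring,
    show c * (-hyperF (1 - x) * w) = -(c * w * hyperF (1 - x)) by ring, neg_re, ofReal_neg]

/-- The infinitesimal form of uniqueness: a kernel vector w makes cwF(x) real and cwF(1-x)
imaginary, so the sector bound on F gives w = 0. Injectivity suffices in finite dimension. -/
theorem isInvertible_fderiv_boutrouxMap {φ : ℝ} {x : ℂ} (h0 : 0 < x.re) (h1 : x.re < 1) :
    (fderiv ℝ boutrouxMap (φ, x) ∘L .inr ℝ ℝ ℂ).IsInvertible := by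
  set L := fderiv ℝ boutrouxMap (φ, x) ∘L .inr ℝ ℝ ℂ with hL
  have hinj : Function.Injective L.toLinearMap := by
    rw [← LinearMap.ker_eq_bot, LinearMap.ker_eq_bot']
    intro w hw
    have hw' : fderiv ℝ boutrouxMap (φ, x) (0, w) = 0 := hw
    rw [fderiv_boutrouxMap_inr (mem_twoSlitDomain_of_re h0 h1), Complex.ext_iff] at hw'
    have e1 : (exp (2 * I * φ) * w * hyperF x).im = 0 := by simpa using hw'.1
    have e2 : (exp (2 * I * φ) * w * hyperF (1 - x)).re = 0 := by
      have := hw'.2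
      simp only [add_im, ofReal_im, mul_im, I_im, I_re, neg_re, ofReal_re, neg_im, zero_im] at this
      linarith
    have := eq_zero_of_sector (abs_im_hyperF_lt h1) (abs_im_hyperF_lt (z := 1 - x) (by simpa using h0))
      e1 e2
    exact (mul_eq_zero.1 this).resolve_left (exp_two_ne_zero φ)
  refine ⟨(LinearEquiv.ofInjectiveEndo L.toLinearMap hinj).toContinuousLinearEquiv, ?_⟩
  ext
  all_goals rfl

/-- Ensures that local continuations of a solution cannot leave the disc, even when they start on
its boundary. -/
theorem HyperBoutroux.mem_solutionDisc {φ : ℝ} {x : ℂ} (h : HyperBoutroux φ x) (h0 : 0 ≤ x.re)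
    (h1 : x.re ≤ 1) (him : x.im ≠ 0) : x ∈ solutionDisc := by
  have key : ∀ {φ : ℝ} {x : ℂ}, HyperBoutroux φ x → 0 < x.im → x ∈ solutionDisc := by
    intro φ x h him
    by_contra hd
    have := re_hyperY_mul_conj_neg him (not_le.1 hd)
    rw [h.re_mul_conj] at this
    exact lt_irrefl _ this
  rcases lt_or_gt_of_ne him with h' | h'
  · have := conj_mem_solutionDisc (key (h.conj h0 h1) (by simpa using h'))
    rwa [Complex.conj_conj] at this
  · exact key h h'

/-- Solutions off the real axis can be continued smoothly. -/
theorem HyperBoutroux.exists_local {φ : ℝ} {x : ℂ} (h : HyperBoutroux φ x)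
    (hx : x ∈ solutionDisc) (him : x.im ≠ 0) {n : WithTop ℕ∞} (hn : n ≠ 0) :
    ∃ ψ : ℝ → ℂ, ContDiffAt ℝ n ψ φ ∧
      ∀ᶠ θ in 𝓝 φ, ψ θ ∈ solutionDisc ∧ HyperBoutroux θ (ψ θ) := by
  have hr := re_mem_of_mem_solutionDisc hx
  have h0 : 0 < x.re := lt_of_le_of_ne hr.1 fun e =>
    him (by rw [eq_zero_of_mem_solutionDisc hx e.symm, zero_im])
  have h1 : x.re < 1 := lt_of_le_of_ne hr.2 fun e =>
    him (by rw [eq_one_of_mem_solutionDisc hx e, one_im])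
  have hcd : ContDiffAt ℝ n boutrouxMap (φ, x) :=
    contDiffAt_boutrouxMap (mem_twoSlitDomain_of_re h0 h1)
  have hinv := isInvertible_fderiv_boutrouxMap (φ := φ) h0 h1
  have hψ := hcd.contDiffAt_implicitFunction hn hinv
  have hself : hcd.implicitFunction hn hinv φ = x := hcd.implicitFunction_apply_self hn hinv
  have hev := hcd.eventually_apply_implicitFunction hn hinv
  refine ⟨hcd.implicitFunction hn hinv, hψ, ?_⟩
  have hU : {z : ℂ | 0 < z.re ∧ z.re < 1 ∧ z.im ≠ 0} ∈ 𝓝 (hcd.implicitFunction hn hinv φ) := by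
    rw [hself]
    exact ((continuous_re.continuousAt.eventually (lt_mem_nhds h0)).and
      ((continuous_re.continuousAt.eventually (gt_mem_nhds h1)).and
        (continuous_im.continuousAt.eventually (isOpen_ne.mem_nhds him))))
  filter_upwards [hev, hψ.continuousAt hU] with θ h2 h3
  rw [boutrouxMap_eq_zero_iff.2 h, boutrouxMap_eq_zero_iff] at h2
  exact ⟨h2.mem_solutionDisc h3.1.le h3.2.1.le h3.2.2, h2⟩

/-! ### Existence and regularity of the solution -/

theorem exp_two_add_pi_div_two (φ : ℝ) :
    exp (2 * I * ((φ + Real.pi / 2 : ℝ) : ℂ)) = -exp (2 * I * φ) := by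
  rw [show 2 * I * ((φ + Real.pi / 2 : ℝ) : ℂ) = 2 * I * φ + Real.pi * I by push_cast; ring,
    exp_add, exp_pi_mul_I, mul_neg_one]

theorem hyperBoutroux_periodic : Function.Periodic HyperBoutroux (Real.pi / 2) := by
  intro φ
  funext x
  rw [HyperBoutroux, HyperBoutroux, exp_two_add_pi_div_two, neg_mul, neg_mul, neg_im, neg_re,
    neg_eq_zero, neg_eq_zero]

theorem exp_two_pi_div_four : exp (2 * I * ((Real.pi / 4 : ℝ) : ℂ)) = I := by
  rw [show 2 * I * ((Real.pi / 4 : ℝ) : ℂ) = Real.pi / 2 * I by push_cast; ring,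
    exp_pi_div_two_mul_I]

theorem hyperBoutroux_zero_one : HyperBoutroux 0 1 := by
  rw [hyperBoutroux_one_iff]
  simp

theorem hyperBoutroux_pi_div_four_zero : HyperBoutroux (Real.pi / 4) 0 := by
  rw [hyperBoutroux_zero_iff, exp_two_pi_div_four, I_re]

/-- Solutions on the real axis only occur at the multiples of `π / 4`. -/
theorem HyperBoutroux.exists_int_of_im_eq_zero {φ : ℝ} {x : ℂ} (h : HyperBoutroux φ x)
    (hx : x ∈ solutionDisc) (him : x.im = 0) : ∃ m : ℤ, φ = m * (Real.pi / 4) := by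
  obtain ⟨r, rfl⟩ : ∃ r : ℝ, x = r := ⟨x.re, Complex.ext rfl (by simpa using him)⟩
  have e : exp (2 * I * φ) = Real.cos (2 * φ) + Real.sin (2 * φ) * I := by
    rw [show 2 * I * (φ : ℂ) = ((2 * φ : ℝ) : ℂ) * I by push_cast; ring, exp_mul_I, ofReal_cos,
      ofReal_sin]
  have e1 : (exp (2 * I * φ)).re = Real.cos (2 * φ) := by
    rw [e]; simp [-ofReal_cos, -ofReal_sin]
  have e2 : (exp (2 * I * φ)).im = Real.sin (2 * φ) := by
    rw [e]; simp [-ofReal_cos, -ofReal_sin]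
  rcases eq_endpoints_or_mem_Ioo_of_mem_Icc (show r ∈ Icc (0 : ℝ) 1 from ofReal_mem_solutionDisc.1 hx)
    with rfl | rfl | hr
  · rw [ofReal_zero, hyperBoutroux_zero_iff, e1, Real.cos_eq_zero_iff] at h
    obtain ⟨k, hk⟩ := h
    exact ⟨2 * k + 1, by push_cast; linarith⟩
  · rw [ofReal_one, hyperBoutroux_one_iff, e2, Real.sin_eq_zero_iff] at h
    obtain ⟨k, hk⟩ := h
    exact ⟨2 * k, by push_cast; linarith⟩
  · exact (hyperBoutroux_ofReal_false hr.1 hr.2 h).elim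

/-- The parameters for which a solution exists. -/
def solvableSet : Set ℝ := {φ | ∃ x ∈ solutionDisc, HyperBoutroux φ x}

theorem isClosed_solutionDisc : IsClosed solutionDisc :=
  isClosed_le continuous_normSq continuous_re

theorem isCompact_solutionDisc : IsCompact solutionDisc := by
  refine (isCompact_closedBall (0 : ℂ) 1).of_isClosed_subset isClosed_solutionDisc fun x hx => ?_
  have hx' : normSq x ≤ x.re := hx
  rw [mem_closedBall_zero_iff, ← sq_le_one_iff₀ (norm_nonneg x), ← normSq_eq_norm_sq]
  exact hx'.trans (re_mem_of_mem_solutionDisc hx).2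

instance : CompactSpace solutionDisc := isCompact_iff_compactSpace.1 isCompact_solutionDisc

theorem isClosed_hyperBoutroux :
    IsClosed {p : ℝ × solutionDisc | HyperBoutroux p.1 p.2} := by
  have hc : Continuous fun p : ℝ × solutionDisc => exp (2 * I * (p.1 : ℂ)) := by fun_prop
  have h1 : Continuous fun p : ℝ × solutionDisc => hyperY p.2 :=
    continuousOn_hyperY.comp_continuous (by fun_prop)
      fun p => (re_mem_of_mem_solutionDisc p.2.2).2
  have h2 : Continuous fun p : ℝ × solutionDisc => hyperY (1 - p.2) :=
    continuousOn_hyperY.comp_continuous (by fun_prop)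
      fun p => by simpa using (re_mem_of_mem_solutionDisc p.2.2).1
  exact (isClosed_eq (continuous_im.comp (hc.mul h1)) continuous_const).inter
    (isClosed_eq (continuous_re.comp (hc.mul h2)) continuous_const)

/-- The solvable parameters are the projection of a closed set along the compact disc. -/
theorem isClosed_solvableSet : IsClosed solvableSet := by
  have := isClosedMap_fst_of_compactSpace (X := ℝ) (Y := solutionDisc) _ isClosed_hyperBoutroux
  convert this using 1
  ext φ
  constructor
  · rintro ⟨x, hx, h⟩
    exact ⟨(φ, ⟨x, hx⟩), h, rfl⟩
  · rintro ⟨p, h, rfl⟩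
    exact ⟨p.2, p.2.2, h⟩

theorem neg_mem_solvableSet {φ : ℝ} (h : φ ∈ solvableSet) : -φ ∈ solvableSet := by
  obtain ⟨x, hx, h⟩ := h
  have hr := re_mem_of_mem_solutionDisc hx
  exact ⟨_, conj_mem_solutionDisc hx, h.conj hr.1 hr.2⟩

theorem add_mem_solvableSet {φ : ℝ} (h : φ ∈ solvableSet) (k : ℤ) :
    φ + k * (Real.pi / 2) ∈ solvableSet := by
  obtain ⟨x, hx, h⟩ := h
  refine ⟨x, hx, ?_⟩
  rwa [hyperBoutroux_periodic.int_mul k φ]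

theorem exp_two_neg_pi_div_eight : ∃ r : ℝ, 0 < r ∧
    exp (2 * I * ((-(Real.pi / 8) : ℝ) : ℂ)) = r * (1 - I) := by
  refine ⟨√2 / 2, by positivity, ?_⟩
  rw [show 2 * I * ((-(Real.pi / 8) : ℝ) : ℂ) = ((-(Real.pi / 4) : ℝ) : ℂ) * I by push_cast; ring,
    exp_mul_I, ← ofReal_cos, ← ofReal_sin, Real.cos_neg, Real.sin_neg, Real.cos_pi_div_four,
    Real.sin_pi_div_four]
  push_cast
  ring

/-- On Re x = 1/2 one has 1-x = conj x, and c is a positive multiple of 1-i, so both equations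
collapse to Im Y(x) = Re Y(x). The difference Im Y - Re Y is negative at x = 1/2 and equals Im Φ(x)
> 0 at x = (1+i)/2, the top of the disc. -/
theorem neg_pi_div_eight_mem_solvableSet : -(Real.pi / 8) ∈ solvableSet := by
  set g : ℝ → ℂ := fun y => 1 / 2 + y * I with hg
  have gre : ∀ y, (g y).re = 1 / 2 := fun y => by simp [hg]
  have gim : ∀ y, (g y).im = y := fun y => by simp [hg]
  have hY : ContinuousOn (fun y => hyperY (g y)) (Icc 0 (1 / 2)) :=
    continuousOn_hyperY.comp (by fun_prop) fun y _ => by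
      rw [mem_ofPred_eq, gre]; norm_num
  have hu : ContinuousOn (fun y => (hyperY (g y)).im - (hyperY (g y)).re) (Icc 0 (1 / 2)) :=
    (continuous_im.comp_continuousOn hY).sub (continuous_re.comp_continuousOn hY)
  have h0 : (hyperY (g 0)).im - (hyperY (g 0)).re ≤ 0 := by
    obtain ⟨r, hr, e⟩ := exists_hyperY_ofReal (x := 1 / 2) (by norm_num)
    have : g 0 = ((1 / 2 : ℝ) : ℂ) := by simp [hg]
    rw [this, e, ofReal_im, ofReal_re]
    linarith
  have h1 : 0 ≤ (hyperY (g (1 / 2))).im - (hyperY (g (1 / 2))).re := by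
    have hp := im_hyperPhi_pos (z := g (1 / 2)) (by rw [gim]; norm_num)
    rw [hyperY, mul_im, mul_re, gre, gim]
    linarith
  obtain ⟨y, hy, e⟩ := intermediate_value_Icc (by norm_num) hu ⟨h0, h1⟩
  have e' : (hyperY (g y)).im - (hyperY (g y)).re = 0 := e
  obtain ⟨r, hr, ec⟩ := exp_two_neg_pi_div_eight
  have es : 1 - g y = (starRingEnd ℂ) (g y) := by
    apply Complex.ext
    · rw [sub_re, conj_re, gre]; norm_num
    · rw [sub_im, conj_im, gim]; norm_num
  refine ⟨g y, ?_, ?_, ?_⟩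
  · change normSq (g y) ≤ (g y).re
    rw [normSq_apply, gre, gim]
    nlinarith [hy.1, hy.2]
  · rw [ec, mul_assoc, im_ofReal_mul, mul_im]
    simp only [sub_re, sub_im, one_re, one_im, I_re, I_im]
    linear_combination r * e'
  · rw [ec, mul_assoc, re_ofReal_mul, mul_re, es, hyperY_conj (Or.inr (by rw [gre]; norm_num)),
      conj_re, conj_im]
    simp only [sub_re, sub_im, one_re, one_im, I_re, I_im]
    linear_combination (-r) * e'

theorem mem_interior_solvableSet {φ : ℝ} (h : φ ∈ solvableSet)
    (hφ : ∀ m : ℤ, φ ≠ m * (Real.pi / 4)) : φ ∈ interior solvableSet := by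
  obtain ⟨x, hx, h⟩ := h
  have him : x.im ≠ 0 := fun h0 => by
    obtain ⟨m, hm⟩ := h.exists_int_of_im_eq_zero hx h0
    exact hφ m hm
  obtain ⟨ψ, -, hψ⟩ := h.exists_local hx him (n := 1) one_ne_zero
  rw [mem_interior_iff_mem_nhds]
  filter_upwards [hψ] with θ hθ using ⟨_, hθ⟩

/-- Between consecutive multiples of π/4 solvability is open and relatively closed. The symmetries φ
↦ -φ and φ ↦ φ + π/2 carry the one known solution to the midpoint of every such interval, and
closedness adds the endpoints. -/
theorem solvableSet_eq_univ : solvableSet = univ := by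
  refine eq_univ_of_forall fun φ => ?_
  have hπ := Real.pi_pos
  set m := ⌊φ / (Real.pi / 4)⌋ with hm
  have hm1 : m * (Real.pi / 4) ≤ φ := by
    rw [← le_div_iff₀ (by positivity)]; exact Int.floor_le _
  have hm2 : φ < (m + 1) * (Real.pi / 4) := by
    rw [← div_lt_iff₀ (by positivity)]; exact Int.lt_floor_add_one _
  -- the midpoint of the interval is a solvable parameter
  have hmid : (2 * m + 1) * (Real.pi / 8) ∈ solvableSet := by
    rcases Int.even_or_odd' m with ⟨k, hk | hk⟩
    · have := add_mem_solvableSet (neg_mem_solvableSet neg_pi_div_eight_mem_solvableSet) k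
      rw [hk]
      convert this using 1
      push_cast; ring
    · have := add_mem_solvableSet neg_pi_div_eight_mem_solvableSet (k + 1)
      rw [hk]
      convert this using 1
      push_cast; ring
  have hint : ∀ θ ∈ Ioo (m * (Real.pi / 4)) ((m + 1) * (Real.pi / 4)),
      ∀ n : ℤ, θ ≠ n * (Real.pi / 4) := by
    rintro θ ⟨h1, h2⟩ n rfl
    have h3 : (m : ℝ) < n := lt_of_mul_lt_mul_right h1 (by positivity)
    have h4 : (n : ℝ) < m + 1 := lt_of_mul_lt_mul_right h2 (by positivity)
    have h5 : m < n := by exact_mod_cast h3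
    have h6 : n < m + 1 := by exact_mod_cast h4
    omega
  have hIoo : Ioo (m * (Real.pi / 4)) ((m + 1) * (Real.pi / 4)) ⊆ solvableSet := by
    have hmem : (2 * m + 1) * (Real.pi / 8) ∈
        Ioo (m * (Real.pi / 4)) ((m + 1) * (Real.pi / 4)) := by
      constructor <;> nlinarith
    refine Subset.trans (isPreconnected_Ioo.subset_of_closure_inter_subset isOpen_interior
      ⟨_, hmem, mem_interior_solvableSet hmid (hint _ hmem)⟩ ?_) interior_subset
    rintro θ ⟨h1, h2⟩
    exact mem_interior_solvableSet
      (closure_minimal interior_subset isClosed_solvableSet h1) (hint θ h2)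
  rcases eq_or_lt_of_le hm1 with h | h
  · rw [← isClosed_solvableSet.closure_eq]
    refine closure_mono hIoo ?_
    rw [closure_Ioo (by nlinarith)]
    exact ⟨hm1, hm2.le⟩
  · exact hIoo ⟨h, hm2⟩

theorem exists_hyperBoutroux (φ : ℝ) : ∃ x : solutionDisc, HyperBoutroux φ x := by
  obtain ⟨x, hx, h⟩ : φ ∈ solvableSet := solvableSet_eq_univ ▸ mem_univ φ
  exact ⟨⟨x, hx⟩, h⟩

/-- The solution of the reduced Boutroux equations in the disc. -/
noncomputable def boutrouxSolution (φ : ℝ) : solutionDisc := (exists_hyperBoutroux φ).choose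

theorem hyperBoutroux_boutrouxSolution (φ : ℝ) : HyperBoutroux φ (boutrouxSolution φ) :=
  (exists_hyperBoutroux φ).choose_spec

theorem eq_boutrouxSolution {φ : ℝ} {x : ℂ} (hx : x ∈ solutionDisc) (h : HyperBoutroux φ x) :
    x = boutrouxSolution φ :=
  (hyperBoutroux_boutrouxSolution φ).unique (boutrouxSolution φ).2 hx h

/-- By uniqueness the closed solution set is the graph of this map, and a map into a compact space
with closed graph is continuous. -/
theorem continuous_boutrouxSolution : Continuous boutrouxSolution := by
  rw [continuous_iff_isClosed]
  intro C hC
  have := isClosedMap_fst_of_compactSpace (X := ℝ) (Y := solutionDisc) _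
    (isClosed_hyperBoutroux.inter (hC.preimage continuous_snd))
  convert this using 1
  ext φ
  constructor
  · intro h
    exact ⟨(φ, boutrouxSolution φ), ⟨hyperBoutroux_boutrouxSolution φ, h⟩, rfl⟩
  · rintro ⟨p, ⟨h1, h2⟩, rfl⟩
    have : p.2 = boutrouxSolution p.1 := Subtype.ext (eq_boutrouxSolution p.2.2 h1)
    rw [mem_preimage, ← this]
    exact h2

/-- Off the multiples of π/4 the solution is not real, hence lies in the strip where both functions
are holomorphic. The implicit function is again a solution in the disc, so uniqueness identifies the
two. -/
theorem contDiffAt_boutrouxSolution {φ : ℝ} (hφ : ∀ m : ℤ, φ ≠ m * (Real.pi / 4))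
    {n : WithTop ℕ∞} (hn : n ≠ 0) : ContDiffAt ℝ n (fun φ => (boutrouxSolution φ : ℂ)) φ := by
  have h := hyperBoutroux_boutrouxSolution φ
  have hx := (boutrouxSolution φ).2
  have him : (boutrouxSolution φ : ℂ).im ≠ 0 := fun h0 => by
    obtain ⟨m, hm⟩ := h.exists_int_of_im_eq_zero hx h0
    exact hφ m hm
  obtain ⟨ψ, hψ, hev⟩ := h.exists_local hx him hn
  refine hψ.congr_of_eventuallyEq ?_
  filter_upwards [hev] with θ hθ using (eq_boutrouxSolution hθ.1 hθ.2).symm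

theorem boutrouxSolution_neg (φ : ℝ) :
    (boutrouxSolution (-φ) : ℂ) = (starRingEnd ℂ) (boutrouxSolution φ) := by
  have hx := (boutrouxSolution φ).2
  have hr := re_mem_of_mem_solutionDisc hx
  exact (eq_boutrouxSolution (conj_mem_solutionDisc hx)
    ((hyperBoutroux_boutrouxSolution φ).conj hr.1 hr.2)).symm

theorem boutrouxSolution_pi_div_four : (boutrouxSolution (Real.pi / 4) : ℂ) = 0 :=
  (eq_boutrouxSolution (by simp [solutionDisc]) hyperBoutroux_pi_div_four_zero).symm

theorem proposition8p15 :
    ∃ A : ℝ → ℂ,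
      -- for each `φ`, `A φ` is the unique solution of the Boutroux equations
      (∀ φ : ℝ, SolvesBoutroux φ (A φ) ∧ ∀ B : ℂ, SolvesBoutroux φ B → B = A φ) ∧
      -- symmetries
      (∀ φ : ℝ, A (φ + Real.pi / 2) = A φ) ∧
      (∀ φ : ℝ, A (-φ) = (starRingEnd ℂ) (A φ)) ∧
      -- special values and bounds
      A 0 = 8 / 27 ∧ A (Real.pi / 4) = 0 ∧ A (-(Real.pi / 4)) = 0 ∧
      (∀ φ : ℝ, 0 ≤ (A φ).re ∧ (A φ).re ≤ 8 / 27) ∧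
      -- regularity
      Continuous A ∧
      ContDiffOn ℝ ((⊤ : ℕ∞) : WithTop ℕ∞) A {φ : ℝ | ∀ m : ℤ, φ ≠ m * (Real.pi / 4)} := by
  refine ⟨fun φ => 8 / 27 * boutrouxSolution φ, fun φ => ⟨?_, fun B hB => ?_⟩, fun φ => ?_,
    fun φ => ?_, ?_, ?_, ?_, fun φ => ?_, ?_, fun φ hφ => ?_⟩
  · exact solvesBoutroux_iff.2 ⟨(boutrouxSolution φ).2, hyperBoutroux_boutrouxSolution φ⟩
  · rw [show B = 8 / 27 * (27 / 8 * B) by ring, solvesBoutroux_iff] at hB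
    simp only [← eq_boutrouxSolution hB.1 hB.2]
    ring
  -- The shift replaces c by -c, which leaves both reduced equations unchanged.
  · have h := hyperBoutroux_boutrouxSolution (φ + Real.pi / 2)
    rw [hyperBoutroux_periodic φ] at h
    simp only [eq_boutrouxSolution (boutrouxSolution (φ + Real.pi / 2)).2 h]
  · simp only [boutrouxSolution_neg, map_mul, map_div₀, Complex.conj_ofNat]
  · simp only [← eq_boutrouxSolution (by simp [solutionDisc]) hyperBoutroux_zero_one, mul_one]
  · simp only [boutrouxSolution_pi_div_four, mul_zero]
  · simp only [boutrouxSolution_neg, boutrouxSolution_pi_div_four, map_zero, mul_zero]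
  · have hr := re_mem_of_mem_solutionDisc (boutrouxSolution φ).2
    have e : (8 / 27 * (boutrouxSolution φ : ℂ)).re = 8 / 27 * (boutrouxSolution φ : ℂ).re := by
      rw [show (8 / 27 : ℂ) = ((8 / 27 : ℝ) : ℂ) by push_cast; rfl, re_ofReal_mul]
    rw [e]
    constructor <;> linarith
  · exact continuous_const.mul (continuous_subtype_val.comp continuous_boutrouxSolution)
  · exact (contDiffAt_const.mul (contDiffAt_boutrouxSolution hφ (by simp))).contDiffWithinAt
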